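/- **Setting.** Let $D\in\mathbb N$ and let $\Lambda\subset\mathbb Z^D$ be finite; write $x\sim y$ if $\sum_i|x_i-y_i|=1$. Let $\mathcal F_\Lambda$ be the bosonic Fock space over $\ell^2(\Lambda)$, with annihilation operators $b_u$ ($u\in\Lambda$) and with the orthonormal basis $|\vec m\rangle$ of occupation number states, $\vec m\in\mathcal M_\Lambda=\{0,1,2,\dots\}^{\Lambda}$, and put $N_\Lambda(\vec m)=\sum_{u\in\Lambda}\vec m(u)$. Let $\gamma\ge 0$, $\omega>0$, $\alpha\in\mathbb C$, $\beta=\alpha/\omega$. Let $(v_x)_{x\in\Lambda}$ be independent random variables with common distribution $\rho(v)\,\mathrm dv$, where $\rho$ is a bounded probability density supported on $[0,V_+]$. On $\mathcal H_\Lambda=\ell^2(\Lambda;\mathcal F_\Lambda)$ consider the self-adjoint operator $$H_\Lambda=\gamma\Delta_\Lambda-(\alpha b_{\mathbf X}^\dagger+\alpha^* b_{\mathbf X})+\omega\sum_{u\in\Lambda}b_u^\dagger b_u+\frac{|\alpha|^2}{\omega}+V_\Lambda ,$$ where $\Delta_\Lambda\psi(x)=\sum_{y\in\Lambda,\,y\sim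 x}(\psi(x)-\psi(y))$, $b_{\mathbf X}\psi(x)=b_x\psi(x)$, $b_{\mathbf X}^\dagger\psi(x)=b_x^\dagger\psi(x)$ and $V_\Lambda\psi(x)=v_x\psi(x)$. For $x\in\Lambda$ and $\vec m\in\mathcal M_\Lambda$ let $|x,\vec m\rangle=|x\rangle\otimes e^{\beta b_x^\dagger-\beta^*b_x}|\vec m\rangle$. For $k=0,1,2,\dots$ let ${\bf J}_k=[0,\omega k+V_++4D\gamma]$. Define $$G_\Lambda(x,\vec m;y,\vec\xi;z)=\langle x,\vec m|(H_\Lambda-z)^{-1}|y,\vec\xi\rangle,\qquad Q_\Lambda(x,\vec m;y,\vec\xi;{\bf J}_k)=\sum_{E\in\sigma(H_\Lambda)\cap{\bf J}_k}\bigl|\langle x,\vec m|P_{\{E\}}(H_\Lambda)|y,\vec\xi\rangle\bigr| ,$$ where $P_{\{E\}}(H_\Lambda)$ is the orthogonal projection onto the eigenspace of $H_\Lambda$ for the eigenvalue $E$. Write $a\vee b=\max(a,b)$. **Theorem 1.7.** For all $0<s<1$, all $\rho$ and $V_+$ as above, all $\omega>0$ and all $\kappa\in\mathbb R$ there is a constant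 $C<\infty$, depending only on $s$, $\rho$, $V_+$, $\omega$ and $\kappa$, such that for every $D$, every $\gamma\ge0$ with $4D\gamma\le\kappa$, every $\alpha\in\mathbb C$, every finite $\Lambda\subset\mathbb Z^D$, every $k\in\{0,1,2,\dots\}$, all $x,y\in\Lambda$ and all $\vec m,\vec\xi\in\mathcal M_\Lambda$, $$\mathbb E\,Q_\Lambda(x,\vec m;y,\vec\xi;{\bf J}_k)\ \le\ C\left[\frac{k\vee1}{N_\Lambda(\vec\xi)\vee1}\right]^{1-\frac{s}{2-s}}\left[\sum_{\vec\lambda\in\mathcal M_\Lambda}\int_{{\bf J}_k}\mathbb E\,\bigl|G_\Lambda(x,\vec\lambda;y,\vec\xi;E)\bigr|^s\,\mathrm dE\right]^{\frac1{2-s}} ,$$ where the right-hand side may be $+\infty$. In particular, for fixed model parameters $D,\gamma,\omega,\alpha$ the constant does not depend on $\Lambda$ or $k$. -/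

import Mathlib

open MeasureTheory
open scoped ENNReal

noncomputable section

namespace UnboundedOperator

variable {E : Type*} [NormedAddCommGroup E] [InnerProductSpace ℂ E]

/-- `R` is the bounded two-sided inverse of `A - z`, where `A` is an operator in `E` with its
domain. -/
def IsResolventAt (A : E →ₗ.[ℂ] E) (z : ℂ) (R : E →L[ℂ] E) : Prop :=
  (∀ φ : E, ∃ h : R φ ∈ A.domain, A ⟨R φ, h⟩ - z • R φ = φ) ∧
    ∀ ψ : A.domain, R (A ψ - z • (ψ : E)) = ψ

/-- The spectrum: all `z` for which `A - z` has no bounded inverse. -/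
def spectrum (A : E →ₗ.[ℂ] E) : Set ℂ := {z | ¬ ∃ R : E →L[ℂ] E, IsResolventAt A z R}

open Classical in
/-- The resolvent `(A - z)⁻¹` for `z` off the spectrum (and `0` by convention on the spectrum). -/
def resolvent (A : E →ₗ.[ℂ] E) (z : ℂ) : E →L[ℂ] E :=
  if h : ∃ R : E →L[ℂ] E, IsResolventAt A z R then h.choose else 0

/-- The eigenspace `{ψ ∈ dom A | A ψ = z ψ}`. -/
def eigenspace (A : E →ₗ.[ℂ] E) (z : ℂ) : Submodule ℂ E where
  carrier := {ψ | ∃ h : ψ ∈ A.domain, A ⟨ψ, h⟩ = z • ψ}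
  zero_mem' := ⟨A.domain.zero_mem, by
    have : (⟨0, A.domain.zero_mem⟩ : A.domain) = 0 := rfl
    rw [this, A.map_zero, smul_zero]⟩
  add_mem' := by
    rintro a b ⟨ha, ha'⟩ ⟨hb, hb'⟩
    refine ⟨A.domain.add_mem ha hb, ?_⟩
    have : (⟨a + b, A.domain.add_mem ha hb⟩ : A.domain) = ⟨a, ha⟩ + ⟨b, hb⟩ := rfl
    rw [this, A.map_add, ha', hb', smul_add]
  smul_mem' := by
    rintro c a ⟨ha, ha'⟩
    refine ⟨A.domain.smul_mem c ha, ?_⟩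
    have : (⟨c • a, A.domain.smul_mem c ha⟩ : A.domain) = c • ⟨a, ha⟩ := rfl
    rw [this, A.map_smul, ha', smul_comm]

/-- The orthogonal projection onto the eigenspace of `A` for the eigenvalue `z`, which is the
spectral projection `P_{z}(A)` when `A` is self-adjoint. The eigenspace of a closed operator is
closed, so that the closure below does not enlarge it. -/
def eigenprojection [CompleteSpace E] (A : E →ₗ.[ℂ] E) (z : ℂ) : E →L[ℂ] E :=
  (eigenspace A z).topologicalClosure.starProjection

end UnboundedOperator

namespace Holstein

variable {D : ℕ}

/-- Two lattice sites are neighbours if their `ℓ¹` distance is one. -/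
def Adjacent (x y : Fin D → ℤ) : Prop := ∑ i, |x i - y i| = 1

instance : DecidableRel (Adjacent (D := D)) := fun x y =>
  inferInstanceAs (Decidable (∑ i, |x i - y i| = 1))

/-- Oscillator configurations over a finite region: the occupation number of every site. -/
abbrev Config (Λ : Finset (Fin D → ℤ)) : Type := Λ → ℕ

/-- The total excitation number. -/
def excitation {Λ : Finset (Fin D → ℤ)} (m : Config Λ) : ℕ := ∑ u, m u

/-- Particle position together with the occupation numbers of the oscillators. -/
abbrev State (Λ : Finset (Fin D → ℤ)) : Type := Λ × Config Λ

/-- The Hilbert space `ℓ²(Λ; F)`, with the bosonic Fock space `F` over `ℓ²(Λ)` in its occupation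
number representation `F = ℓ²(ℕ^Λ)`. -/
abbrev Space (Λ : Finset (Fin D → ℤ)) : Type := lp (fun _ : State Λ => ℂ) 2

variable {Λ : Finset (Fin D → ℤ)}

/-- The annihilation operator `b_u`, acting on arbitrary functions of the occupation numbers:
`b_u |n⟩ = √(n u) |n - 1_u⟩`. -/
def annihilate (u : Λ) : (State Λ → ℂ) →ₗ[ℂ] (State Λ → ℂ) where
  toFun ψ := fun p => (Real.sqrt ((p.2 u : ℝ) + 1) : ℂ) * ψ (p.1, p.2 + Pi.single u 1)
  map_add' := by intros; funext p; simp [mul_add]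
  map_smul' := by intros; funext p; simp; ring

/-- The creation operator `b_u†`, acting on arbitrary functions of the occupation numbers:
`b_u† |n⟩ = √(n u + 1) |n + 1_u⟩`. -/
def create (u : Λ) : (State Λ → ℂ) →ₗ[ℂ] (State Λ → ℂ) where
  toFun ψ := fun p => (Real.sqrt (p.2 u) : ℂ) * ψ (p.1, p.2 - Pi.single u 1)
  map_add' := by intros; funext p; simp [mul_add]
  map_smul' := by intros; funext p; simp; ring

/-- The annihilation operator at the particle position. -/
def annihilateAtParticle : (State Λ → ℂ) →ₗ[ℂ] (State Λ → ℂ) where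
  toFun ψ := fun p => annihilate p.1 ψ p
  map_add' := by intros; funext p; simp
  map_smul' := by intros; funext p; simp

/-- The creation operator at the particle position. -/
def createAtParticle : (State Λ → ℂ) →ₗ[ℂ] (State Λ → ℂ) where
  toFun ψ := fun p => create p.1 ψ p
  map_add' := by intros; funext p; simp
  map_smul' := by intros; funext p; simp

/-- The discrete Laplacian `(Δ ψ)(x) = ∑_{y ∈ Λ, y ∼ x} (ψ(x) - ψ(y))`. -/
def laplacian : (State Λ → ℂ) →ₗ[ℂ] (State Λ → ℂ) where
  toFun ψ := fun p => ∑ y : ↥Λ, if Adjacent p.1.1 y.1 then ψ p - ψ (y, p.2) else 0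
  map_add' := by
    intros; funext p; simp only [Pi.add_apply, ← Finset.sum_add_distrib]
    exact Finset.sum_congr rfl fun _ _ => by split_ifs <;> ring
  map_smul' := by
    intros; funext p; simp only [Pi.smul_apply, RingHom.id_apply, Finset.smul_sum]
    exact Finset.sum_congr rfl fun _ _ => by split_ifs <;> simp [mul_sub]

/-- Multiplication by the on-site potential `v` at the particle position. -/
def potential (v : Λ → ℝ) : (State Λ → ℂ) →ₗ[ℂ] (State Λ → ℂ) where
  toFun ψ := fun p => (v p.1 : ℂ) * ψ p
  map_add' := by intros; funext p; simp [mul_add]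
  map_smul' := by intros; funext p; simp; ring

/-- The expression
`γ Δ - (α b_X† + α* b_X) + ω ∑_u b_u† b_u + |α|² / ω + V`
on arbitrary functions. -/
def hamiltonianExpr (γ ω : ℝ) (α : ℂ) (v : Λ → ℝ) : (State Λ → ℂ) →ₗ[ℂ] (State Λ → ℂ) :=
  (γ : ℂ) • laplacian - (α • createAtParticle + (starRingEnd ℂ) α • annihilateAtParticle)
    + (ω : ℂ) • ∑ u : Λ, create u ∘ₗ annihilate u
    + ((‖α‖ ^ 2 / ω : ℝ) : ℂ) • LinearMap.id + potential v

/-- The disordered Holstein Hamiltonian as an unbounded operator in `ℓ²(Λ; F)`, on its natural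
domain of all `ψ` in the Hilbert space for which the expression `H ψ` is in the Hilbert space.
For `ω > 0` this is the self-adjoint closure of the operator on finite combinations of occupation
number states. -/
def hamiltonian (γ ω : ℝ) (α : ℂ) (v : Λ → ℝ) : Space Λ →ₗ.[ℂ] Space Λ where
  domain :=
    { carrier := {ψ | Memℓp (hamiltonianExpr γ ω α v ⇑ψ) 2}
      zero_mem' := by
        simp only [Set.mem_ofPred_eq, lp.coeFn_zero, map_zero]
        exact zero_memℓp
      add_mem' := by
        intro a b ha hb
        simp only [Set.mem_ofPred_eq, lp.coeFn_add, map_add] at *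
        exact ha.add hb
      smul_mem' := by
        intro c a ha
        simp only [Set.mem_ofPred_eq, lp.coeFn_smul, map_smul] at *
        exact ha.const_smul c }
  toFun :=
    { toFun := fun ψ => ⟨hamiltonianExpr γ ω α v ⇑(ψ : Space Λ), ψ.2⟩
      map_add' := by
        intro a b; apply Subtype.ext; exact map_add (hamiltonianExpr γ ω α v) _ _
      map_smul' := by
        intro c a; apply Subtype.ext; exact map_smul (hamiltonianExpr γ ω α v) _ _ }

/-- The vector `|x⟩ ⊗ |m⟩`: particle at `x` and occupation numbers `m`. -/
def numberKet (x : Λ) (m : Config Λ) : State Λ → ℂ := Pi.single (x, m) 1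

/-- The function `|x⟩ ⊗ D_x(β)|m⟩`, where
`D_x(β) = exp(β b_x† - β* b_x) = exp(-|β|²/2) exp(β b_x†) exp(-β* b_x)`
is the displacement operator and both exponentials on the right are power series. Terms with
`j > m x` vanish because `b_x ^ j |m⟩ = 0`, and terms with `i > n x` do not contribute to the
coefficient at the occupation numbers `n`. -/
def displacedKetFun (β : ℂ) (x : Λ) (m : Config Λ) : State Λ → ℂ := fun p =>
  (Real.exp (-‖β‖ ^ 2 / 2) : ℂ) *
    ∑ j ∈ Finset.range (m x + 1), ∑ i ∈ Finset.range (p.2 x + 1),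
      (β ^ i / (i.factorial : ℂ)) * ((-(starRingEnd ℂ) β) ^ j / (j.factorial : ℂ)) *
        ((create x ^ i) ((annihilate x ^ j) (numberKet x m))) p

theorem annihilate_numberKet (x u : Λ) (m : Config Λ) :
    annihilate u (numberKet x m) =
      (Real.sqrt (m u) : ℂ) • numberKet x (m - Pi.single u 1) := by
  funext p
  obtain ⟨y, n⟩ := p
  simp only [annihilate, numberKet, LinearMap.coe_mk, AddHom.coe_mk, Pi.smul_apply, smul_eq_mul,
    Pi.single_apply, Prod.mk.injEq]
  by_cases h : y = x ∧ n + Pi.single u 1 = m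
  · obtain ⟨rfl, rfl⟩ := h
    simp
  · rw [if_neg h]
    by_cases h2 : y = x ∧ n = m - Pi.single u 1
    · obtain ⟨rfl, rfl⟩ := h2
      have h0 : m u = 0 := by
        by_contra hm
        refine h ⟨rfl, ?_⟩
        funext w
        by_cases hw : w = u
        · subst hw; simp; omega
        · simp [hw]
      simp [h0]
    · rw [if_neg h2]; simp

theorem create_numberKet (x u : Λ) (m : Config Λ) :
    create u (numberKet x m) =
      (Real.sqrt ((m u : ℝ) + 1) : ℂ) • numberKet x (m + Pi.single u 1) := by
  funext p
  obtain ⟨y, n⟩ := p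
  simp only [create, numberKet, LinearMap.coe_mk, AddHom.coe_mk, Pi.smul_apply, smul_eq_mul,
    Pi.single_apply, Prod.mk.injEq]
  by_cases h : y = x ∧ n = m + Pi.single u 1
  · obtain ⟨rfl, rfl⟩ := h
    simp
  · rw [if_neg h]
    by_cases h2 : y = x ∧ n - Pi.single u 1 = m
    · obtain ⟨rfl, rfl⟩ := h2
      have h0 : n u = 0 := by
        by_contra hm
        refine h ⟨rfl, ?_⟩
        funext w
        by_cases hw : w = u
        · subst hw; simp; omega
        · simp [hw]
      simp [h0]
    · rw [if_neg h2]; simp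

theorem annihilate_pow_numberKet (x u : Λ) (m : Config Λ) (j : ℕ) :
    ∃ c : ℂ, (annihilate u ^ j) (numberKet x m) = c • numberKet x (m - Pi.single u j) := by
  induction j with
  | zero => exact ⟨1, by simp⟩
  | succ j ih =>
    obtain ⟨c, hc⟩ := ih
    refine ⟨c * (Real.sqrt ((m - Pi.single u j : Config Λ) u) : ℂ), ?_⟩
    rw [pow_succ', Module.End.mul_apply, hc, map_smul, annihilate_numberKet, smul_smul,
      tsub_tsub, ← Pi.single_add]

theorem create_pow_numberKet (x u : Λ) (m : Config Λ) (i : ℕ) :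
    (create u ^ i) (numberKet x m) =
      (Real.sqrt ((m u + 1).ascFactorial i) : ℂ) • numberKet x (m + Pi.single u i) := by
  induction i with
  | zero => simp
  | succ i ih =>
    rw [pow_succ', Module.End.mul_apply, ih, map_smul, create_numberKet, smul_smul, add_assoc,
      ← Pi.single_add, Nat.ascFactorial_succ]
    congr 1
    rw [← Complex.ofReal_mul, ← Real.sqrt_mul (by positivity)]
    congr 2
    simp
    ring

theorem creationSeries_memℓp (β : ℂ) (x : Λ) (l : Config Λ) :
    Memℓp (fun p : State Λ => ∑ i ∈ Finset.range (p.2 x + 1),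
      (β ^ i / (i.factorial : ℂ)) * ((create x ^ i) (numberKet x l)) p) 2 := by
  set f : State Λ → ℂ := fun p => ∑ i ∈ Finset.range (p.2 x + 1),
      (β ^ i / (i.factorial : ℂ)) * ((create x ^ i) (numberKet x l)) p with hf
  let g : ℕ → State Λ := fun i => (x, l + Pi.single x i)
  have hg : Function.Injective g := by
    intro i i' h
    simpa [g] using h
  have hzero : ∀ p ∉ Set.range g, ‖f p‖ ^ (2 : ℝ) = 0 := by
    intro p hp
    have : f p = 0 := by
      rw [hf]
      refine Finset.sum_eq_zero fun i _ => ?_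
      rw [create_pow_numberKet]
      have : numberKet x (l + Pi.single x i) p = 0 :=
        Pi.single_eq_of_ne (fun h => hp ⟨i, h.symm⟩) _
      simp [this]
    rw [this]; simp
  have hval : ∀ i, f (g i) =
      (β ^ i / (i.factorial : ℂ)) * (Real.sqrt ((l x + 1).ascFactorial i) : ℂ) := by
    intro i
    rw [hf]
    simp only
    rw [Finset.sum_eq_single i]
    · rw [create_pow_numberKet]; simp [numberKet, g]
    · intro i' _ hne
      rw [create_pow_numberKet]
      have : numberKet x (l + Pi.single x i') (g i) = 0 :=
        Pi.single_eq_of_ne (fun h => hne (hg h).symm) _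
      simp [this]
    · intro h; exact absurd (Finset.mem_range.2 (by simp [g])) h
  refine memℓp_gen ?_
  simp only [ENNReal.toReal_ofNat]
  refine (hg.summable_iff hzero).1 ?_
  refine Summable.of_nonneg_of_le (fun i => Real.rpow_nonneg (norm_nonneg _) _) (fun i => ?_)
    ((Real.summable_pow_div_factorial (2 * ‖β‖ ^ 2)).mul_left (2 ^ (l x)))
  have h1 : ((l x + 1).ascFactorial i : ℝ) = i.factorial * ((l x + i).choose i : ℝ) := by
    exact_mod_cast Nat.ascFactorial_eq_factorial_mul_choose (l x) i
  have h2 : ((l x + i).choose i : ℝ) ≤ 2 ^ (l x + i) := by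
    exact_mod_cast Nat.choose_le_two_pow _ _
  have h3 : (0 : ℝ) < i.factorial := by positivity
  rw [Function.comp_apply, hval, Real.rpow_two, norm_mul, norm_div, norm_pow, mul_pow,
    Complex.norm_real, Real.norm_eq_abs, sq_abs, Real.sq_sqrt (by positivity), h1,
    Complex.norm_natCast]
  calc (‖β‖ ^ i / (i.factorial : ℝ)) ^ 2 * (i.factorial * ((l x + i).choose i : ℝ))
      = (‖β‖ ^ 2) ^ i / i.factorial * ((l x + i).choose i : ℝ) := by
        field_simp
        ring
    _ ≤ (‖β‖ ^ 2) ^ i / i.factorial * 2 ^ (l x + i) := by gcongr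
    _ = 2 ^ (l x) * ((2 * ‖β‖ ^ 2) ^ i / i.factorial) := by rw [mul_pow, pow_add]; ring

theorem displacedKetFun_memℓp (β : ℂ) (x : Λ) (m : Config Λ) :
    Memℓp (displacedKetFun β x m) 2 := by
  choose c hc using annihilate_pow_numberKet x x m
  have key : displacedKetFun β x m = (Real.exp (-‖β‖ ^ 2 / 2) : ℂ) •
      ∑ j ∈ Finset.range (m x + 1), ((-(starRingEnd ℂ) β) ^ j / (j.factorial : ℂ) * c j) •
        (fun p : State Λ => ∑ i ∈ Finset.range (p.2 x + 1), (β ^ i / (i.factorial : ℂ)) *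
          ((create x ^ i) (numberKet x (m - Pi.single x j))) p) := by
    funext p
    rw [displacedKetFun, Pi.smul_apply, smul_eq_mul, Finset.sum_apply]
    congr 1
    refine Finset.sum_congr rfl fun j _ => ?_
    rw [Pi.smul_apply, smul_eq_mul, Finset.mul_sum]
    refine Finset.sum_congr rfl fun i _ => ?_
    rw [hc, map_smul, Pi.smul_apply, smul_eq_mul]
    ring
  rw [key]
  have hsum : Memℓp (∑ j ∈ Finset.range (m x + 1),
      ((-(starRingEnd ℂ) β) ^ j / (j.factorial : ℂ) * c j) •
        (fun p : State Λ => ∑ i ∈ Finset.range (p.2 x + 1), (β ^ i / (i.factorial : ℂ)) *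
          ((create x ^ i) (numberKet x (m - Pi.single x j))) p)) 2 := by
    refine Finset.sum_induction _ (fun f : State Λ → ℂ => Memℓp f 2) (fun a b ha hb => ha.add hb)
      zero_memℓp fun j _ => ?_
    have h := creationSeries_memℓp β x (m - Pi.single x j)
    exact h.const_smul ((-(starRingEnd ℂ) β) ^ j / (j.factorial : ℂ) * c j)
  exact hsum.const_smul (Real.exp (-‖β‖ ^ 2 / 2) : ℂ)

/-- The vector `|x, m⟩ = |x⟩ ⊗ D_x(β)|m⟩` of the eigenbasis of the Hamiltonian without hopping. -/
def displacedKet (β : ℂ) (x : Λ) (m : Config Λ) : Space Λ :=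
  ⟨displacedKetFun β x m, displacedKetFun_memℓp β x m⟩

/-- The Green's function `⟨x, m| (H - z)⁻¹ |y, ξ⟩`, with `β = α / ω`. -/
def greenFunction (γ ω : ℝ) (α : ℂ) (v : Λ → ℝ) (x : Λ) (m : Config Λ) (y : Λ) (ξ : Config Λ)
    (z : ℂ) : ℂ :=
  inner ℂ (displacedKet (α / ω) x m)
    (UnboundedOperator.resolvent (hamiltonian γ ω α v) z (displacedKet (α / ω) y ξ))

/-- The eigenfunction correlator
`∑_{E ∈ σ(H) ∩ J} |⟨x, m| P_{E}(H) |y, ξ⟩|`. -/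
def correlator (γ ω : ℝ) (α : ℂ) (v : Λ → ℝ) (x : Λ) (m : Config Λ) (y : Λ) (ξ : Config Λ)
    (J : Set ℝ) : ℝ≥0∞ :=
  ∑' E : ↥({E : ℝ | (E : ℂ) ∈ UnboundedOperator.spectrum (hamiltonian γ ω α v)} ∩ J),
    ‖inner ℂ (displacedKet (α / ω) x m)
      (UnboundedOperator.eigenprojection (hamiltonian γ ω α v) ((E : ℝ) : ℂ)
        (displacedKet (α / ω) y ξ))‖ₑ

/-- The law of independent potentials `(v_x)_{x ∈ Λ}`, each with distribution `ρ(v) dv`. -/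
def disorderLaw (ρ : ℝ → ℝ) (Λ : Finset (Fin D → ℤ)) : Measure (Λ → ℝ) :=
  Measure.pi fun _ => volume.withDensity fun t => ENNReal.ofReal (ρ t)

/-- The energy window `J_k = [0, ω k + V + 4 D γ]`. -/
def energyWindow (D : ℕ) (γ ω V : ℝ) (k : ℕ) : Set ℝ := Set.Icc 0 (ω * k + V + 4 * D * γ)

end Holstein

end

/-!
Fix all potentials except `t = v x` and write `H_t = W + t P + H₀` with `H₀` the free Hamiltonian
and `P` the projection onto the states with the particle at `x`. Although `P` has infinite rank, the
rank-one argument survives because the sum over all oscillator configurations is on the right-hand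
side of the bound.

If `η` is an eigenvector of `H_t` for the eigenvalue `E`, and `t'` is another coupling, then
`⟨η, φ⟩ = (t' - t) ⟨P η, (H_{t'} - E)⁻¹ φ⟩` (`inner_eigenvector_eq`). Expanding `P` in the kets
`|x, l⟩` bounds the eigenprojection `P_E |y, ξ⟩` by `V ∑_l ‖P_E |x, l⟩‖ |G_{t'}(x, l; y, ξ; E)|`
(`enorm_eigProj_le`). Raise this to the power `s`, multiply by `‖P_E |x, m⟩‖ ^ (2 - s)` and separate
the factors by `a ^ (2 - s) b ^ s ≤ a ^ 2 + b ^ 2`: the result is an integral of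
`|G_{t'}(x, l; y, ξ; E)| ^ s`, which does not depend on `t`, with respect to the spectral measures of
`H_t` at `|x, m⟩` and `|x, l⟩`. Averaged over `t`, these spectral measures have bounded densities
(`exists_measurable_majorant`). Spectral averaging holds for a perturbation `t P` of infinite rank at
unit vectors `φ` in the range of `P`: the function `t ↦ ⟨φ, (H_t - z)⁻¹ φ⟩` extends to the lower half
plane, where it is bounded by `1 / |im t|`, and Cauchy's theorem on a rectangle bounds its integral
against a weight that vanishes at the corners (`norm_integral_weight_le`). This gives
`lintegral_tsum_eigProj_rpow_le`.

Hölder's inequality (`tsum_indicator_inner_eigProj_le`) splits the correlator into this quantity, to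
the power `1 / (2 - s)`, and the mass that the spectral measure at `|y, ξ⟩` gives to the energy
window, to the power `(1 - s) / (2 - s)`. Since `|y, ξ⟩` is an eigenvector of `H₀` for `ω N(ξ)` and
`H - H₀` has norm at most `4 D γ + V` on it, the mass is `O((k / N(ξ)) ^ 2)`
(`tsum_energyWindow_eigProj_sq_le`). Finally the bound is averaged over `t'` and over the remaining
potentials with Jensen's inequality (`lintegral_pi_le_of_forall_update`).

The spectral theory is developed for `H₀ + W` with `R = (H₀ + 1)⁻¹` compact and `W` bounded, through
the bounded operators `1 + (W - (z + 1)) R`. To put the Holstein Hamiltonian on its maximal domain in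
this form, the displaced number states have to be an orthonormal eigenbasis of `H₀`. They satisfy the
ladder relations of `annihilate_displacedKetFun` and `create_displacedKetFun`, which give the
eigenvalue equation and orthonormality. They are complete because the adjoint of the displacement
operator at `β` is the one at `-β` (`displacedKet_complete`).
-/

set_option linter.unusedSectionVars false

open MeasureTheory
open scoped ENNReal

noncomputable section

/-! ### Complex analysis in a half plane -/

/-- The constant in `norm_integral_weight_le`, as a function of the length of the interval. -/
def weightBound (L : ℝ) : ℝ := (L + 1) ^ 2 * L + 2 * (L + 1)

/-- Cauchy's theorem on the rectangle with corners `a - i` and `b`. The weight vanishes at `a` and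
`b`, which compensates the singular bound `1 / |im v|` along the vertical sides. -/
theorem norm_integral_weight_le {f : ℂ → ℂ} (hf : ∀ v : ℂ, v.im ≤ 0 → DifferentiableAt ℂ f v)
    (hb : ∀ v : ℂ, v.im ≤ 0 → ‖f v‖ * |v.im| ≤ 1) {a b : ℝ} (hab : a ≤ b) :
    ‖∫ t in a..b, f t * (((t : ℂ) - a) * (b - t))‖ ≤ weightBound (b - a) := by
  set F : ℂ → ℂ := fun v => f v * ((v - a) * (b - v)) with hF
  have hdiff : DifferentiableOn ℂ F
      (Set.uIcc (⟨a, -1⟩ : ℂ).re (⟨b, 0⟩ : ℂ).re ×ℂ Set.uIcc (⟨a, -1⟩ : ℂ).im (⟨b, 0⟩ : ℂ).im) := by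
    intro v hv
    have h2 := hv.2
    simp only [Set.mem_preimage, Set.uIcc_of_le (show (-1 : ℝ) ≤ 0 by norm_num)] at h2
    have := hf v h2.2
    exact (this.mul (by fun_prop)).differentiableWithinAt
  have hrect := Complex.integral_boundary_rect_eq_zero_of_differentiableOn F ⟨a, -1⟩ ⟨b, 0⟩ hdiff
  simp only [Complex.ofReal_neg, Complex.ofReal_one, Complex.ofReal_zero, zero_mul,
    add_zero] at hrect
  have h1 : ‖∫ x in a..b, F (x + -1 * Complex.I)‖ ≤ (b - a + 1) ^ 2 * |b - a| := by
    refine intervalIntegral.norm_integral_le_of_norm_le_const fun x hx => ?_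
    rw [Set.uIoc_of_le hab] at hx
    have hbx := hb (x + -1 * Complex.I) (by simp)
    simp only [neg_mul, one_mul, Complex.add_im, Complex.ofReal_im, Complex.neg_im, Complex.I_im,
      zero_add, abs_neg, abs_one, mul_one] at hbx
    have e1 : ‖((x : ℂ) + -Complex.I - a)‖ ≤ b - a + 1 := by
      calc ‖((x : ℂ) + -Complex.I - a)‖ = ‖((x - a : ℝ) : ℂ) + -Complex.I‖ := by
            congr 1; push_cast; ring
        _ ≤ |x - a| + 1 := by
            refine (norm_add_le _ _).trans ?_
            rw [Complex.norm_real, Real.norm_eq_abs]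
            simp
        _ ≤ b - a + 1 := by rw [abs_of_nonneg (by linarith [hx.1])]; linarith [hx.2]
    have e2 : ‖(b - ((x : ℂ) + -Complex.I))‖ ≤ b - a + 1 := by
      calc ‖(b - ((x : ℂ) + -Complex.I))‖ = ‖((b - x : ℝ) : ℂ) + Complex.I‖ := by
            congr 1; push_cast; ring
        _ ≤ |b - x| + 1 := by
            refine (norm_add_le _ _).trans ?_
            rw [Complex.norm_real, Real.norm_eq_abs]
            simp
        _ ≤ b - a + 1 := by rw [abs_of_nonneg (by linarith [hx.2])]; linarith [hx.1]
    simp only [hF, neg_mul, one_mul, norm_mul]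
    calc _ ≤ 1 * ((b - a + 1) * (b - a + 1)) := by gcongr
      _ = _ := by ring
  have hside : ∀ (c : ℝ), (c = a ∨ c = b) →
      ‖∫ y in (-1 : ℝ)..0, F (c + y * Complex.I)‖ ≤ (b - a + 1) * |0 - (-1 : ℝ)| := by
    intro c hc
    refine intervalIntegral.norm_integral_le_of_norm_le_const fun y hy => ?_
    rw [Set.uIoc_of_le (by norm_num)] at hy
    have hby := hb (c + y * Complex.I) (by simpa using hy.2)
    simp only [Complex.add_im, Complex.ofReal_im, Complex.mul_im, Complex.ofReal_re,
      Complex.I_im, Complex.I_re, mul_one, mul_zero, add_zero, zero_add] at hby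
    have e0 : ‖((b - a : ℝ) : ℂ) + y * Complex.I‖ ≤ b - a + 1 := by
      refine (norm_add_le _ _).trans ?_
      simp only [Complex.norm_real, norm_mul, Complex.norm_I, mul_one, Real.norm_eq_abs]
      rw [abs_of_nonneg (by linarith), abs_of_nonpos hy.2]; linarith [hy.1]
    have e0' : ‖((b - a : ℝ) : ℂ) - y * Complex.I‖ ≤ b - a + 1 := by
      refine (norm_sub_le _ _).trans ?_
      simp only [Complex.norm_real, norm_mul, Complex.norm_I, mul_one, Real.norm_eq_abs]
      rw [abs_of_nonneg (by linarith), abs_of_nonpos hy.2]; linarith [hy.1]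
    have ey : ‖(y : ℂ) * Complex.I‖ = |y| := by simp
    simp only [hF, norm_mul]
    rcases hc with rfl | rfl
    · have i1 : (c : ℂ) + y * Complex.I - c = y * Complex.I := by ring
      have i2 : (b : ℂ) - (c + y * Complex.I) = ((b - c : ℝ) : ℂ) - y * Complex.I := by
        push_cast; ring
      rw [i1, i2, ey, ← mul_assoc]
      calc _ ≤ 1 * (b - c + 1) := by gcongr
        _ = _ := by ring
    · have i1 : (c : ℂ) - (c + y * Complex.I) = -(y * Complex.I) := by ring
      have i2 : (c : ℂ) + y * Complex.I - a = ((c - a : ℝ) : ℂ) + y * Complex.I := by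
        push_cast; ring
      rw [i1, i2, norm_neg, ey, mul_comm ‖((c - a : ℝ) : ℂ) + y * Complex.I‖, ← mul_assoc]
      calc _ ≤ 1 * (c - a + 1) := by gcongr
        _ = _ := by ring
  have hb' := hside b (Or.inr rfl)
  have ha' := hside a (Or.inl rfl)
  have hmain : (∫ x in a..b, F x) = (∫ x in a..b, F (x + -1 * Complex.I)) +
      Complex.I • (∫ y in (-1 : ℝ)..0, F (b + y * Complex.I)) -
      Complex.I • (∫ y in (-1 : ℝ)..0, F (a + y * Complex.I)) := by
    linear_combination -hrect
  have : ‖∫ x in a..b, F x‖ ≤ weightBound (b - a) := by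
    rw [hmain]
    refine (norm_sub_le _ _).trans ((add_le_add (norm_add_le _ _) le_rfl).trans ?_)
    rw [norm_smul, norm_smul, Complex.norm_I, one_mul, one_mul, weightBound]
    rw [abs_of_nonneg (by linarith)] at h1
    norm_num at ha' hb'
    linarith
  exact this

/-- A function with nonnegative imaginary part on the real line, analytic in the closed lower half
plane and bounded there by the inverse distance to the real line, has an integral of the imaginary
part over `[0, V]` that is bounded in terms of `V` only. -/
theorem lintegral_im_le {f : ℂ → ℂ} (hf : ∀ v : ℂ, v.im ≤ 0 → DifferentiableAt ℂ f v)
    (hb : ∀ v : ℂ, v.im ≤ 0 → ‖f v‖ * |v.im| ≤ 1) (hpos : ∀ t : ℝ, 0 ≤ (f t).im) {V : ℝ}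
    (hV : 0 ≤ V) :
    ∫⁻ t in Set.Icc 0 V, ENNReal.ofReal (f t).im ≤ ENNReal.ofReal (weightBound (V + 2)) := by
  have hcont : Continuous fun t : ℝ => f t := by
    refine continuous_iff_continuousAt.2 fun t => ?_
    exact (hf t (by simp)).continuousAt.comp Complex.continuous_ofReal.continuousAt
  have h := norm_integral_weight_le hf hb (show (-1 : ℝ) ≤ V + 1 by linarith)
  have hc2 : Continuous fun t : ℝ => f t * (((t : ℂ) - (-1 : ℝ)) * ((V + 1 : ℝ) - t)) :=
    hcont.mul (by fun_prop)
  have him : ∀ t : ℝ, (f t * (((t : ℂ) - (-1 : ℝ)) * ((V + 1 : ℝ) - t))).im =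
      (f t).im * ((t + 1) * (V + 1 - t)) := by
    intro t
    have : ((t : ℂ) - (-1 : ℝ)) * ((V + 1 : ℝ) - t) = (((t + 1) * (V + 1 - t) : ℝ) : ℂ) := by
      push_cast; ring
    rw [this, Complex.im_mul_ofReal]
  have hle : ∫ t in (-1 : ℝ)..(V + 1), (f t).im * ((t + 1) * (V + 1 - t)) ≤
      weightBound (V + 2) := by
    have e : (∫ t in (-1 : ℝ)..(V + 1), f t * (((t : ℂ) - (-1 : ℝ)) * ((V + 1 : ℝ) - t))).im =
        ∫ t in (-1 : ℝ)..(V + 1), (f t).im * ((t + 1) * (V + 1 - t)) := by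
      simp_rw [← him]
      exact (intervalIntegral.intervalIntegral_im (hc2.intervalIntegrable _ _)).symm
    rw [← e]
    have e2 : V + 1 - (-1) = V + 2 := by ring
    rw [e2] at h
    exact ((le_abs_self _).trans (Complex.abs_im_le_norm _)).trans h
  have hci : Continuous fun t : ℝ => (f t).im * ((t + 1) * (V + 1 - t)) :=
    (Complex.continuous_im.comp hcont).mul (by fun_prop)
  rw [intervalIntegral.integral_of_le (by linarith)] at hle
  calc ∫⁻ t in Set.Icc 0 V, ENNReal.ofReal (f t).im
      ≤ ∫⁻ t in Set.Icc 0 V, ENNReal.ofReal ((f t).im * ((t + 1) * (V + 1 - t))) := by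
        refine setLIntegral_mono hci.measurable.ennreal_ofReal fun t ht => ENNReal.ofReal_le_ofReal ?_
        have : 1 ≤ (t + 1) * (V + 1 - t) := by nlinarith [ht.1, ht.2]
        nlinarith [hpos t]
    _ ≤ ∫⁻ t in Set.Ioc (-1) (V + 1), ENNReal.ofReal ((f t).im * ((t + 1) * (V + 1 - t))) :=
        lintegral_mono_set fun t ht => ⟨by linarith [ht.1], by linarith [ht.2]⟩
    _ = ENNReal.ofReal (∫ t in Set.Ioc (-1) (V + 1), (f t).im * ((t + 1) * (V + 1 - t))) := by
        refine (ofReal_integral_eq_lintegral_ofReal ?_ ?_).symm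
        · exact (hci.integrableOn_Icc).mono_set Set.Ioc_subset_Icc_self
        · refine (ae_restrict_iff' measurableSet_Ioc).2 (Filter.Eventually.of_forall fun t ht => ?_)
          exact mul_nonneg (hpos t) (mul_nonneg (by linarith [ht.1]) (by linarith [ht.2]))
    _ ≤ _ := ENNReal.ofReal_le_ofReal hle

/-! ### Operators with compact resolvent -/

namespace CompactResolvent

variable {H : Type*} [NormedAddCommGroup H] [InnerProductSpace ℂ H] [CompleteSpace H]

/-- The inverse of `R⁻¹ + T`, where `R` is the inverse of an unbounded operator and `T` is bounded.
It is zero by convention if `1 + T R` is not invertible. -/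
def invAdd (R T : H →L[ℂ] H) : H →L[ℂ] H := R * Ring.inverse (1 + T * R)

/-- The orthogonal projection onto the kernel of `R⁻¹ + T`. -/
def kerProj (R T : H →L[ℂ] H) : H →L[ℂ] H := (1 + R * T).ker.starProjection

variable {R T W P : H →L[ℂ] H}

/-- The Fredholm alternative. -/
theorem isUnit_one_add_mul_of_injective (hR : IsCompactOperator R)
    (h : ∀ χ, χ + T (R χ) = 0 → χ = 0) : IsUnit (1 + T * R) := by
  have hK : IsCompactOperator (-(T * R) : H →L[ℂ] H) := (hR.clm_comp T).neg
  rcases hK.hasEigenvalue_or_mem_resolventSet (one_ne_zero (α := ℂ)) with h1 | h1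
  · obtain ⟨χ, hχ⟩ := h1.exists_hasEigenvector
    refine absurd (h χ ?_) hχ.2
    have := hχ.apply_eq_smul
    simp only [ContinuousLinearMap.coe_coe, neg_apply,
      mul_apply_eq_comp, one_smul] at this
    rw [neg_eq_iff_eq_neg.1 this, add_neg_cancel]
  · have := spectrum.mem_resolventSet_iff.1 h1
    simpa using this

theorem invAdd_eq (h : IsUnit (1 + T * R)) (φ : H) :
    ∃ χ, R χ = invAdd R T φ ∧ χ + T (R χ) = φ := by
  refine ⟨Ring.inverse (1 + T * R) φ, rfl, ?_⟩
  have := congrArg (fun A : H →L[ℂ] H => A φ) (Ring.mul_inverse_cancel _ h)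
  simpa using this

theorem invAdd_apply_of_add (h : IsUnit (1 + T * R)) {χ φ : H} (hχ : χ + T (R χ) = φ) :
    R χ = invAdd R T φ := by
  have := congrArg (fun A : H →L[ℂ] H => A χ) (Ring.inverse_mul_cancel _ h)
  simp only [mul_apply_eq_comp, add_apply,
    one_apply_eq_self] at this
  rw [hχ] at this
  rw [invAdd, mul_apply_eq_comp, this]

theorem mem_ker {ψ : H} : ψ ∈ (1 + R * T).ker ↔ ψ + R (T ψ) = 0 := by simp

theorem isUnit_of_ker_eq_bot (hR : IsCompactOperator R)
    (h : ∀ ψ, ψ + R (T ψ) = 0 → ψ = 0) : IsUnit (1 + T * R) := by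
  refine isUnit_one_add_mul_of_injective hR fun χ hχ => ?_
  have h1 : R χ = 0 := h _ (by rw [← map_add, hχ, map_zero])
  simpa [h1] using hχ

theorem im_inner_invAdd (hRs : R.IsSymmetric) (h : IsUnit (1 + T * R)) (φ : H) :
    (inner ℂ φ (invAdd R T φ)).im = -(inner ℂ (invAdd R T φ) (T (invAdd R T φ))).im := by
  obtain ⟨χ, hχ, hφ⟩ := invAdd_eq h φ
  rw [← hχ]
  have h1 : (inner ℂ χ (R χ)).im = 0 := by
    have := hRs.im_inner_self_apply χ
    simpa using this
  conv_lhs => rw [← hφ, inner_add_left, Complex.add_im, h1, zero_add]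
  rw [← inner_conj_symm, Complex.conj_im]

theorem isSymmetric_add_smul (hW : W.IsSymmetric) (hP : P.IsSymmetric) (t : ℝ) :
    (W + (t : ℂ) • P).IsSymmetric := by
  intro x y
  have h1 := hW x y
  have h2 := hP x y
  simp only [ContinuousLinearMap.coe_coe, add_apply, smul_apply, inner_add_left,
    inner_add_right, inner_smul_left, inner_smul_right, Complex.conj_ofReal] at h1 h2 ⊢
  rw [h1, h2]

/-- The perturbation that is added to `R⁻¹ = H₀ + 1`, for the operator `H₀ + W + v P - z`. -/
def shifted (W P : H →L[ℂ] H) (v z : ℂ) : H →L[ℂ] H := W + v • P - (z + 1) • 1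

/-- The quadratic form of `H₀ + W + v P - z` has imaginary part `im v ‖P ψ‖ ^ 2 - im z ‖ψ‖ ^ 2`. -/
theorem im_inner_shifted (hW : W.IsSymmetric) (hP : P.IsSymmetric)
    (hPP : ∀ ψ, P (P ψ) = P ψ) (v z : ℂ) (ψ : H) :
    (inner ℂ ψ (shifted W P v z ψ)).im = v.im * ‖P ψ‖ ^ 2 - z.im * ‖ψ‖ ^ 2 := by
  have h1 : (inner ℂ ψ (W ψ)).im = 0 := by simpa using hW.im_inner_self_apply ψ
  have h2 : inner ℂ ψ (P ψ) = ((‖P ψ‖ ^ 2 : ℝ) : ℂ) := by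
    rw [← hPP ψ]
    have := hP ψ (P ψ)
    simp only [ContinuousLinearMap.coe_coe] at this
    rw [← this, hPP, inner_self_eq_norm_sq_to_K]
    simp
  have h3 : inner ℂ ψ ψ = ((‖ψ‖ ^ 2 : ℝ) : ℂ) := by
    rw [inner_self_eq_norm_sq_to_K]; simp
  simp only [shifted, sub_apply, add_apply,
    smul_apply, one_apply_eq_self, inner_sub_right,
    inner_add_right, inner_smul_right, Complex.sub_im, Complex.add_im, h1, h2, h3,
    Complex.im_mul_ofReal, Complex.one_im]
  ring

/-- For `im z > 0`, the resolvent of `H₀ + W + v P` exists for all complex couplings `v` in the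
closed lower half plane. -/
theorem isUnit_shifted (hR : IsCompactOperator R) (hRs : R.IsSymmetric) (hW : W.IsSymmetric)
    (hP : P.IsSymmetric) (hPP : ∀ ψ, P (P ψ) = P ψ) {v z : ℂ} (hv : v.im ≤ 0) (hz : 0 < z.im) :
    IsUnit (1 + shifted W P v z * R) := by
  refine isUnit_one_add_mul_of_injective hR fun χ hχ => ?_
  have h1 : (inner ℂ (R χ) (shifted W P v z (R χ))).im = 0 := by
    have : shifted W P v z (R χ) = -χ := eq_neg_of_add_eq_zero_right hχ
    rw [this, inner_neg_right, Complex.neg_im]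
    simpa using hRs.im_inner_apply_self χ
  rw [im_inner_shifted hW hP hPP] at h1
  have h2 : ‖R χ‖ ^ 2 = 0 := by
    have : v.im * ‖P (R χ)‖ ^ 2 ≤ 0 := mul_nonpos_of_nonpos_of_nonneg hv (by positivity)
    have h3 : 0 ≤ ‖R χ‖ ^ 2 := by positivity
    nlinarith
  have h4 : R χ = 0 := by simpa using h2
  simpa [h4] using hχ

/-- At a unit vector in the range of `P`, the Green function as a function of the coupling `v` is
bounded by `1 / |im v|` in the lower half plane, uniformly in `z`. -/
theorem norm_inner_invAdd_shifted_mul_le (hR : IsCompactOperator R) (hRs : R.IsSymmetric)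
    (hW : W.IsSymmetric) (hP : P.IsSymmetric) (hPP : ∀ ψ, P (P ψ) = P ψ) {φ : H} (hφ : ‖φ‖ = 1)
    (hPφ : P φ = φ) {v z : ℂ} (hv : v.im ≤ 0) (hz : 0 < z.im) :
    ‖inner ℂ φ (invAdd R (shifted W P v z) φ)‖ * |v.im| ≤ 1 := by
  have h := im_inner_invAdd hRs (isUnit_shifted hR hRs hW hP hPP hv hz) φ
  rw [im_inner_shifted hW hP hPP] at h
  set ψ := invAdd R (shifted W P v z) φ
  have h1 : inner ℂ φ ψ = inner ℂ φ (P ψ) := by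
    conv_lhs => rw [← hPφ]
    exact hP φ ψ
  have h2 : ‖inner ℂ φ ψ‖ ≤ ‖P ψ‖ := by
    rw [h1]; simpa [hφ] using norm_inner_le_norm (𝕜 := ℂ) φ (P ψ)
  have h3 : |v.im| * ‖P ψ‖ ^ 2 ≤ ‖P ψ‖ := by
    rw [abs_of_nonpos hv]
    have := (Complex.abs_im_le_norm (inner ℂ φ ψ)).trans h2
    have h5 := (le_abs_self _).trans this
    rw [h] at h5
    have : 0 ≤ z.im * ‖ψ‖ ^ 2 := by positivity
    linarith
  rcases (norm_nonneg (P ψ)).eq_or_lt with h0 | h0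
  · have : ‖inner ℂ φ ψ‖ = 0 := le_antisymm (h2.trans h0.symm.le) (norm_nonneg _)
    rw [this]; simp
  · have : |v.im| * ‖P ψ‖ ≤ 1 := by
      by_contra! hc
      nlinarith
    calc _ ≤ ‖P ψ‖ * |v.im| := by gcongr
      _ ≤ 1 := by linarith

theorem im_inner_invAdd_shifted (hR : IsCompactOperator R) (hRs : R.IsSymmetric)
    (hW : W.IsSymmetric) (hP : P.IsSymmetric) (hPP : ∀ ψ, P (P ψ) = P ψ) (φ : H)
    (t : ℝ) {z : ℂ} (hz : 0 < z.im) :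
    (inner ℂ φ (invAdd R (shifted W P t z) φ)).im =
      z.im * ‖invAdd R (shifted W P t z) φ‖ ^ 2 := by
  rw [im_inner_invAdd hRs (isUnit_shifted hR hRs hW hP hPP (by simp) hz),
    im_inner_shifted hW hP hPP]
  simp

theorem differentiableAt_inner_invAdd_shifted (φ : H) {v z : ℂ}
    (h : IsUnit (1 + shifted W P v z * R)) :
    DifferentiableAt ℂ (fun v => inner ℂ φ (invAdd R (shifted W P v z) φ)) v := by
  have h1 : DifferentiableAt ℂ (fun v => 1 + shifted W P v z * R) v := by
    unfold shifted; fun_prop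
  have h2 : DifferentiableAt ℂ (fun v => Ring.inverse (1 + shifted W P v z * R)) v :=
    DifferentiableAt.fun_comp' v (differentiableAt_inverse (𝕜 := ℂ) h) h1
  have h3 : DifferentiableAt ℂ (fun v => invAdd R (shifted W P v z) φ) v := by
    unfold invAdd
    exact ((differentiableAt_const R).mul h2).clm_apply (differentiableAt_const φ)
  exact (innerSL ℂ φ).differentiableAt.comp v h3

/-- The Poisson transform of the spectral measure at `φ`, averaged over the coupling, is bounded
uniformly in `z`. -/
theorem lintegral_norm_invAdd_shifted_le (hR : IsCompactOperator R) (hRs : R.IsSymmetric)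
    (hW : W.IsSymmetric) (hP : P.IsSymmetric) (hPP : ∀ ψ, P (P ψ) = P ψ) {φ : H} (hφ : ‖φ‖ = 1)
    (hPφ : P φ = φ) {z : ℂ} (hz : 0 < z.im) {V : ℝ} (hV : 0 ≤ V) :
    ∫⁻ t : ℝ in Set.Icc 0 V, ENNReal.ofReal (z.im * ‖invAdd R (shifted W P t z) φ‖ ^ 2) ≤
      ENNReal.ofReal (weightBound (V + 2)) := by
  have := lintegral_im_le (f := fun v => inner ℂ φ (invAdd R (shifted W P v z) φ))
    (fun v hv => differentiableAt_inner_invAdd_shifted φ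
      (isUnit_shifted hR hRs hW hP hPP hv hz))
    (fun v hv => norm_inner_invAdd_shifted_mul_le hR hRs hW hP hPP hφ hPφ hv hz)
    (fun t => by
      rw [im_inner_invAdd_shifted hR hRs hW hP hPP φ t hz]; positivity) hV
  simpa only [im_inner_invAdd_shifted hR hRs hW hP hPP φ _ hz] using this

/-! ### Bessel's inequality for eigenprojections -/

theorem sum_norm_starProjection_sq_le {ι : Type*} (K : ι → Submodule ℂ H)
    [∀ i, (K i).HasOrthogonalProjection] (hK : Pairwise fun i j => K i ⟂ K j) (s : Finset ι)
    (φ : H) : ∑ i ∈ s, ‖(K i).starProjection φ‖ ^ 2 ≤ ‖φ‖ ^ 2 := by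
  set u := ∑ i ∈ s, (K i).starProjection φ with hu
  have horth : ∀ i j, i ≠ j → inner ℂ ((K i).starProjection φ) ((K j).starProjection φ) = 0 :=
    fun i j hij => (hK hij).inner_eq (Submodule.starProjection_apply_mem _ _)
      (Submodule.starProjection_apply_mem _ _)
  have hself : ∀ i, inner ℂ ((K i).starProjection φ) φ =
      ((‖(K i).starProjection φ‖ ^ 2 : ℝ) : ℂ) := by
    intro i
    have h := Submodule.inner_starProjection_left_eq_right (K i) φ ((K i).starProjection φ)
    rw [Submodule.starProjection_eq_self_iff.2 (Submodule.starProjection_apply_mem _ _)] at h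
    rw [← inner_conj_symm, ← h, inner_self_eq_norm_sq_to_K]
    simp
  have h1 : inner ℂ u φ = ((∑ i ∈ s, ‖(K i).starProjection φ‖ ^ 2 : ℝ) : ℂ) := by
    rw [hu, sum_inner, Complex.ofReal_sum]
    exact Finset.sum_congr rfl fun i _ => hself i
  have h2 : ‖u‖ ^ 2 = ∑ i ∈ s, ‖(K i).starProjection φ‖ ^ 2 := by
    have : inner ℂ u u = ((∑ i ∈ s, ‖(K i).starProjection φ‖ ^ 2 : ℝ) : ℂ) := by
      rw [Complex.ofReal_sum]
      conv_lhs => rw [hu, sum_inner]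
      refine Finset.sum_congr rfl fun i hi => ?_
      rw [inner_sum, Finset.sum_eq_single i (fun j _ hj => horth i j hj.symm)
        (fun h => absurd hi h), inner_self_eq_norm_sq_to_K]
      simp
    rw [inner_self_eq_norm_sq_to_K] at this
    exact Complex.ofReal_injective (by rw [← this]; simp)
  have h3 : ∑ i ∈ s, ‖(K i).starProjection φ‖ ^ 2 ≤ ‖u‖ * ‖φ‖ := by
    have := norm_inner_le_norm (𝕜 := ℂ) u φ
    rw [h1, Complex.norm_real] at this
    exact (le_abs_self _).trans this
  rw [← h2] at h3 ⊢
  nlinarith [norm_nonneg u, norm_nonneg φ, sq_nonneg (‖u‖ - ‖φ‖)]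

theorem tsum_enorm_starProjection_sq_le {ι : Type*} (K : ι → Submodule ℂ H)
    [∀ i, (K i).HasOrthogonalProjection] (hK : Pairwise fun i j => K i ⟂ K j)
    (φ : H) : ∑' i, ‖(K i).starProjection φ‖ₑ ^ 2 ≤ ‖φ‖ₑ ^ 2 := by
  refine ENNReal.summable.tsum_le_of_sum_le fun s => ?_
  have := ENNReal.ofReal_le_ofReal (sum_norm_starProjection_sq_le K hK s φ)
  rw [ENNReal.ofReal_sum_of_nonneg (fun _ _ => by positivity)] at this
  simpa only [ENNReal.ofReal_pow (norm_nonneg _), ofReal_norm] using this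

/-- The eigenprojection of `R⁻¹ + W - 1` for the eigenvalue `E`. -/
def eigProj (R W : H →L[ℂ] H) (E : ℝ) : H →L[ℂ] H := kerProj R (W - ((E : ℂ) + 1) • 1)

theorem eigProj_mem (E : ℝ) (φ : H) :
    eigProj R W E φ ∈ (1 + R * (W - ((E : ℂ) + 1) • 1)).ker :=
  Submodule.starProjection_apply_mem _ _

/-- Pairing of an element `R χ` of the domain with an eigenvector of `R⁻¹ + W - 1`. -/
theorem inner_eigenvector (hRs : R.IsSymmetric) (hW : W.IsSymmetric) {E : ℝ} {η : H}
    (hη : η ∈ (1 + R * (W - ((E : ℂ) + 1) • 1)).ker) (χ : H) :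
    inner ℂ η (χ + W (R χ)) = ((E : ℂ) + 1) * inner ℂ η (R χ) := by
  rw [mem_ker] at hη
  have h1 : inner ℂ η χ = - inner ℂ (W η - ((E : ℂ) + 1) • η) (R χ) := by
    conv_lhs => rw [eq_neg_of_add_eq_zero_left hη, inner_neg_left]
    exact congrArg _ (hRs _ _)
  have h2 : inner ℂ (W η) (R χ) = inner ℂ η (W (R χ)) := hW _ _
  rw [inner_add_right, h1, inner_sub_left, inner_smul_left, h2]
  simp

theorem pairwise_isOrtho_ker (hRs : R.IsSymmetric) (hW : W.IsSymmetric) :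
    Pairwise fun E E' : ℝ => (1 + R * (W - ((E : ℂ) + 1) • 1)).ker ⟂
      (1 + R * (W - ((E' : ℂ) + 1) • 1)).ker := by
  intro E E' hE
  rw [Submodule.isOrtho_iff_inner_eq]
  intro η hη η' hη'
  rw [mem_ker] at hη'
  set χ := -(W η' - ((E' : ℂ) + 1) • η') with hχ
  have h1 : R χ = η' := by
    rw [hχ, map_neg]; exact (eq_neg_of_add_eq_zero_left hη').symm
  have h2 := inner_eigenvector hRs hW hη χ
  rw [h1] at h2
  have h3 : χ + W η' = ((E' : ℂ) + 1) • η' := by rw [hχ]; abel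
  rw [h3, inner_smul_right] at h2
  have h4 : ((E' : ℂ) - E) * inner ℂ η η' = 0 := by linear_combination h2
  rcases mul_eq_zero.1 h4 with h | h
  · exact absurd (by exact_mod_cast (sub_eq_zero.1 h).symm) hE
  · exact h

theorem tsum_enorm_eigProj_sq_le (hRs : R.IsSymmetric) (hW : W.IsSymmetric) (φ : H) :
    ∑' E : ℝ, ‖eigProj R W E φ‖ₑ ^ 2 ≤ ‖φ‖ₑ ^ 2 :=
  tsum_enorm_starProjection_sq_le _ (pairwise_isOrtho_ker hRs hW) φ

/-- If `φ = (R⁻¹ + W - 1 - a) ψ`, then the eigenprojections of `φ` and `ψ` are related by the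
factor `E - a`. -/
theorem eigProj_add_apply (hRs : R.IsSymmetric) (hW : W.IsSymmetric) (E : ℝ) (a : ℂ) (χ : H) :
    eigProj R W E (χ + W (R χ) - (a + 1) • R χ) = ((E : ℂ) - a) • eigProj R W E (R χ) := by
  set K := (1 + R * (W - ((E : ℂ) + 1) • 1)).ker
  have : eigProj R W E ((χ + W (R χ) - (a + 1) • R χ) - ((E : ℂ) - a) • R χ) = 0 := by
    refine (Submodule.starProjection_apply_eq_zero_iff K).2 ?_
    rw [Submodule.mem_orthogonal]
    intro η hη
    rw [inner_sub_right, inner_sub_right, inner_eigenvector hRs hW hη, inner_smul_right,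
      inner_smul_right]
    ring
  rw [map_sub, map_smul, sub_eq_zero] at this
  exact this

end CompactResolvent

namespace CompactResolvent

variable {H : Type*} [NormedAddCommGroup H] [InnerProductSpace ℂ H] [CompleteSpace H]
variable {R T W P : H →L[ℂ] H}

/-! ### Spectral averaging -/

/-- The factor `1 / π` of the Poisson kernel is not needed for this inequality: without it the mass
of the interval `[a - ε, a + ε]` is already at least one. -/
theorem le_liminf_lintegral_poisson {g : ℝ → ℝ≥0∞} (hg : LowerSemicontinuous g) (a : ℝ) :
    g a ≤ Filter.liminf (fun n : ℕ => ∫⁻ E, g E *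
      ENNReal.ofReal ((1 / ((n : ℝ) + 1)) / ((a - E) ^ 2 + (1 / ((n : ℝ) + 1)) ^ 2)))
      Filter.atTop := by
  refine le_of_forall_lt fun c hc => ?_
  obtain ⟨c', hcc', hc'⟩ := exists_between hc
  refine hcc'.trans_le ?_
  obtain ⟨δ, hδ, hball⟩ := Metric.eventually_nhds_iff.1 (hg a c' hc')
  refine Filter.le_liminf_of_le (by isBoundedDefault) ?_
  have hev : ∀ᶠ n : ℕ in Filter.atTop, 1 / ((n : ℝ) + 1) < δ :=
    tendsto_one_div_add_atTop_nhds_zero_nat.eventually (gt_mem_nhds hδ)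
  filter_upwards [hev] with n hn
  set ε : ℝ := 1 / ((n : ℝ) + 1) with hε
  have hε0 : 0 < ε := by positivity
  calc c' = ∫⁻ _ in Set.Icc (a - ε) (a + ε), c' * ENNReal.ofReal (1 / (2 * ε)) := by
        rw [setLIntegral_const, Real.volume_Icc, mul_assoc,
          ← ENNReal.ofReal_mul (by positivity)]
        have : 1 / (2 * ε) * (a + ε - (a - ε)) = 1 := by field_simp; ring
        rw [this]; simp
    _ ≤ ∫⁻ E in Set.Icc (a - ε) (a + ε), g E *
          ENNReal.ofReal (ε / ((a - E) ^ 2 + ε ^ 2)) := by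
        refine setLIntegral_mono' measurableSet_Icc fun E hE => ?_
        have h1 : |a - E| ≤ ε := abs_le.2 ⟨by linarith [hE.2], by linarith [hE.1]⟩
        refine mul_le_mul' (hball ?_).le (ENNReal.ofReal_le_ofReal ?_)
        · rw [Real.dist_eq, abs_sub_comm]; exact h1.trans_lt hn
        · have h2 : (a - E) ^ 2 ≤ ε ^ 2 := sq_le_sq' (abs_le.1 h1).1 (abs_le.1 h1).2
          rw [div_le_div_iff₀ (by positivity) (by positivity)]
          nlinarith
    _ ≤ _ := setLIntegral_le_lintegral _ _

/-- Bessel's inequality for the resolvent `(H - e - iε)⁻¹ φ`, whose components in the eigenspaces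
are those of `φ` divided by `E - e - iε`. -/
theorem sum_poisson_le (hR : IsCompactOperator R) (hRs : R.IsSymmetric) (hW : W.IsSymmetric)
    (hP : P.IsSymmetric) (hPP : ∀ ψ, P (P ψ) = P ψ) (φ : H) (t e : ℝ) {ε : ℝ} (hε : 0 < ε)
    (s : Finset ℝ) :
    ∑ E ∈ s, ‖eigProj R (W + (t : ℂ) • P) E φ‖ ^ 2 * (ε / ((E - e) ^ 2 + ε ^ 2)) ≤
      ε * ‖invAdd R (shifted W P t (e + ε * Complex.I)) φ‖ ^ 2 := by
  have hz : 0 < ((e : ℂ) + ε * Complex.I).im := by simpa using hε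
  set z : ℂ := e + ε * Complex.I with hzdef
  obtain ⟨χ, hχ, hφ⟩ := invAdd_eq (isUnit_shifted (v := (t : ℂ)) hR hRs hW hP hPP (by simp) hz) φ
  have hWt := isSymmetric_add_smul hW hP t
  have key : ∀ E : ℝ, ‖eigProj R (W + (t : ℂ) • P) E φ‖ ^ 2 * (ε / ((E - e) ^ 2 + ε ^ 2)) =
      ε * ‖eigProj R (W + (t : ℂ) • P) E (R χ)‖ ^ 2 := by
    intro E
    have h1 := eigProj_add_apply (R := R) hRs hWt E z χ
    have h2 : χ + (W + (t : ℂ) • P) (R χ) - (z + 1) • R χ = φ := by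
      rw [← hφ, shifted]
      simp only [add_apply, sub_apply, smul_apply, one_apply_eq_self]
      abel
    rw [h2] at h1
    have h3 : ‖(E : ℂ) - z‖ ^ 2 = (E - e) ^ 2 + ε ^ 2 := by
      rw [← Complex.normSq_eq_norm_sq, Complex.normSq_apply, hzdef]
      simp
      ring
    have h4 : 0 < (E - e) ^ 2 + ε ^ 2 := by positivity
    rw [h1, norm_smul, mul_pow, h3]
    field_simp
  simp_rw [key]
  rw [← Finset.mul_sum, ← hχ]
  exact mul_le_mul_of_nonneg_left
    (sum_norm_starProjection_sq_le _ (pairwise_isOrtho_ker hRs hWt) s (R χ)) hε.le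

theorem continuous_invAdd_shifted (hR : IsCompactOperator R) (hRs : R.IsSymmetric)
    (hW : W.IsSymmetric) (hP : P.IsSymmetric) (hPP : ∀ ψ, P (P ψ) = P ψ) (φ : H) {ε : ℝ}
    (hε : 0 < ε) : Continuous fun q : ℝ × ℝ =>
      invAdd R (shifted W P q.1 (q.2 + ε * Complex.I)) φ := by
  refine continuous_iff_continuousAt.2 fun q => ?_
  have hu : IsUnit (1 + shifted W P q.1 (q.2 + ε * Complex.I) * R) :=
    isUnit_shifted hR hRs hW hP hPP (by simp) (by simpa using hε)
  have hc : Continuous fun q : ℝ × ℝ => 1 + shifted W P q.1 (q.2 + ε * Complex.I) * R := by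
    unfold shifted; fun_prop
  have h0 : ContinuousAt Ring.inverse (1 + shifted W P q.1 (q.2 + ε * Complex.I) * R) :=
    NormedRing.inverse_continuousAt hu.unit
  have h1 := ContinuousAt.comp (f := fun q : ℝ × ℝ =>
    1 + shifted W P q.1 (q.2 + ε * Complex.I) * R) h0 hc.continuousAt
  exact (R.continuous.continuousAt).comp (h1.clm_apply continuousAt_const)

/-- The integral of `g` against the spectral measure of `H₀ + W + t P` at `φ`, smeared with the
(not normalized) Poisson kernel of width `1 / (n + 1)`. -/
def poissonAverage (R W P : H →L[ℂ] H) (φ : H) (g : ℝ → ℝ≥0∞) (n : ℕ) (t : ℝ) : ℝ≥0∞ :=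
  ∫⁻ E : ℝ, g E * ENNReal.ofReal ((1 / ((n : ℝ) + 1)) *
    ‖invAdd R (shifted W P t (E + (1 / ((n : ℝ) + 1) : ℝ) * Complex.I)) φ‖ ^ 2)

/-- Lower semicontinuous functions are integrated with respect to the point part of the spectral
measure at `φ` by smearing it with the Poisson kernel. -/
theorem tsum_eigProj_mul_le_liminf (hR : IsCompactOperator R) (hRs : R.IsSymmetric)
    (hW : W.IsSymmetric) (hP : P.IsSymmetric) (hPP : ∀ ψ, P (P ψ) = P ψ) (φ : H)
    {g : ℝ → ℝ≥0∞} (hg : LowerSemicontinuous g) (t : ℝ) :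
    ∑' E : ℝ, ‖eigProj R (W + (t : ℂ) • P) E φ‖ₑ ^ 2 * g E ≤
      Filter.liminf (fun n => poissonAverage R W P φ g n t) Filter.atTop := by
  refine ENNReal.summable.tsum_le_of_sum_le fun s => ?_
  set w : ℝ → ℝ := fun E => ‖eigProj R (W + (t : ℂ) • P) E φ‖ ^ 2 with hw
  set p : ℕ → ℝ → ℝ → ℝ := fun n a E =>
    (1 / ((n : ℝ) + 1)) / ((a - E) ^ 2 + (1 / ((n : ℝ) + 1)) ^ 2) with hp
  have hw' : ∀ E, ‖eigProj R (W + (t : ℂ) • P) E φ‖ₑ ^ 2 = ENNReal.ofReal (w E) := by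
    intro E; rw [hw, ENNReal.ofReal_pow (norm_nonneg _), ofReal_norm]
  have hmeas : ∀ n a, Measurable fun E => g E * ENNReal.ofReal (p n a E) := by
    intro n a
    exact hg.measurable.mul (by simp only [hp]; fun_prop)
  have h1 : ∑ E ∈ s, ENNReal.ofReal (w E) * g E ≤
      ∑ E ∈ s, ENNReal.ofReal (w E) * Filter.liminf (fun n => ∫⁻ e, g e *
        ENNReal.ofReal (p n E e)) Filter.atTop :=
    Finset.sum_le_sum fun E _ => mul_le_mul' le_rfl (le_liminf_lintegral_poisson hg E)
  have h2 : ∑ E ∈ s, ENNReal.ofReal (w E) * Filter.liminf (fun n => ∫⁻ e, g e *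
        ENNReal.ofReal (p n E e)) Filter.atTop ≤
      Filter.liminf (fun n => ∑ E ∈ s, ENNReal.ofReal (w E) * ∫⁻ e, g e *
        ENNReal.ofReal (p n E e)) Filter.atTop := by
    have hmul : ∀ E, ENNReal.ofReal (w E) * Filter.liminf (fun n : ℕ => ∫⁻ e, g e *
        ENNReal.ofReal (p n E e)) Filter.atTop ≤ Filter.liminf (fun n => ENNReal.ofReal (w E) *
          ∫⁻ e, g e * ENNReal.ofReal (p n E e)) Filter.atTop := fun E =>
      (ENNReal.liminf_const_mul_of_ne_top ENNReal.ofReal_ne_top).ge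
    refine (Finset.sum_le_sum fun E _ => hmul E).trans ?_
    have hF := lintegral_liminf_le (μ := Measure.count (α := s)) (f := fun (n : ℕ) (E : s) =>
      ENNReal.ofReal (w E) * ∫⁻ e, g e * ENNReal.ofReal (p n E e))
      (u := Filter.atTop) (fun n => Measurable.of_discrete)
    simp only [lintegral_count, tsum_fintype] at hF
    rw [← Finset.sum_coe_sort s]
    refine hF.trans (le_of_eq ?_)
    congr 1
    funext n
    exact Finset.sum_coe_sort s fun E => ENNReal.ofReal (w E) *
      ∫⁻ e, g e * ENNReal.ofReal (p n E e)
  simp_rw [hw']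
  refine h1.trans (h2.trans (Filter.liminf_le_liminf (Filter.Eventually.of_forall fun n => ?_)))
  have hc : ∀ E, ENNReal.ofReal (w E) * ∫⁻ e, g e * ENNReal.ofReal (p n E e) =
      ∫⁻ e, ENNReal.ofReal (w E) * (g e * ENNReal.ofReal (p n E e)) := fun E =>
    (lintegral_const_mul _ (hmeas n E)).symm
  simp_rw [hc]
  rw [← lintegral_finsetSum _ (fun E _ => (hmeas n E).const_mul _)]
  refine lintegral_mono fun e => ?_
  have hε : 0 < 1 / ((n : ℝ) + 1) := by positivity
  have := sum_poisson_le hR hRs hW hP hPP φ t e hε s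
  calc ∑ E ∈ s, ENNReal.ofReal (w E) * (g e * ENNReal.ofReal (p n E e))
      = g e * ∑ E ∈ s, ENNReal.ofReal (w E * p n E e) := by
        rw [Finset.mul_sum]
        refine Finset.sum_congr rfl fun E _ => ?_
        rw [ENNReal.ofReal_mul (by positivity)]; ring
    _ = g e * ENNReal.ofReal (∑ E ∈ s, w E * p n E e) := by
        rw [ENNReal.ofReal_sum_of_nonneg]
        intro E _
        simp only [hw, hp]; positivity
    _ ≤ _ := by gcongr

/-- **Spectral averaging.** The spectral measures of `H₀ + W + t P` at a unit vector `φ` in the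
range of `P`, averaged over `t ∈ [0, V]`, are bounded by a multiple of Lebesgue measure. A measurable
majorant takes the place of the measurability of the spectral measures in `t`. -/
theorem exists_measurable_majorant (hR : IsCompactOperator R) (hRs : R.IsSymmetric)
    (hW : W.IsSymmetric) (hP : P.IsSymmetric) (hPP : ∀ ψ, P (P ψ) = P ψ) {φ : H} (hφ : ‖φ‖ = 1)
    (hPφ : P φ = φ) {V : ℝ} (hV : 0 ≤ V) {F : ℝ → ℝ≥0∞} (hF : Measurable F) {δ : ℝ≥0∞}
    (hδ : δ ≠ 0) :
    ∃ M : ℝ → ℝ≥0∞, Measurable M ∧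
      (∀ t : ℝ, ∑' E : ℝ, ‖eigProj R (W + (t : ℂ) • P) E φ‖ₑ ^ 2 * F E ≤ M t) ∧
      ∫⁻ t in Set.Icc 0 V, M t ≤
        ENNReal.ofReal (weightBound (V + 2)) * ((∫⁻ E, F E) + δ) := by
  obtain ⟨g, hFg, hg, hgint⟩ := exists_le_lowerSemicontinuous_lintegral_ge volume F hF hδ
  have hjoint : ∀ n : ℕ, Measurable (Function.uncurry fun t E : ℝ =>
      g E * ENNReal.ofReal ((1 / ((n : ℝ) + 1)) *
        ‖invAdd R (shifted W P t (E + (1 / ((n : ℝ) + 1) : ℝ) * Complex.I)) φ‖ ^ 2)) := by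
    intro n
    have hc := continuous_invAdd_shifted hR hRs hW hP hPP φ
      (show (0 : ℝ) < 1 / ((n : ℝ) + 1) by positivity)
    have hc2 : Continuous fun q : ℝ × ℝ => (1 / ((n : ℝ) + 1)) *
        ‖invAdd R (shifted W P q.1 (q.2 + (1 / ((n : ℝ) + 1) : ℝ) * Complex.I)) φ‖ ^ 2 :=
      continuous_const.mul (hc.norm.pow 2)
    exact (hg.measurable.comp measurable_snd).mul hc2.measurable.ennreal_ofReal
  refine ⟨fun t => Filter.liminf (fun n => poissonAverage R W P φ g n t) Filter.atTop, ?_, ?_, ?_⟩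
  · exact Measurable.liminf fun n => (hjoint n).lintegral_prod_right
  · intro t
    refine le_trans (ENNReal.tsum_le_tsum fun E => mul_le_mul' le_rfl (hFg E)) ?_
    exact tsum_eigProj_mul_le_liminf hR hRs hW hP hPP φ hg t
  · refine (lintegral_liminf_le fun n => (hjoint n).lintegral_prod_right).trans ?_
    refine Filter.liminf_le_of_le (by isBoundedDefault) fun b hb => ?_
    obtain ⟨n, hn⟩ := hb.exists
    refine hn.trans ?_
    rw [lintegral_lintegral_swap (hjoint n).aemeasurable]
    calc _ = ∫⁻ E, g E * ∫⁻ t in Set.Icc 0 V, ENNReal.ofReal ((1 / ((n : ℝ) + 1)) *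
          ‖invAdd R (shifted W P t (E + (1 / ((n : ℝ) + 1) : ℝ) * Complex.I)) φ‖ ^ 2) := by
          refine lintegral_congr fun E => lintegral_const_mul _ ?_
          have hc := (continuous_invAdd_shifted hR hRs hW hP hPP φ
            (show (0 : ℝ) < 1 / ((n : ℝ) + 1) by positivity)).comp (Continuous.prodMk_left E)
          exact (continuous_const.mul (hc.norm.pow 2)).measurable.ennreal_ofReal
      _ ≤ ∫⁻ E, g E * ENNReal.ofReal (weightBound (V + 2)) := by
          refine lintegral_mono fun E => mul_le_mul' le_rfl ?_
          have him : ∀ r : ℝ, ((E : ℂ) + r * Complex.I).im = r := by simp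
          have := lintegral_norm_invAdd_shifted_le hR hRs hW hP hPP hφ hPφ
            (z := E + (1 / ((n : ℝ) + 1) : ℝ) * Complex.I) (by rw [him]; positivity) hV
          rwa [him] at this
      _ = ENNReal.ofReal (weightBound (V + 2)) * ∫⁻ E, g E := by
          rw [lintegral_mul_const _ hg.measurable, mul_comm]
      _ ≤ _ := by gcongr

end CompactResolvent

/-! ### Inequalities for sums in `[0, ∞]` -/

namespace ENNReal

theorem tsum_rpow_mul_rpow_le {ι : Type*} (f g : ι → ℝ≥0∞) {p q : ℝ} (hp : 0 ≤ p) (hq : 0 ≤ q)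
    (hpq : p + q = 1) : ∑' i, f i ^ p * g i ^ q ≤ (∑' i, f i) ^ p * (∑' i, g i) ^ q := by
  let _ : MeasurableSpace ι := ⊤
  have := lintegral_mul_norm_pow_le (μ := Measure.count) (f := f) (g := g)
    (Measurable.of_discrete).aemeasurable (Measurable.of_discrete).aemeasurable hp hq hpq
  simpa only [lintegral_count] using this

theorem rpow_tsum_le_tsum_rpow {ι : Type*} (f : ι → ℝ≥0∞) {s : ℝ} (hs : 0 < s) (hs1 : s ≤ 1) :
    (∑' i, f i) ^ s ≤ ∑' i, f i ^ s := by
  have hfin : ∀ S : Finset ι, (∑ i ∈ S, f i) ^ s ≤ ∑ i ∈ S, f i ^ s := by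
    classical
    intro S
    induction S using Finset.induction_on with
    | empty => simp [hs]
    | insert a S ha ih =>
      rw [Finset.sum_insert ha, Finset.sum_insert ha]
      exact (rpow_add_le_add_rpow _ _ hs.le hs1).trans (add_le_add le_rfl ih)
  have ht : Filter.Tendsto (fun S : Finset ι => (∑ i ∈ S, f i) ^ s) Filter.atTop
      (nhds ((∑' i, f i) ^ s)) :=
    (ENNReal.continuous_rpow_const.tendsto _).comp ENNReal.summable.hasSum
  exact le_of_tendsto ht (Filter.Eventually.of_forall fun S =>
    (hfin S).trans (ENNReal.sum_le_tsum S))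

theorem rpow_two_sub_mul_rpow_le (a b : ℝ≥0∞) {s : ℝ} (hs : 0 ≤ s) (hs2 : s ≤ 2) :
    a ^ (2 - s) * b ^ s ≤ a ^ 2 + b ^ 2 := by
  have h1 : a ^ (2 - s) * b ^ s ≤ max a b ^ (2 - s) * max a b ^ s :=
    mul_le_mul' (rpow_le_rpow (le_max_left _ _) (by linarith))
      (rpow_le_rpow (le_max_right _ _) hs)
  rw [← rpow_add_of_nonneg _ _ (by linarith) hs, sub_add_cancel, rpow_two] at h1
  refine h1.trans ?_
  rcases le_total a b with h | h
  · rw [max_eq_right h]; exact le_add_self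
  · rw [max_eq_left h]; exact le_self_add

end ENNReal

namespace CompactResolvent

variable {H : Type*} [NormedAddCommGroup H] [InnerProductSpace ℂ H] [CompleteSpace H]
variable {R T W P : H →L[ℂ] H}

/-! ### Measurability of the resolvent -/

theorem measurable_ringInverse {A : Type*} [NormedRing A] [HasSummableGeomSeries A]
    [MeasurableSpace A] [BorelSpace A] : Measurable (Ring.inverse : A → A) := by
  classical
  set U : Set A := {a : A | IsUnit a} with hU
  have hopen : IsOpen U := Units.isOpen
  have h : (Ring.inverse : A → A) =
      U.piecewise Ring.inverse (fun _ => 0) := by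
    funext a
    by_cases ha : a ∈ U
    · exact (Set.piecewise_eq_of_mem _ _ _ ha).symm
    · rw [Set.piecewise_eq_of_notMem _ _ _ ha, Ring.inverse_non_unit _ ha]
  rw [h]
  refine ContinuousOn.measurable_piecewise ?_ continuousOn_const hopen.measurableSet
  intro a ha
  obtain ⟨u, rfl⟩ := ha
  exact (NormedRing.inverse_continuousAt u).continuousWithinAt

theorem measurable_inner_invAdd {X : Type*} [TopologicalSpace X] [MeasurableSpace X]
    [OpensMeasurableSpace X] {S : X → H →L[ℂ] H} (hS : Continuous S) (φ φ' : H) :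
    Measurable fun q => inner ℂ φ (invAdd R (S q) φ') := by
  borelize (H →L[ℂ] H)
  have h1 : Measurable fun q => Ring.inverse (1 + S q * R) :=
    measurable_ringInverse.comp (continuous_const.add (hS.mul continuous_const)).measurable
  have h2 : Continuous fun A : H →L[ℂ] H => inner ℂ φ (R (A φ')) := by fun_prop
  exact h2.measurable.comp h1

/-! ### Eigenfunctions and the Green function at another value of the coupling -/

theorem enorm_inner_eigProj_le (E : ℝ) (φ φ' : H) :
    ‖inner ℂ φ (eigProj R W E φ')‖ₑ ≤ ‖eigProj R W E φ‖ₑ * ‖eigProj R W E φ'‖ₑ := by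
  have h : inner ℂ φ (eigProj R W E φ') = inner ℂ (eigProj R W E φ) (eigProj R W E φ') := by
    have h := Submodule.inner_starProjection_left_eq_right
      (1 + R * (W - ((E : ℂ) + 1) • 1)).ker φ (eigProj R W E φ')
    rw [Submodule.starProjection_eq_self_iff.2 (eigProj_mem E φ')] at h
    exact h.symm
  rw [h, ← ofReal_norm, ← ofReal_norm, ← ofReal_norm, ← ENNReal.ofReal_mul (norm_nonneg _)]
  exact ENNReal.ofReal_le_ofReal (norm_inner_le_norm _ _)

/-- The set of energies at which `R⁻¹ + W - 1 - E` is not invertible. -/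
def spec (R W : H →L[ℂ] H) : Set ℝ := {E | ¬ IsUnit (1 + (W - ((E : ℂ) + 1) • 1) * R)}

/-- Since eigenspaces for different eigenvalues are orthogonal, each `b i` has a nonzero component
in only countably many of them. -/
theorem countable_spec (hR : IsCompactOperator R) (hRs : R.IsSymmetric) (hW : W.IsSymmetric)
    {ι : Type*} [Countable ι] (b : ι → H) (hb : ∀ ψ, (∀ i, inner ℂ (b i) ψ = 0) → ψ = 0) :
    (spec R W).Countable := by
  have hc : (⋃ i, Function.support fun E : ℝ => ‖eigProj R W E (b i)‖ₑ ^ 2).Countable := by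
    refine Set.countable_iUnion fun i => Summable.countable_support_ennreal ?_
    exact ((tsum_enorm_eigProj_sq_le hRs hW (b i)).trans_lt (by simp)).ne
  refine hc.mono fun E hE => ?_
  by_contra hcon
  refine hE (isUnit_of_ker_eq_bot hR fun ψ hψ => hb ψ fun i => ?_)
  have h0 : eigProj R W E (b i) = 0 := by
    by_contra h0
    exact hcon (Set.mem_iUnion.2 ⟨i, by simpa using h0⟩)
  have h := Submodule.inner_starProjection_left_eq_right
      (1 + R * (W - ((E : ℂ) + 1) • 1)).ker (b i) ψ
  rw [Submodule.starProjection_eq_self_iff.2 (mem_ker.2 hψ)] at h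
  rw [← h]
  change inner ℂ (eigProj R W E (b i)) ψ = 0
  rw [h0, inner_zero_left]

/-- An eigenvector at the coupling `t` in terms of the resolvent at another coupling `t'`. -/
theorem inner_eigenvector_eq (hRs : R.IsSymmetric) (hW : W.IsSymmetric) (hP : P.IsSymmetric)
    {t t' E : ℝ} {η : H} (hη : η ∈ (1 + R * ((W + (t : ℂ) • P) - ((E : ℂ) + 1) • 1)).ker)
    (hE : E ∉ spec R (W + (t' : ℂ) • P)) (φ : H) :
    inner ℂ η φ = ((t' : ℂ) - t) *
      inner ℂ (P η) (invAdd R (W + (t' : ℂ) • P - ((E : ℂ) + 1) • 1) φ) := by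
  have hu : IsUnit (1 + (W + (t' : ℂ) • P - ((E : ℂ) + 1) • 1) * R) := not_not.1 hE
  obtain ⟨χ, hχ, hφ⟩ := invAdd_eq hu φ
  rw [← hχ]
  have h1 := inner_eigenvector hRs (isSymmetric_add_smul hW hP t) hη χ
  have h2 : inner ℂ (P η) (R χ) = inner ℂ η (P (R χ)) := hP _ _
  rw [h2, ← hφ]
  simp only [add_apply, sub_apply, smul_apply, one_apply_eq_self, inner_add_right, inner_sub_right,
    inner_smul_right] at h1 ⊢
  linear_combination h1

/-- An eigenprojection at the coupling `t` in terms of the Green function at another coupling `t'`.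
The hypothesis on `φ` says that these vectors are complete in the range of `P`. -/
theorem enorm_eigProj_le (hRs : R.IsSymmetric) (hW : W.IsSymmetric) (hP : P.IsSymmetric)
    {ι : Type*} {φ : ι → H}
    (hφ : ∀ ψ θ, ‖inner ℂ (P ψ) θ‖ₑ ≤ ∑' i, ‖inner ℂ (φ i) ψ‖ₑ * ‖inner ℂ (φ i) θ‖ₑ)
    {t t' E : ℝ} (hE : E ∉ spec R (W + (t' : ℂ) • P)) (y : H) :
    ‖eigProj R (W + (t : ℂ) • P) E y‖ₑ ≤ ENNReal.ofReal |t' - t| *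
      ∑' i, ‖eigProj R (W + (t : ℂ) • P) E (φ i)‖ₑ *
        ‖inner ℂ (φ i) (invAdd R (W + (t' : ℂ) • P - ((E : ℂ) + 1) • 1) y)‖ₑ := by
  set Q := eigProj R (W + (t : ℂ) • P) E with hQ
  set K := (1 + R * ((W + (t : ℂ) • P) - ((E : ℂ) + 1) • 1)).ker with hK
  have hQs : ∀ a b, inner ℂ (Q a) b = inner ℂ a (Q b) := fun a b =>
    Submodule.inner_starProjection_left_eq_right K a b
  have hQQ : ∀ a, Q (Q a) = Q a := fun a =>
    Submodule.starProjection_eq_self_iff.2 (Submodule.starProjection_apply_mem K a)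
  set θ := invAdd R (W + (t' : ℂ) • P - ((E : ℂ) + 1) • 1) y with hθ
  rcases eq_or_ne ‖Q y‖ₑ 0 with h0 | h0
  · rw [h0]; exact zero_le
  have h1 : ‖Q y‖ₑ * ‖Q y‖ₑ = ‖inner ℂ (Q y) y‖ₑ := by
    have : inner ℂ (Q y) y = inner ℂ (Q y) (Q y) := by rw [hQs, hQs, hQQ]
    rw [this, inner_self_eq_norm_sq_to_K, ← ofReal_norm, ← ofReal_norm,
      ← ENNReal.ofReal_mul (norm_nonneg _), norm_pow, ← sq]
    simp
  have h2 : ‖inner ℂ (Q y) y‖ₑ ≤ ENNReal.ofReal |t' - t| * ∑' i, (‖Q (φ i)‖ₑ * ‖Q y‖ₑ) *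
      ‖inner ℂ (φ i) θ‖ₑ := by
    rw [inner_eigenvector_eq hRs hW hP (eigProj_mem E y) hE y, enorm_mul]
    refine mul_le_mul' (le_of_eq ?_) ((hφ _ _).trans (ENNReal.tsum_le_tsum fun i => ?_))
    · rw [← ofReal_norm, ← Complex.ofReal_sub, Complex.norm_real, Real.norm_eq_abs]
    · exact mul_le_mul' (enorm_inner_eigProj_le E _ _) le_rfl
  have h3 : ∑' i, (‖Q (φ i)‖ₑ * ‖Q y‖ₑ) * ‖inner ℂ (φ i) θ‖ₑ =
      (∑' i, ‖Q (φ i)‖ₑ * ‖inner ℂ (φ i) θ‖ₑ) * ‖Q y‖ₑ := by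
    rw [← ENNReal.tsum_mul_right]
    exact tsum_congr fun i => by ring
  rw [h3, ← mul_assoc, ← h1] at h2
  exact (ENNReal.mul_le_mul_iff_left h0 (by simp)).1 h2

/-! ### Fractional moments -/

/-- Fractional moments of eigenfunctions, averaged over the coupling `t`, are bounded by the
fractional moments of the Green function at any fixed coupling `t'`. -/
theorem lintegral_tsum_eigProj_rpow_le (hR : IsCompactOperator R) (hRs : R.IsSymmetric)
    (hW : W.IsSymmetric) (hP : P.IsSymmetric) (hPP : ∀ ψ, P (P ψ) = P ψ)
    {κ : Type*} [Countable κ] (b : κ → H) (hb : ∀ ψ, (∀ i, inner ℂ (b i) ψ = 0) → ψ = 0)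
    {ι : Type*} [Countable ι] {φ : ι → H} (hφ1 : ∀ i, ‖φ i‖ = 1) (hPφ : ∀ i, P (φ i) = φ i)
    (hφ : ∀ ψ θ, ‖inner ℂ (P ψ) θ‖ₑ ≤ ∑' i, ‖inner ℂ (φ i) ψ‖ₑ * ‖inner ℂ (φ i) θ‖ₑ)
    {s : ℝ} (hs0 : 0 < s) (hs1 : s < 1) {V : ℝ} (hV : 0 < V) {t' : ℝ} (ht' : t' ∈ Set.Icc 0 V)
    {J : Set ℝ} (hJ : MeasurableSet J) (m : ι) (y : H) :
    ∫⁻ t in Set.Icc 0 V, ∑' E : ℝ, J.indicator (fun E =>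
        ‖eigProj R (W + ((t : ℝ) : ℂ) • P) E (φ m)‖ₑ ^ (2 - s) *
          ‖eigProj R (W + (t : ℂ) • P) E y‖ₑ ^ s) E ≤
      ENNReal.ofReal V ^ s * (2 * ENNReal.ofReal (weightBound (V + 2))) *
        ∑' i, ∫⁻ E in J,
          ‖inner ℂ (φ i) (invAdd R (W + (t' : ℂ) • P - ((E : ℂ) + 1) • 1) y)‖ₑ ^ s := by
  set N := spec R (W + (t' : ℂ) • P) with hN
  have hNc : N.Countable := countable_spec hR hRs (isSymmetric_add_smul hW hP t') b hb
  set G : ι → ℝ → ℝ≥0∞ := fun i E =>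
    ‖inner ℂ (φ i) (invAdd R (W + (t' : ℂ) • P - ((E : ℂ) + 1) • 1) y)‖ₑ ^ s with hG
  have hGm : ∀ i, Measurable (G i) := by
    intro i
    refine (Measurable.enorm ?_).pow_const s
    exact measurable_inner_invAdd (S := fun E : ℝ => W + (t' : ℂ) • P - ((E : ℂ) + 1) • 1)
      (by fun_prop) _ _
  -- On the null set of energies in the spectrum at the coupling `t'` the weight is infinite.
  set F : ι → ℝ → ℝ≥0∞ := fun i E => J.indicator (G i) E + N.indicator (fun _ => ∞) E with hF
  have hFm : ∀ i, Measurable (F i) := fun i =>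
    ((hGm i).indicator hJ).add (measurable_const.indicator hNc.measurableSet)
  have hFint : ∀ i, ∫⁻ E, F i E = ∫⁻ E in J, G i E := by
    intro i
    simp only [hF]
    rw [lintegral_add_left ((hGm i).indicator hJ), lintegral_indicator hJ,
      lintegral_indicator hNc.measurableSet, Measure.restrict_eq_zero.2 (hNc.measure_zero _)]
    simp
  have hpt : ∀ t ∈ Set.Icc 0 V, ∀ E, J.indicator (fun E =>
        ‖eigProj R (W + ((t : ℝ) : ℂ) • P) E (φ m)‖ₑ ^ (2 - s) *
          ‖eigProj R (W + (t : ℂ) • P) E y‖ₑ ^ s) E ≤ ENNReal.ofReal V ^ s * ∑' i,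
        (‖eigProj R (W + (t : ℂ) • P) E (φ m)‖ₑ ^ 2 * F i E +
          ‖eigProj R (W + (t : ℂ) • P) E (φ i)‖ₑ ^ 2 * F i E) := by
    intro t ht E
    by_cases hEJ : E ∈ J
    swap
    · rw [Set.indicator_of_notMem hEJ]; exact zero_le
    rw [Set.indicator_of_mem hEJ]
    by_cases hE : E ∈ N
    · rcases eq_or_ne ‖eigProj R (W + (t : ℂ) • P) E (φ m)‖ₑ 0 with h0 | h0
      · rw [h0, ENNReal.zero_rpow_of_pos (by linarith), zero_mul]; exact zero_le
      · have : ∑' i, (‖eigProj R (W + (t : ℂ) • P) E (φ m)‖ₑ ^ 2 * F i E +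
          ‖eigProj R (W + (t : ℂ) • P) E (φ i)‖ₑ ^ 2 * F i E) = ∞ := by
          refine top_unique (le_trans ?_ (ENNReal.le_tsum m))
          have hFt : F m E = ∞ := by simp [hF, hE]
          rw [hFt, ENNReal.mul_top (pow_ne_zero 2 h0)]
          simp
        rw [this, ENNReal.mul_top]
        · exact le_top
        · exact (ENNReal.rpow_pos (by simpa using hV) (by simp)).ne'
    · have h1 := enorm_eigProj_le (t := t) hRs hW hP hφ hE y
      have htt : ENNReal.ofReal |t' - t| ≤ ENNReal.ofReal V :=
        ENNReal.ofReal_le_ofReal (abs_le.2 ⟨by linarith [ht.2, ht'.1], by linarith [ht.1, ht'.2]⟩)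
      have h2 := ENNReal.rpow_le_rpow (h1.trans (mul_le_mul' htt le_rfl)) hs0.le
      rw [ENNReal.mul_rpow_of_nonneg _ _ hs0.le] at h2
      refine (mul_le_mul' le_rfl (h2.trans (mul_le_mul' le_rfl
        (ENNReal.rpow_tsum_le_tsum_rpow _ hs0 hs1.le)))).trans ?_
      rw [mul_left_comm, ← ENNReal.tsum_mul_left]
      refine mul_le_mul' le_rfl (ENNReal.tsum_le_tsum fun i => ?_)
      rw [ENNReal.mul_rpow_of_nonneg _ _ hs0.le, ← mul_assoc, ← add_mul]
      refine mul_le_mul' (ENNReal.rpow_two_sub_mul_rpow_le _ _ hs0.le (by linarith)) ?_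
      simp [hF, hEJ, hE, hG]
  set C := ENNReal.ofReal (weightBound (V + 2)) with hC
  refine ENNReal.le_of_forall_pos_le_add fun ε hε _ => ?_
  have hA : ENNReal.ofReal V ^ s * (2 * C) ≠ ∞ :=
    ENNReal.mul_ne_top (ENNReal.rpow_ne_top_of_nonneg hs0.le (by simp))
      (ENNReal.mul_ne_top (by simp) (by simp [hC]))
  obtain ⟨η, hη0, hη⟩ : ∃ η : ℝ≥0∞, η ≠ 0 ∧ ENNReal.ofReal V ^ s * (2 * C) * η ≤ ε := by
    refine ⟨ε / (ENNReal.ofReal V ^ s * (2 * C)), ?_, ENNReal.mul_div_le⟩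
    exact (ENNReal.div_pos (by simpa using hε.ne') hA).ne'
  obtain ⟨δ, hδ0, hδ⟩ := ENNReal.exists_pos_sum_of_countable' hη0 ι
  choose M1 hM1m hM1 hM1int using fun i => exists_measurable_majorant hR hRs hW hP hPP (hφ1 m)
    (hPφ m) hV.le (hFm i) (hδ0 i).ne'
  choose M2 hM2m hM2 hM2int using fun i => exists_measurable_majorant hR hRs hW hP hPP (hφ1 i)
    (hPφ i) hV.le (hFm i) (hδ0 i).ne'
  calc _ ≤ ∫⁻ t in Set.Icc 0 V, ENNReal.ofReal V ^ s * ∑' i, (M1 i t + M2 i t) := by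
        refine setLIntegral_mono' measurableSet_Icc fun t ht => ?_
        refine (ENNReal.tsum_le_tsum fun E => hpt t ht E).trans ?_
        rw [ENNReal.tsum_mul_left, ENNReal.tsum_comm]
        refine mul_le_mul' le_rfl (ENNReal.tsum_le_tsum fun i => ?_)
        rw [ENNReal.tsum_add]
        exact add_le_add (hM1 i t) (hM2 i t)
    _ = ENNReal.ofReal V ^ s * ∑' i, ((∫⁻ t in Set.Icc 0 V, M1 i t) +
          ∫⁻ t in Set.Icc 0 V, M2 i t) := by
        have hm : ∀ i, Measurable fun t => M1 i t + M2 i t := fun i => (hM1m i).add (hM2m i)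
        rw [lintegral_const_mul _ (Measurable.tsum hm),
          lintegral_tsum fun i => (hm i).aemeasurable]
        simp_rw [lintegral_add_left (hM1m _)]
    _ ≤ ENNReal.ofReal V ^ s * ∑' i, (2 * C) * ((∫⁻ E in J, G i E) + δ i) := by
        refine mul_le_mul' le_rfl (ENNReal.tsum_le_tsum fun i => ?_)
        have h1 := hM1int i
        have h2 := hM2int i
        rw [hFint] at h1 h2
        refine (add_le_add h1 h2).trans (le_of_eq ?_)
        ring
    _ = ENNReal.ofReal V ^ s * (2 * C) * ∑' i, (∫⁻ E in J, G i E) +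
          ENNReal.ofReal V ^ s * (2 * C) * ∑' i, δ i := by
        rw [ENNReal.tsum_mul_left, ENNReal.tsum_add]; ring
    _ ≤ _ := by
        refine add_le_add le_rfl (le_trans ?_ hη)
        gcongr

/-! ### Hölder's inequality for the eigenfunction correlator -/

/-- Hölder's inequality with the exponents `2 - s` and `(2 - s) / (1 - s)`. -/
theorem tsum_indicator_inner_eigProj_le {s : ℝ} (hs0 : 0 < s) (hs1 : s < 1) (J : Set ℝ)
    (x y : H) :
    ∑' E : ℝ, J.indicator (fun E => ‖inner ℂ x (eigProj R W E y)‖ₑ) E ≤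
      (∑' E : ℝ, J.indicator (fun E => ‖eigProj R W E x‖ₑ ^ (2 - s) * ‖eigProj R W E y‖ₑ ^ s) E) ^
          (1 / (2 - s)) *
        (∑' E : ℝ, J.indicator (fun E => ‖eigProj R W E y‖ₑ ^ 2) E) ^ ((1 - s) / (2 - s)) := by
  have h2 : 0 < 2 - s := by linarith
  refine le_trans (ENNReal.tsum_le_tsum fun E => ?_) (ENNReal.tsum_rpow_mul_rpow_le _ _
    (by positivity) (div_nonneg (by linarith) h2.le) (by field_simp; ring))
  by_cases hE : E ∈ J
  · simp only [Set.indicator_of_mem hE]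
    refine (enorm_inner_eigProj_le E x y).trans (le_of_eq ?_)
    rw [ENNReal.mul_rpow_of_nonneg _ _ (by positivity), ← ENNReal.rpow_mul, ← ENNReal.rpow_mul,
      ← ENNReal.rpow_two, ← ENNReal.rpow_mul, mul_assoc, ← ENNReal.rpow_add_of_nonneg _ _
        (by positivity) (mul_nonneg (by norm_num) (div_nonneg (by linarith) h2.le))]
    have e1 : (2 - s) * (1 / (2 - s)) = 1 := by field_simp
    have e2 : s * (1 / (2 - s)) + 2 * ((1 - s) / (2 - s)) = 1 := by field_simp; ring
    rw [e1, e2, ENNReal.rpow_one, ENNReal.rpow_one]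
  · simp [Set.indicator_of_notMem hE]

/-- If `y` is an eigenvector of the unperturbed operator for an eigenvalue `e` that lies above the
energy window by at least `d`, the spectral projection of `y` onto the window is small. -/
theorem tsum_indicator_eigProj_sq_le (hRs : R.IsSymmetric) (hW : W.IsSymmetric) {e d c : ℝ}
    (hd : 0 < d) {y : H} (hy : ((e : ℂ) + 1) • R y = y) (hWy : ‖W y‖ ≤ c) {J : Set ℝ}
    (hJ : ∀ E ∈ J, E + d ≤ e) :
    ∑' E : ℝ, J.indicator (fun E => ‖eigProj R W E y‖ₑ ^ 2) E ≤ ENNReal.ofReal (c / d) ^ 2 := by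
  have hc : 0 ≤ c := (norm_nonneg _).trans hWy
  have key : ∀ E ∈ J, d * ‖eigProj R W E y‖ ≤ ‖eigProj R W E (W y)‖ := by
    intro E hE
    have h := eigProj_add_apply hRs hW E e (((e : ℂ) + 1) • y)
    rw [map_smul, hy, add_sub_cancel_left] at h
    rw [h, norm_smul, ← Complex.ofReal_sub, Complex.norm_real, Real.norm_eq_abs]
    gcongr
    rw [abs_sub_comm]
    exact (by linarith [hJ E hE] : d ≤ e - E).trans (le_abs_self _)
  have h1 : ∀ E, ENNReal.ofReal d ^ 2 * J.indicator (fun E => ‖eigProj R W E y‖ₑ ^ 2) E ≤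
      ‖eigProj R W E (W y)‖ₑ ^ 2 := by
    intro E
    by_cases hE : E ∈ J
    · rw [Set.indicator_of_mem hE, ← mul_pow, ← ofReal_norm, ← ofReal_norm,
        ← ENNReal.ofReal_mul hd.le]
      gcongr
      exact key E hE
    · simp [Set.indicator_of_notMem hE]
  have h2 := (ENNReal.tsum_le_tsum h1).trans (tsum_enorm_eigProj_sq_le hRs hW (W y))
  rw [ENNReal.tsum_mul_left] at h2
  have h3 : ‖W y‖ₑ ^ 2 ≤ ENNReal.ofReal c ^ 2 := by
    rw [← ofReal_norm]; gcongr
  rw [ENNReal.ofReal_div_of_pos hd, div_eq_mul_inv, mul_pow, ← ENNReal.inv_pow, ← div_eq_mul_inv]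
  rw [ENNReal.le_div_iff_mul_le (Or.inl (by simpa using hd)) (Or.inl (by simp))]
  rw [mul_comm]
  exact h2.trans h3

end CompactResolvent

namespace Holstein

variable {D : ℕ} {Λ : Finset (Fin D → ℤ)}

/-! ### Canonical commutation relations and displaced number states -/

theorem create_apply (u : Λ) (f : State Λ → ℂ) (p : State Λ) :
    create u f p = (Real.sqrt (p.2 u) : ℂ) * f (p.1, p.2 - Pi.single u 1) := rfl

theorem annihilate_apply (u : Λ) (f : State Λ → ℂ) (p : State Λ) :
    annihilate u f p = (Real.sqrt ((p.2 u : ℝ) + 1) : ℂ) * f (p.1, p.2 + Pi.single u 1) := rfl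

theorem ofReal_sqrt_mul_self {a : ℝ} (ha : 0 ≤ a) :
    (Real.sqrt a : ℂ) * (Real.sqrt a : ℂ) = (a : ℂ) := by
  rw [← Complex.ofReal_mul, Real.mul_self_sqrt ha]

theorem sub_single_add_single (u : Λ) {n : Config Λ} (hn : n u ≠ 0) :
    n - Pi.single u 1 + Pi.single u 1 = n := by
  funext w
  by_cases hw : w = u
  · subst hw; simp; omega
  · simp [hw]

theorem create_annihilate_apply (u : Λ) (f : State Λ → ℂ) (p : State Λ) :
    create u (annihilate u f) p = (p.2 u : ℂ) * f p := by
  rw [create_apply, annihilate_apply]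
  by_cases hn : p.2 u = 0
  · simp [hn]
  · simp only [sub_single_add_single u hn, Pi.sub_apply, Pi.single_eq_same]
    have h1 : (((p.2 u - 1 : ℕ) : ℝ) + 1) = (p.2 u : ℝ) := by
      rw [Nat.cast_sub (by omega)]; simp
    rw [h1, ← mul_assoc, ofReal_sqrt_mul_self (by positivity)]
    simp

theorem annihilate_create_apply (u : Λ) (f : State Λ → ℂ) (p : State Λ) :
    annihilate u (create u f) p = ((p.2 u : ℂ) + 1) * f p := by
  rw [annihilate_apply, create_apply]
  simp only [Pi.add_apply, Pi.single_eq_same, add_tsub_cancel_right, Nat.cast_add, Nat.cast_one]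
  rw [← mul_assoc, ofReal_sqrt_mul_self (by positivity)]
  simp

theorem annihilate_create (u : Λ) (f : State Λ → ℂ) :
    annihilate u (create u f) = create u (annihilate u f) + f := by
  funext p
  rw [Pi.add_apply, annihilate_create_apply, create_annihilate_apply]
  ring

theorem annihilate_create_pow (u : Λ) (f : State Λ → ℂ) (i : ℕ) :
    annihilate u ((create u ^ (i + 1)) f) =
      (create u ^ (i + 1)) (annihilate u f) + ((i : ℂ) + 1) • (create u ^ i) f := by
  induction i with
  | zero => simp [annihilate_create]
  | succ i ih =>
    have h : ∀ j g, create u ((create u ^ j) g) = (create u ^ (j + 1)) g := fun j g => by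
      rw [pow_succ', Module.End.mul_apply]
    rw [← h (i + 1) f, annihilate_create, ih, map_add, map_smul, h, h]
    push_cast
    module

theorem create_pow_apply (u : Λ) (i : ℕ) (f : State Λ → ℂ) (p : State Λ) :
    (create u ^ i) f p =
      (Real.sqrt ((p.2 u).descFactorial i) : ℂ) * f (p.1, p.2 - Pi.single u i) := by
  induction i generalizing p with
  | zero => simp
  | succ i ih =>
    rw [pow_succ', Module.End.mul_apply, create_apply, ih]
    simp only [Pi.sub_apply, Pi.single_eq_same, tsub_tsub, ← Pi.single_add, add_comm 1 i]
    rw [← mul_assoc, ← Complex.ofReal_mul, ← Real.sqrt_mul (by positivity)]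
    congr 3
    cases h : p.2 u with
    | zero => simp
    | succ k => rw [Nat.succ_descFactorial_succ]; simp

theorem annihilate_pow_numberKet_eq (x u : Λ) (m : Config Λ) (j : ℕ) :
    (annihilate u ^ j) (numberKet x m) =
      (Real.sqrt ((m u).descFactorial j) : ℂ) • numberKet x (m - Pi.single u j) := by
  induction j with
  | zero => simp
  | succ j ih =>
    rw [pow_succ', Module.End.mul_apply, ih, map_smul, annihilate_numberKet, smul_smul,
      tsub_tsub, ← Pi.single_add, ← Complex.ofReal_mul, ← Real.sqrt_mul (by positivity),
      Nat.descFactorial_succ]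
    simp [mul_comm]

/-- The matrix elements of the displacement operator. -/
theorem displacedKetFun_apply (β : ℂ) (x : Λ) (m : Config Λ) (p : State Λ) :
    displacedKetFun β x m p = (Real.exp (-‖β‖ ^ 2 / 2) : ℂ) *
      ∑ j ∈ Finset.range (m x + 1), ∑ i ∈ Finset.range (p.2 x + 1),
        (β ^ i / (i.factorial : ℂ)) * ((-(starRingEnd ℂ) β) ^ j / (j.factorial : ℂ)) *
          ((Real.sqrt ((m x).descFactorial j) : ℂ) * (Real.sqrt ((p.2 x).descFactorial i) : ℂ) *
            if p.1 = x ∧ p.2 - Pi.single x i = m - Pi.single x j then 1 else 0) := by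
  rw [displacedKetFun]
  congr 1
  refine Finset.sum_congr rfl fun j _ => Finset.sum_congr rfl fun i _ => ?_
  rw [annihilate_pow_numberKet_eq, map_smul, Pi.smul_apply, create_pow_apply, smul_eq_mul,
    numberKet, Pi.single_apply]
  simp only [Prod.mk.injEq]
  ring

/-- The displacement operator at `x` changes neither the particle position nor the oscillators at
other sites. -/
theorem displacedKetFun_ne_zero {β : ℂ} {x : Λ} {m : Config Λ} {p : State Λ}
    (h : displacedKetFun β x m p ≠ 0) : p.1 = x ∧ ∀ u, u ≠ x → p.2 u = m u := by
  rw [displacedKetFun_apply] at h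
  obtain ⟨j, _, hj⟩ := Finset.exists_ne_zero_of_sum_ne_zero (right_ne_zero_of_mul h)
  obtain ⟨i, _, hi⟩ := Finset.exists_ne_zero_of_sum_ne_zero hj
  have h1 := right_ne_zero_of_mul (right_ne_zero_of_mul hi)
  simp only [ne_eq, ite_eq_right_iff, one_ne_zero, imp_false, not_not] at h1
  refine ⟨h1.1, fun u hu => ?_⟩
  have := congrFun h1.2 u
  simpa [hu] using this

/-- The adjoint of the displacement operator at `β` is the displacement operator at `-β`. -/
theorem displacedKetFun_swap (β : ℂ) (x y : Λ) (m n : Config Λ) :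
    displacedKetFun β x m (y, n) = (starRingEnd ℂ) (displacedKetFun (-β) y n (x, m)) := by
  by_cases hxy : y = x
  · subst hxy
    rw [displacedKetFun_apply, displacedKetFun_apply, map_mul, map_sum, Finset.sum_comm]
    congr 1
    · rw [Complex.conj_ofReal, norm_neg]
    refine Finset.sum_congr rfl fun i _ => ?_
    rw [map_sum]
    refine Finset.sum_congr rfl fun j _ => ?_
    simp only [map_mul, map_div₀, map_pow, map_neg, Complex.conj_ofReal, Complex.conj_natCast,
      Complex.conj_conj, neg_neg, true_and, eq_comm (a := n - Pi.single y i)]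
    split_ifs <;> (simp; try ring)
  · have h1 : displacedKetFun β x m (y, n) = 0 := by
      by_contra h; exact hxy (displacedKetFun_ne_zero h).1
    have h2 : displacedKetFun (-β) y n (x, m) = 0 := by
      by_contra h; exact hxy (displacedKetFun_ne_zero h).1.symm
    rw [h1, h2, map_zero]

/-- The power series `exp(β b_x†)`, evaluated pointwise. -/
def expCreate (β : ℂ) (x : Λ) (f : State Λ → ℂ) : State Λ → ℂ := fun p =>
  ∑ i ∈ Finset.range (p.2 x + 1), (β ^ i / (i.factorial : ℂ)) * (create x ^ i) f p

theorem expCreate_smul (β : ℂ) (x : Λ) (c : ℂ) (f : State Λ → ℂ) :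
    expCreate β x (c • f) = c • expCreate β x f := by
  funext p
  simp only [expCreate, map_smul, Pi.smul_apply, smul_eq_mul, Finset.mul_sum]
  exact Finset.sum_congr rfl fun i _ => by ring

theorem annihilate_expCreate (β : ℂ) (x : Λ) (f : State Λ → ℂ) :
    annihilate x (expCreate β x f) = expCreate β x (annihilate x f) + β • expCreate β x f := by
  funext p
  have h1 : annihilate x (expCreate β x f) p =
      ∑ i ∈ Finset.range (p.2 x + 1 + 1),
        (β ^ i / (i.factorial : ℂ)) * annihilate x ((create x ^ i) f) p := by
    rw [annihilate_apply, expCreate, Finset.mul_sum]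
    simp only [Pi.add_apply, Pi.single_eq_same]
    refine Finset.sum_congr rfl fun i _ => ?_
    rw [annihilate_apply]; ring
  have h2 : ∑ i ∈ Finset.range (p.2 x + 1), β ^ (i + 1) / ((i + 1).factorial : ℂ) *
      (((i : ℂ) + 1) * (create x ^ i) f p) =
      ∑ i ∈ Finset.range (p.2 x + 1), β * (β ^ i / (i.factorial : ℂ) * (create x ^ i) f p) := by
    refine Finset.sum_congr rfl fun i _ => ?_
    rw [Nat.factorial_succ]
    have : (i : ℂ) + 1 ≠ 0 := by exact_mod_cast Nat.succ_ne_zero i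
    have : (i.factorial : ℂ) ≠ 0 := by exact_mod_cast i.factorial_ne_zero
    push_cast
    field_simp
    ring
  have h3 : expCreate β x (annihilate x f) p = ∑ i ∈ Finset.range (p.2 x + 1 + 1),
      β ^ i / (i.factorial : ℂ) * (create x ^ i) (annihilate x f) p := by
    rw [Finset.sum_range_succ, create_pow_apply x (p.2 x + 1),
      Nat.descFactorial_of_lt (Nat.lt_succ_self _), expCreate]
    simp
  rw [Finset.sum_range_succ'] at h1 h3
  rw [h1, Pi.add_apply, Pi.smul_apply, smul_eq_mul, h3, expCreate, Finset.mul_sum, ← h2]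
  simp only [annihilate_create_pow, Pi.add_apply, Pi.smul_apply, smul_eq_mul, mul_add,
    Finset.sum_add_distrib, pow_zero, Module.End.one_apply]
  ring

/-- The function `|x⟩ ⊗ exp(-β* b_x)|m⟩`. -/
def expAnnihilate (β : ℂ) (x : Λ) (m : Config Λ) : State Λ → ℂ :=
  ∑ j ∈ Finset.range (m x + 1), ((-(starRingEnd ℂ) β) ^ j / (j.factorial : ℂ)) •
    (annihilate x ^ j) (numberKet x m)

theorem displacedKetFun_eq (β : ℂ) (x : Λ) (m : Config Λ) :
    displacedKetFun β x m =
      (Real.exp (-‖β‖ ^ 2 / 2) : ℂ) • expCreate β x (expAnnihilate β x m) := by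
  funext p
  rw [displacedKetFun, Pi.smul_apply, smul_eq_mul, expCreate, Finset.sum_comm]
  congr 1
  refine Finset.sum_congr rfl fun i _ => ?_
  rw [expAnnihilate, map_sum, Finset.sum_apply, Finset.mul_sum]
  refine Finset.sum_congr rfl fun j _ => ?_
  rw [map_smul, Pi.smul_apply, smul_eq_mul]
  ring

theorem annihilate_expAnnihilate (β : ℂ) (x : Λ) (m : Config Λ) :
    annihilate x (expAnnihilate β x m) =
      (Real.sqrt (m x) : ℂ) • expAnnihilate β x (m - Pi.single x 1) := by
  have h1 : annihilate x (expAnnihilate β x m) = (Real.sqrt (m x) : ℂ) •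
      ∑ j ∈ Finset.range (m x + 1), ((-(starRingEnd ℂ) β) ^ j / (j.factorial : ℂ)) •
        (annihilate x ^ j) (numberKet x (m - Pi.single x 1)) := by
    rw [expAnnihilate, map_sum, Finset.smul_sum]
    refine Finset.sum_congr rfl fun j _ => ?_
    rw [map_smul, ← Module.End.mul_apply, ← pow_succ', pow_succ, Module.End.mul_apply,
      annihilate_numberKet, map_smul, smul_comm]
  rw [h1]
  by_cases hm : m x = 0
  · simp [hm]
  · congr 1
    have h2 : (m - Pi.single x 1 : Config Λ) x + 1 = m x := by simp; omega
    rw [Finset.sum_range_succ, annihilate_pow_numberKet_eq,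
      Nat.descFactorial_of_lt (by omega), expAnnihilate, h2]
    simp

/-- `b_x D_x(β) = D_x(β) (b_x + β)`. -/
theorem annihilate_displacedKetFun (β : ℂ) (x : Λ) (m : Config Λ) :
    annihilate x (displacedKetFun β x m) = β • displacedKetFun β x m +
      (Real.sqrt (m x) : ℂ) • displacedKetFun β x (m - Pi.single x 1) := by
  rw [displacedKetFun_eq, displacedKetFun_eq, map_smul, annihilate_expCreate,
    annihilate_expAnnihilate, expCreate_smul]
  module

/-- `b_x† D_x(β) = D_x(β) (b_x† + β*)`. -/
theorem create_displacedKetFun (β : ℂ) (x : Λ) (m : Config Λ) :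
    create x (displacedKetFun β x m) = (starRingEnd ℂ) β • displacedKetFun β x m +
      (Real.sqrt ((m x : ℝ) + 1) : ℂ) • displacedKetFun β x (m + Pi.single x 1) := by
  funext p
  obtain ⟨y, n⟩ := p
  -- Take adjoints in the relation for the annihilation operator at `-β`.
  by_cases hy : y = x
  · subst hy
    have h := congrArg (starRingEnd ℂ) (congrFun (annihilate_displacedKetFun (-β) y n) (y, m))
    rw [create_apply, Pi.add_apply, Pi.smul_apply, Pi.smul_apply, displacedKetFun_swap β,
      displacedKetFun_swap β, displacedKetFun_swap β]
    rw [annihilate_apply, Pi.add_apply, Pi.smul_apply, Pi.smul_apply] at h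
    simp only [smul_eq_mul, map_mul, map_add, map_neg, Complex.conj_ofReal] at h ⊢
    linear_combination -h
  · have h0 : ∀ m' n', displacedKetFun β x m' (y, n') = 0 := fun m' n' => by
      by_contra h; exact hy (displacedKetFun_ne_zero h).1
    simp [create_apply, h0]

/-! ### Adjoints of creation and annihilation operators -/

/-- The creation and annihilation operators are formal adjoints of each other on all functions, for
a site `u p.1` that may depend on the particle position. -/
theorem hasSum_conj_mul_create_iff (u : Λ → Λ) (f g : State Λ → ℂ) (S : ℂ) :
    HasSum (fun p => (starRingEnd ℂ) (f p) * create (u p.1) g p) S ↔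
      HasSum (fun p => (starRingEnd ℂ) (annihilate (u p.1) f p) * g p) S := by
  set e : State Λ → State Λ := fun p => (p.1, p.2 + Pi.single (u p.1) 1) with he
  have hinj : Function.Injective e := by
    rintro ⟨y, n⟩ ⟨y', n'⟩ h
    simp only [he, Prod.mk.injEq] at h
    obtain ⟨rfl, h⟩ := h
    simpa using h
  rw [← hinj.hasSum_iff]
  · refine iff_of_eq (congrArg (fun F => HasSum F S) ?_)
    funext p
    simp only [Function.comp_apply, he, create_apply, annihilate_apply, Pi.add_apply,
      Pi.single_eq_same, add_tsub_cancel_right, Nat.cast_add, Nat.cast_one, map_mul,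
      Complex.conj_ofReal]
    ring
  · intro p hp
    have h0 : p.2 (u p.1) = 0 := by
      by_contra h0
      exact hp ⟨(p.1, p.2 - Pi.single (u p.1) 1),
        Prod.ext rfl (sub_single_add_single (u p.1) h0)⟩
    simp [create_apply, h0]

theorem hasSum_conj_mul_annihilate_iff (u : Λ → Λ) (f g : State Λ → ℂ) (S : ℂ) :
    HasSum (fun p => (starRingEnd ℂ) (f p) * annihilate (u p.1) g p) S ↔
      HasSum (fun p => (starRingEnd ℂ) (create (u p.1) f p) * g p) S := by
  have h := hasSum_conj_mul_create_iff u g f ((starRingEnd ℂ) S)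
  have h1 : ∀ F : State Λ → ℂ, HasSum F S ↔
      HasSum (fun p => (starRingEnd ℂ) (F p)) ((starRingEnd ℂ) S) := fun F =>
    (Complex.hasSum_conj' (f := F) (x := S)).symm
  rw [h1, h1 fun p => (starRingEnd ℂ) (create (u p.1) f p) * g p]
  simp only [map_mul, Complex.conj_conj]
  simp only [mul_comm] at h ⊢
  exact h.symm

theorem hasSum_inner (f g : Space Λ) :
    HasSum (fun p => (starRingEnd ℂ) (f p) * g p) (inner ℂ f g) := by
  have := lp.hasSum_inner (𝕜 := ℂ) f g
  simpa [mul_comm] using this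

/-! ### The displaced number states form a Hilbert basis -/

theorem coe_displacedKet (β : ℂ) (x : Λ) (m : Config Λ) :
    ⇑(displacedKet β x m) = displacedKetFun β x m := rfl

/-- The ladder relations move an excitation at `x` from the right to the left of the inner product.
-/
theorem inner_displacedKet_succ (β : ℂ) (x : Λ) (m m' : Config Λ) :
    (Real.sqrt ((m' x : ℝ) + 1) : ℂ) *
        inner ℂ (displacedKet β x m) (displacedKet β x (m' + Pi.single x 1)) =
      (Real.sqrt (m x) : ℂ) *
        inner ℂ (displacedKet β x (m - Pi.single x 1)) (displacedKet β x m') := by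
  have h1 := hasSum_inner (displacedKet β x m) ((starRingEnd ℂ) β • displacedKet β x m' +
    (Real.sqrt ((m' x : ℝ) + 1) : ℂ) • displacedKet β x (m' + Pi.single x 1))
  have h2 := hasSum_inner (β • displacedKet β x m +
    (Real.sqrt (m x) : ℂ) • displacedKet β x (m - Pi.single x 1)) (displacedKet β x m')
  simp only [lp.coeFn_add, lp.coeFn_smul, coe_displacedKet, ← annihilate_displacedKetFun,
    ← create_displacedKetFun] at h1 h2
  have h3 := ((hasSum_conj_mul_create_iff (fun _ => x) _ _ _).1 h1).unique h2
  simp only [inner_add_left, inner_add_right, inner_smul_left, inner_smul_right,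
    Complex.conj_ofReal] at h3
  linear_combination h3

theorem inner_displacedKet_eq_zero {β : ℂ} {x x' : Λ} {m m' : Config Λ}
    (h : x = x' → ∃ u, u ≠ x ∧ m u ≠ m' u) :
    inner ℂ (displacedKet β x m) (displacedKet β x' m') = 0 := by
  refine (hasSum_inner _ _).unique ?_
  have h0 : ∀ p, (starRingEnd ℂ) (displacedKetFun β x m p) * displacedKetFun β x' m' p = 0 := by
    intro p
    by_contra hp
    obtain ⟨h1, h2⟩ := displacedKetFun_ne_zero (right_ne_zero_of_mul hp)
    obtain ⟨h3, h4⟩ := displacedKetFun_ne_zero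
      ((map_ne_zero (starRingEnd ℂ)).1 (left_ne_zero_of_mul hp))
    obtain ⟨u, hu, hmu⟩ := h (h3.symm.trans h1)
    exact hmu (by rw [← h4 u hu, h2 u (by rwa [← h1, h3])])
  simp only [coe_displacedKet, h0]
  exact hasSum_zero

/-- Coherent states are normalized. -/
theorem inner_displacedKet_self_of_eq_zero (β : ℂ) (x : Λ) {m : Config Λ} (hm : m x = 0) :
    inner ℂ (displacedKet β x m) (displacedKet β x m) = 1 := by
  refine (hasSum_inner _ _).unique ?_
  set e : ℕ → State Λ := fun i => (x, m + Pi.single x i) with he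
  have hinj : Function.Injective e := by
    intro i i' h; simpa [he] using h
  have hval : ∀ i, displacedKetFun β x m (e i) = (Real.exp (-‖β‖ ^ 2 / 2) : ℂ) *
      (β ^ i / (i.factorial : ℂ) * (Real.sqrt i.factorial : ℂ)) := by
    intro i
    rw [displacedKetFun_apply, hm, zero_add, Finset.sum_range_one]
    congr 1
    have hx : (e i).2 x = i := by simp [he, hm]
    rw [hx, Finset.sum_eq_single i]
    · simp [he, Nat.descFactorial_self]
    · intro j hj hji
      rw [if_neg]
      · simp
      · rintro ⟨-, h⟩
        have := congrFun h x
        simp [he, hm] at this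
        have := Finset.mem_range.1 hj
        omega
    · simp
  rw [← hinj.hasSum_iff]
  · have h1 : ∀ i, (starRingEnd ℂ) (displacedKetFun β x m (e i)) * displacedKetFun β x m (e i) =
        ((Real.exp (-‖β‖ ^ 2) * ((‖β‖ ^ 2) ^ i / i.factorial) : ℝ) : ℂ) := by
      intro i
      have hf : (0 : ℝ) < i.factorial := by positivity
      rw [Complex.conj_mul', hval, norm_mul, norm_mul, norm_div, norm_pow, Complex.norm_real,
        Complex.norm_real, Complex.norm_natCast, Real.norm_eq_abs, Real.norm_eq_abs,
        ← Complex.ofReal_pow]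
      congr 1
      rw [mul_pow, mul_pow, sq_abs, sq_abs, Real.sq_sqrt hf.le, ← Real.exp_nat_mul]
      have : ((2 : ℕ) : ℝ) * (-‖β‖ ^ 2 / 2) = -‖β‖ ^ 2 := by push_cast; ring
      rw [this]
      field_simp
      ring
    have h2 : HasSum (fun i : ℕ => Real.exp (-‖β‖ ^ 2) * ((‖β‖ ^ 2) ^ i / i.factorial)) 1 := by
      have := (NormedSpace.expSeries_div_hasSum_exp (𝔸 := ℝ) (‖β‖ ^ 2)).mul_left
        (Real.exp (-‖β‖ ^ 2))
      rw [← Real.exp_eq_exp_ℝ, ← Real.exp_add, neg_add_cancel, Real.exp_zero] at this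
      exact this
    have h3 := Complex.hasSum_ofReal.2 h2
    rw [Complex.ofReal_one] at h3
    exact h3.congr_fun fun i => h1 i
  · intro p hp
    have : displacedKetFun β x m p = 0 := by
      by_contra h
      obtain ⟨hp1, hp2⟩ := displacedKetFun_ne_zero h
      refine hp ⟨p.2 x, Prod.ext hp1.symm ?_⟩
      funext u
      by_cases hu : u = x
      · subst hu; simp [he, hm]
      · simp [he, hu, hp2 u hu]
    rw [coe_displacedKet, this, mul_zero]

theorem inner_displacedKet (β : ℂ) (x : Λ) (m m' : Config Λ) :
    inner ℂ (displacedKet β x m) (displacedKet β x m') = if m = m' then 1 else 0 := by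
  have hpos : ∀ k : ℕ, (Real.sqrt ((k : ℝ) + 1) : ℂ) ≠ 0 := fun k => by
    rw [Complex.ofReal_ne_zero]; positivity
  induction hk : m' x generalizing m m' with
  | zero =>
    by_cases hm : m x = 0
    · split_ifs with h
      · subst h; exact inner_displacedKet_self_of_eq_zero β x hm
      · refine inner_displacedKet_eq_zero fun _ => ?_
        obtain ⟨u, hu⟩ := Function.ne_iff.1 h
        exact ⟨u, fun hux => hu (by rw [hux, hm, hk]), hu⟩
    · have hne : m ≠ m' := fun h => hm (by rw [h, hk])
      rw [if_neg hne, ← inner_conj_symm]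
      have h := inner_displacedKet_succ β x m' (m - Pi.single x 1)
      rw [sub_single_add_single x hm, hk] at h
      simp only [Nat.cast_zero, Real.sqrt_zero, Complex.ofReal_zero, zero_mul, mul_eq_zero,
        hpos, false_or] at h
      rw [h, map_zero]
  | succ k ih =>
    have hm' : m' x ≠ 0 := by omega
    have h := inner_displacedKet_succ β x m (m' - Pi.single x 1)
    have hk' : (m' - Pi.single x 1 : Config Λ) x = k := by simp [hk]
    rw [sub_single_add_single x hm', hk', ih _ _ hk'] at h
    by_cases hm : m x = 0
    · have hne : m ≠ m' := fun h => hm' (by rw [← h, hm])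
      simp only [hm, Nat.cast_zero, Real.sqrt_zero, Complex.ofReal_zero, zero_mul, mul_eq_zero,
        hpos, false_or] at h
      rw [if_neg hne, h]
    · by_cases hmm : m = m'
      · subst hmm
        rw [if_pos rfl, mul_one, hk] at h
        rw [if_pos rfl]
        refine mul_left_cancel₀ (hpos k) ?_
        rw [h]; simp
      · have hne : m - Pi.single x 1 ≠ m' - Pi.single x 1 := fun h' => hmm (by
          rw [← sub_single_add_single x hm, h', sub_single_add_single x hm'])
        rw [if_neg hne, mul_zero] at h
        rw [if_neg hmm]
        exact (mul_eq_zero.1 h).resolve_left (hpos k)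

theorem orthonormal_displacedKet (β : ℂ) :
    Orthonormal ℂ fun q : State Λ => displacedKet β q.1 q.2 := by
  rw [orthonormal_iff_ite]
  rintro ⟨x, m⟩ ⟨x', m'⟩
  by_cases hx : x = x'
  · subst hx
    simp [inner_displacedKet]
  · rw [if_neg (by simp [hx])]
    exact inner_displacedKet_eq_zero fun h => absurd h hx

theorem norm_displacedKet (β : ℂ) (x : Λ) (m : Config Λ) : ‖displacedKet β x m‖ = 1 :=
  (orthonormal_displacedKet β).1 (x, m)

/-- Completeness: the rows of the unitary matrix of the displacement operators at `β` are the
conjugated columns of the matrix at `-β`, hence are normalized as well. -/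
theorem displacedKet_complete (β : ℂ) (ψ : Space Λ)
    (h : ∀ q : State Λ, inner ℂ (displacedKet β q.1 q.2) ψ = 0) : ψ = 0 := by
  refine lp.ext (funext fun p => ?_)
  set e : Space Λ := lp.single 2 p (1 : ℂ) with he
  have hinner : ∀ f : Space Λ, inner ℂ e f = f p := fun f => by
    rw [he, lp.inner_single_left]; simp
  have he1 : ‖e‖ ^ 2 = 1 := by
    have := hinner e
    rw [inner_self_eq_norm_sq_to_K, he, lp.single_apply_self] at this
    exact Complex.ofReal_injective (by rw [Complex.ofReal_pow]; exact this)
  -- The component `v` of `e` orthogonal to `ψ` has the same coefficients as `e`, with square sum one.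
  set v := e - (ℂ ∙ ψ).starProjection e with hv
  have hsum : HasSum (fun q : State Λ => ‖inner ℂ (displacedKet β q.1 q.2) v‖ ^ 2) 1 := by
    have h1 : ∀ q : State Λ, ‖inner ℂ (displacedKet β q.1 q.2) v‖ ^ 2 =
        ‖displacedKetFun (-β) p.1 p.2 q‖ ^ 2 := by
      intro q
      obtain ⟨c, hc⟩ := Submodule.mem_span_singleton.1
        (Submodule.starProjection_apply_mem (ℂ ∙ ψ) e)
      have hq := displacedKetFun_swap β q.1 p.1 q.2 p.2
      rw [hv, inner_sub_right, ← hc, inner_smul_right, h q, mul_zero, sub_zero,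
        ← inner_conj_symm, hinner, coe_displacedKet, RCLike.norm_conj, hq, RCLike.norm_conj]
    simp_rw [h1]
    have h2 := hasSum_inner (displacedKet (-β) p.1 p.2) (displacedKet (-β) p.1 p.2)
    rw [inner_displacedKet, if_pos rfl] at h2
    refine Complex.hasSum_ofReal.1 ?_
    simpa [Complex.conj_mul', coe_displacedKet] using h2
  have hle : 1 ≤ ‖v‖ ^ 2 := by
    rw [← hsum.tsum_eq]
    exact (orthonormal_displacedKet β).tsum_inner_products_le v
  have hpyth : ‖e‖ ^ 2 = ‖(ℂ ∙ ψ).starProjection e‖ ^ 2 + ‖v‖ ^ 2 := by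
    have h0 : inner ℂ ((ℂ ∙ ψ).starProjection e) v = 0 := by
      rw [← inner_conj_symm, hv, Submodule.starProjection_inner_eq_zero e _
        (Submodule.starProjection_apply_mem _ _), map_zero]
    have := norm_add_sq_eq_norm_sq_add_norm_sq_of_inner_eq_zero _ _ h0
    rw [hv, add_sub_cancel] at this
    nlinarith
  have h0 : (ℂ ∙ ψ).starProjection e = 0 := by
    have : ‖(ℂ ∙ ψ).starProjection e‖ ^ 2 = 0 := by
      nlinarith [sq_nonneg ‖(ℂ ∙ ψ).starProjection e‖]
    simpa using this
  have h1 := (Submodule.mem_orthogonal _ _).1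
    ((Submodule.starProjection_apply_eq_zero_iff (ℂ ∙ ψ)).1 h0) ψ
    (Submodule.mem_span_singleton_self ψ)
  rw [← hinner ψ, ← inner_conj_symm, h1, map_zero]
  rfl

/-- The eigenbasis of the Hamiltonian without hopping and potential. -/
def displacedBasis (Λ : Finset (Fin D → ℤ)) (β : ℂ) : HilbertBasis (State Λ) ℂ (Space Λ) :=
  HilbertBasis.mkOfOrthogonalEqBot (orthonormal_displacedKet β) (by
    rw [Submodule.eq_bot_iff]
    intro ψ hψ
    refine displacedKet_complete β ψ fun q => ?_
    exact (Submodule.mem_orthogonal _ _).1 hψ _ (Submodule.subset_span ⟨q, rfl⟩))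

theorem displacedBasis_apply (β : ℂ) (q : State Λ) :
    displacedBasis Λ β q = displacedKet β q.1 q.2 := by
  rw [displacedBasis, HilbertBasis.coe_mkOfOrthogonalEqBot]

end Holstein

namespace CompactResolvent

variable {H : Type*} [NormedAddCommGroup H] [InnerProductSpace ℂ H] [CompleteSpace H]
variable {R W : H →L[ℂ] H}

/-! ### Resolvent and eigenprojections of an unbounded operator -/

/-- `A = R⁻¹ - 1 + W` as an unbounded operator with domain the range of `R`. Injectivity of `R` is not
part of the definition, as it follows from `apply_eq`. -/
structure IsPerturbation (A : H →ₗ.[ℂ] H) (R W : H →L[ℂ] H) : Prop where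
  mem_domain_iff : ∀ ψ, ψ ∈ A.domain ↔ ∃ χ, R χ = ψ
  apply_eq : ∀ χ (h : R χ ∈ A.domain), A ⟨R χ, h⟩ = χ - R χ + W (R χ)

namespace IsPerturbation

variable {A : H →ₗ.[ℂ] H} (hA : IsPerturbation A R W)
include hA

theorem apply_sub (z : ℂ) (χ : H) (h : R χ ∈ A.domain) :
    A ⟨R χ, h⟩ - z • R χ = χ + (W - (z + 1) • 1 : H →L[ℂ] H) (R χ) := by
  rw [hA.apply_eq, sub_apply, smul_apply, one_apply_eq_self]
  module

theorem isResolventAt {z : ℂ} (hu : IsUnit (1 + (W - (z + 1) • 1) * R)) :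
    UnboundedOperator.IsResolventAt A z (invAdd R (W - (z + 1) • 1)) := by
  refine ⟨fun φ => ?_, fun ψ => ?_⟩
  · obtain ⟨χ, hχ, hφ⟩ := invAdd_eq hu φ
    rw [← hχ]
    refine ⟨(hA.mem_domain_iff _).2 ⟨χ, rfl⟩, ?_⟩
    rw [hA.apply_sub, hφ]
  · obtain ⟨ψ, hψ⟩ := ψ
    obtain ⟨χ, rfl⟩ := (hA.mem_domain_iff _).1 hψ
    rw [hA.apply_sub]
    exact (invAdd_apply_of_add hu rfl).symm

theorem isUnit_of_isResolventAt {z : ℂ} {S : H →L[ℂ] H}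
    (hS : UnboundedOperator.IsResolventAt A z S) : IsUnit (1 + (W - (z + 1) • 1) * R) := by
  set T : H →L[ℂ] H := W - (z + 1) • 1 with hT
  refine ⟨⟨1 + T * R, 1 - T * S, ?_, ?_⟩, rfl⟩
  · ext φ
    obtain ⟨h, hφ⟩ := hS.1 φ
    obtain ⟨χ, hχ⟩ := (hA.mem_domain_iff _).1 h
    have h1 : χ + T (R χ) = φ := by
      have h2 : A ⟨R χ, hχ ▸ h⟩ - z • R χ = φ := by simpa only [hχ] using hφ
      rw [← h2, hA.apply_sub]
    have h2 : φ - T (S φ) = χ := by rw [← hχ, ← h1]; abel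
    simp only [mul_apply_eq_comp, add_apply, sub_apply, one_apply_eq_self, h2, h1]
  · ext χ
    have h : R χ ∈ A.domain := (hA.mem_domain_iff _).2 ⟨χ, rfl⟩
    have h1 := hS.2 ⟨R χ, h⟩
    simp only [hA.apply_sub] at h1
    simp only [mul_apply_eq_comp, add_apply, sub_apply, one_apply_eq_self]
    rw [h1]
    abel

theorem resolvent_eq (z : ℂ) :
    UnboundedOperator.resolvent A z = invAdd R (W - (z + 1) • 1) := by
  by_cases h : ∃ S : H →L[ℂ] H, UnboundedOperator.IsResolventAt A z S
  · have hu := hA.isUnit_of_isResolventAt h.choose_spec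
    rw [UnboundedOperator.resolvent, dif_pos h]
    ext φ
    obtain ⟨h1, h2⟩ := h.choose_spec.1 φ
    have h3 := (hA.isResolventAt hu).2 ⟨_, h1⟩
    simp only [h2] at h3
    exact h3.symm
  · have hu : ¬ IsUnit (1 + (W - (z + 1) • 1) * R) := fun hu => h ⟨_, hA.isResolventAt hu⟩
    rw [UnboundedOperator.resolvent, dif_neg h, invAdd, Ring.inverse_non_unit _ hu, mul_zero]

theorem eigenspace_eq (z : ℂ) :
    UnboundedOperator.eigenspace A z = (1 + R * (W - (z + 1) • 1)).ker := by
  ext ψ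
  rw [mem_ker]
  constructor
  · rintro ⟨h, hψ⟩
    obtain ⟨χ, rfl⟩ := (hA.mem_domain_iff _).1 h
    have := hA.apply_sub z χ h
    rw [hψ, sub_self] at this
    rw [← map_add, ← this, map_zero]
  · intro hψ
    set T : H →L[ℂ] H := W - (z + 1) • 1 with hT
    have h1 : R (-(T ψ)) = ψ := by rw [map_neg, ← eq_neg_of_add_eq_zero_left hψ]
    have h : R (-(T ψ)) ∈ A.domain := (hA.mem_domain_iff _).2 ⟨_, rfl⟩
    have h2 := hA.apply_sub z _ h
    simp only [h1, ← hT] at h2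
    refine ⟨h1 ▸ h, ?_⟩
    rw [← sub_eq_zero, h2, neg_add_cancel]

theorem eigenprojection_eq (E : ℝ) :
    UnboundedOperator.eigenprojection A E = eigProj R W E := by
  have h : (UnboundedOperator.eigenspace A E).topologicalClosure =
      (1 + R * (W - ((E : ℂ) + 1) • 1)).ker := by
    rw [hA.eigenspace_eq]
    exact (ContinuousLinearMap.isClosed_ker _).submodule_topologicalClosure_eq
  unfold UnboundedOperator.eigenprojection eigProj kerProj
  congr 1

end IsPerturbation

/-! ### Diagonal operators -/

section Diagonal

variable {ι : Type*}

theorem memℓp_mul {c : ι → ℝ} {C : ℝ} (hc : ∀ i, |c i| ≤ C) (f : lp (fun _ : ι => ℂ) 2) :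
    Memℓp (fun i => (c i : ℂ) * f i) 2 := by
  refine ((lp.memℓp f).const_mul (C : ℂ)).mono' fun i => ?_
  rw [norm_mul, norm_mul, Complex.norm_real, Complex.norm_real, Real.norm_eq_abs]
  gcongr
  exact (hc i).trans (le_abs_self C)

/-- Multiplication by a bounded sequence on `ℓ²`. -/
def diagonal (c : ι → ℝ) (C : ℝ) (hc : ∀ i, |c i| ≤ C) :
    lp (fun _ : ι => ℂ) 2 →L[ℂ] lp (fun _ : ι => ℂ) 2 :=
  LinearMap.mkContinuous
    { toFun := fun f => ⟨fun i => (c i : ℂ) * f i, memℓp_mul hc f⟩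
      map_add' := fun f g => lp.ext (funext fun i => mul_add _ _ _)
      map_smul' := fun a f => lp.ext (funext fun i => mul_left_comm _ _ _) } |C| (fun f => by
    have h : ‖(C : ℂ) • f‖ = |C| * ‖f‖ := by
      rw [norm_smul, Complex.norm_real, Real.norm_eq_abs]
    rw [← h]
    refine lp.norm_mono (by simp) fun i => ?_
    simp only [lp.coeFn_smul, Pi.smul_apply, smul_eq_mul, norm_mul, Complex.norm_real,
      Real.norm_eq_abs, LinearMap.coe_mk, AddHom.coe_mk]
    exact mul_le_mul_of_nonneg_right ((hc i).trans (le_abs_self C)) (norm_nonneg _))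

theorem diagonal_apply (c : ι → ℝ) (C : ℝ) (hc : ∀ i, |c i| ≤ C) (f : lp (fun _ : ι => ℂ) 2)
    (i : ι) : diagonal c C hc f i = (c i : ℂ) * f i := rfl

theorem isSymmetric_diagonal (c : ι → ℝ) (C : ℝ) (hc : ∀ i, |c i| ≤ C) :
    (diagonal c C hc).IsSymmetric := by
  intro f g
  simp only [ContinuousLinearMap.coe_coe, lp.inner_eq_tsum]
  refine tsum_congr fun i => ?_
  simp only [diagonal_apply, RCLike.inner_apply, map_mul, Complex.conj_ofReal]
  ring

theorem isCompactOperator_diagonal (c : ι → ℝ) (C : ℝ) (hc : ∀ i, |c i| ≤ C)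
    (h0 : Filter.Tendsto c Filter.cofinite (nhds 0)) : IsCompactOperator (diagonal c C hc) := by
  classical
  set F : Finset ι → lp (fun _ : ι => ℂ) 2 →L[ℂ] lp (fun _ : ι => ℂ) 2 := fun S =>
    ∑ i ∈ S, (c i : ℂ) • (lp.singleContinuousLinearMap ℂ (fun _ : ι => ℂ) 2 i ∘L
      lp.evalCLM ℂ (fun _ : ι => ℂ) 2 i) with hF
  have hFc : ∀ S, IsCompactOperator (F S) := by
    intro S
    refine Submodule.sum_mem (compactOperator (RingHom.id ℂ) _ _) fun i _ =>
      Submodule.smul_mem _ _ ?_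
    have h : IsCompactOperator (id : ℂ → ℂ) :=
      isCompactOperator_id_iff_locallyCompactSpace.2 inferInstance
    exact (h.comp_clm (lp.evalCLM ℂ (fun _ : ι => ℂ) 2 i)).clm_comp
      (lp.singleContinuousLinearMap ℂ (fun _ : ι => ℂ) 2 i)
  have hFapply : ∀ S f j, F S f j = if j ∈ S then (c j : ℂ) * f j else 0 := by
    intro S f j
    simp only [hF, sum_apply, lp.coeFn_sum, Finset.sum_apply, smul_apply,
      lp.coeFn_smul, Pi.smul_apply, ContinuousLinearMap.comp_apply,
      lp.singleContinuousLinearMap_apply, lp.single_apply, smul_eq_mul]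
    simp only [Pi.single_apply, mul_ite, mul_zero, Finset.sum_ite_eq]
    rfl
  refine isCompactOperator_of_tendsto (l := Filter.atTop) (F := F) ?_
    (Filter.Eventually.of_forall hFc)
  rw [Metric.tendsto_atTop]
  intro ε hε
  have hfin : {i | ¬ |c i| < ε / 2}.Finite := by
    have := h0.eventually (Metric.ball_mem_nhds 0 (half_pos hε))
    simpa [Filter.eventually_cofinite] using this
  refine ⟨hfin.toFinset, fun S hS => ?_⟩
  rw [dist_eq_norm]
  refine lt_of_le_of_lt (ContinuousLinearMap.opNorm_le_bound _ (half_pos hε).le fun f => ?_)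
    (half_lt_self hε)
  have h : ‖((ε / 2 : ℝ) : ℂ) • f‖ = ε / 2 * ‖f‖ := by
    rw [norm_smul, Complex.norm_real, Real.norm_eq_abs, abs_of_pos (half_pos hε)]
  rw [← h]
  refine lp.norm_mono (by simp) fun j => ?_
  rw [sub_apply, lp.coeFn_sub, Pi.sub_apply, hFapply, diagonal_apply, lp.coeFn_smul,
    Pi.smul_apply, smul_eq_mul, norm_mul, Complex.norm_real, Real.norm_eq_abs,
    abs_of_pos (half_pos hε)]
  by_cases hj : j ∈ S
  · rw [if_pos hj, sub_self, norm_zero]; positivity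
  · rw [if_neg hj, zero_sub, norm_neg, norm_mul, Complex.norm_real, Real.norm_eq_abs]
    have : |c j| < ε / 2 := by
      by_contra hc
      exact hj (hS.le (hfin.mem_toFinset.2 hc))
    gcongr

/-! ### Operators diagonal in a Hilbert basis -/

variable {E : Type*} [NormedAddCommGroup E] [InnerProductSpace ℂ E]

/-- The operator that is diagonal in the given Hilbert basis. -/
def diagonalIn (b : HilbertBasis ι ℂ E) (c : ι → ℝ) (C : ℝ) (hc : ∀ i, |c i| ≤ C) : E →L[ℂ] E :=
  (b.repr.symm.toContinuousLinearEquiv : lp (fun _ : ι => ℂ) 2 →L[ℂ] E) ∘L diagonal c C hc ∘L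
    (b.repr.toContinuousLinearEquiv : E →L[ℂ] lp (fun _ : ι => ℂ) 2)

theorem diagonalIn_apply (b : HilbertBasis ι ℂ E) (c : ι → ℝ) (C : ℝ) (hc : ∀ i, |c i| ≤ C)
    (ψ : E) : diagonalIn b c C hc ψ = b.repr.symm (diagonal c C hc (b.repr ψ)) := rfl

theorem diagonalIn_basis (b : HilbertBasis ι ℂ E) (c : ι → ℝ) (C : ℝ) (hc : ∀ i, |c i| ≤ C)
    (i : ι) : diagonalIn b c C hc (b i) = (c i : ℂ) • b i := by
  classical
  rw [diagonalIn_apply, LinearIsometryEquiv.symm_apply_eq, map_smul, b.repr_self]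
  refine lp.ext (funext fun j => ?_)
  rw [diagonal_apply, lp.coeFn_smul, Pi.smul_apply, smul_eq_mul, lp.single_apply]
  by_cases h : j = i
  · subst h; rfl
  · simp [h]

theorem isSymmetric_diagonalIn (b : HilbertBasis ι ℂ E) (c : ι → ℝ) (C : ℝ)
    (hc : ∀ i, |c i| ≤ C) : (diagonalIn b c C hc).IsSymmetric := by
  intro f g
  simp only [ContinuousLinearMap.coe_coe, diagonalIn_apply]
  rw [← b.repr.inner_map_map, ← b.repr.inner_map_map f, LinearIsometryEquiv.apply_symm_apply,
    LinearIsometryEquiv.apply_symm_apply]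
  exact isSymmetric_diagonal c C hc _ _

theorem isCompactOperator_diagonalIn (b : HilbertBasis ι ℂ E) (c : ι → ℝ) (C : ℝ)
    (hc : ∀ i, |c i| ≤ C) (h0 : Filter.Tendsto c Filter.cofinite (nhds 0)) :
    IsCompactOperator (diagonalIn b c C hc) :=
  ((isCompactOperator_diagonal c C hc h0).comp_clm
    (b.repr.toContinuousLinearEquiv : E →L[ℂ] lp (fun _ : ι => ℂ) 2)).clm_comp
    (b.repr.symm.toContinuousLinearEquiv : lp (fun _ : ι => ℂ) 2 →L[ℂ] E)

end Diagonal

end CompactResolvent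

namespace Holstein

open CompactResolvent

variable {D : ℕ} {Λ : Finset (Fin D → ℤ)}

/-! ### Hopping and potential as bounded operators -/

theorem memℓp_hop (x y : Λ) (ψ : Space Λ) :
    Memℓp (fun p : State Λ => if p.1 = x then ψ (y, p.2) else 0) 2 := by
  have hinj : Function.Injective fun n : Config Λ => ((x, n) : State Λ) :=
    Prod.mk_right_injective x
  have hinj' : Function.Injective fun n : Config Λ => ((y, n) : State Λ) :=
    Prod.mk_right_injective y
  refine memℓp_gen ((hinj.summable_iff ?_).1 ?_)
  · rintro ⟨z, n⟩ hp
    have : z ≠ x := fun h => hp ⟨n, by rw [h]⟩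
    simp [this]
  · have := ((lp.memℓp ψ).summable (by simp)).comp_injective hinj'
    simpa [Function.comp_def] using this

/-- The operator `|x⟩⟨y|` on the particle, tensored with the identity on the oscillators. -/
def hop (x y : Λ) : Space Λ →L[ℂ] Space Λ :=
  LinearMap.mkContinuous
    { toFun := fun ψ => ⟨fun p => if p.1 = x then ψ (y, p.2) else 0, memℓp_hop x y ψ⟩
      map_add' := fun f g => lp.ext (funext fun p => by
        simp only [lp.coeFn_add, Pi.add_apply]
        split_ifs <;> simp)
      map_smul' := fun a f => lp.ext (funext fun p => by
        simp only [lp.coeFn_smul, Pi.smul_apply, RingHom.id_apply]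
        split_ifs <;> simp) } 1 (fun ψ => by
    have hinj : Function.Injective fun n : Config Λ => ((x, n) : State Λ) :=
      Prod.mk_right_injective x
    have hinj' : Function.Injective fun n : Config Λ => ((y, n) : State Λ) :=
      Prod.mk_right_injective y
    rw [one_mul]
    refine lp.norm_le_of_tsum_le (by simp) (norm_nonneg _) ?_
    rw [lp.norm_rpow_eq_tsum (by simp)]
    have hs : Function.support (fun p : State Λ =>
        ‖(if p.1 = x then ψ (y, p.2) else 0 : ℂ)‖ ^ (2 : ℝ≥0∞).toReal) ⊆
        Set.range fun n : Config Λ => ((x, n) : State Λ) := by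
      rintro ⟨z, n⟩ hp
      by_cases hz : z = x
      · exact ⟨n, by rw [hz]⟩
      · simp [hz] at hp
    have h1 := hinj.tsum_eq hs
    simp only [if_true] at h1
    refine h1.symm.le.trans ?_
    exact tsum_comp_le_tsum_of_inj ((lp.memℓp ψ).summable (by simp))
      (fun p => by positivity) hinj')

theorem hop_apply (x y : Λ) (ψ : Space Λ) (p : State Λ) :
    hop x y ψ p = if p.1 = x then ψ (y, p.2) else 0 := rfl

theorem norm_hop_le (x y : Λ) (ψ : Space Λ) : ‖hop x y ψ‖ ≤ ‖ψ‖ := by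
  have := (hop x y).le_of_opNorm_le (LinearMap.mkContinuous_norm_le _ zero_le_one _) ψ
  simpa using this

theorem hasSum_inner_hop (x y : Λ) (ψ φ : Space Λ) :
    HasSum (fun n : Config Λ => (starRingEnd ℂ) (ψ (x, n)) * φ (y, n)) (inner ℂ ψ (hop x y φ)) := by
  have hinj : Function.Injective fun n : Config Λ => ((x, n) : State Λ) :=
    Prod.mk_right_injective x
  have h := hasSum_inner ψ (hop x y φ)
  rw [← hinj.hasSum_iff] at h
  · simpa [Function.comp_def, hop_apply] using h
  · rintro ⟨z, n⟩ hp
    have : z ≠ x := fun h => hp ⟨n, by rw [h]⟩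
    simp [hop_apply, this]

theorem inner_hop_left (x y : Λ) (ψ φ : Space Λ) :
    inner ℂ (hop x y ψ) φ = inner ℂ ψ (hop y x φ) := by
  rw [← inner_conj_symm]
  have h := Complex.hasSum_conj'.2 (hasSum_inner_hop x y φ ψ)
  refine h.unique ?_
  have h2 := hasSum_inner_hop y x ψ φ
  simpa [mul_comm] using h2

theorem isSymmetric_hop (x : Λ) : (hop x x).IsSymmetric := fun ψ φ => inner_hop_left x x ψ φ

theorem hop_hop (x : Λ) (ψ : Space Λ) : hop x x (hop x x ψ) = hop x x ψ := by
  refine lp.ext (funext fun p => ?_)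
  by_cases h : p.1 = x <;> simp [hop_apply, h]

theorem hop_displacedKet_self (β : ℂ) (x : Λ) (m : Config Λ) :
    hop x x (displacedKet β x m) = displacedKet β x m := by
  refine lp.ext (funext fun p => ?_)
  rw [hop_apply, coe_displacedKet]
  by_cases h : p.1 = x
  · rw [if_pos h, ← h]
  · rw [if_neg h]
    by_contra h0
    exact h (displacedKetFun_ne_zero (Ne.symm h0)).1

theorem hop_displacedKet_of_ne (β : ℂ) {x y : Λ} (z : Λ) (h : y ≠ x) (m : Config Λ) :
    hop z y (displacedKet β x m) = 0 := by
  refine lp.ext (funext fun p => ?_)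
  rw [hop_apply, coe_displacedKet]
  have h0 : displacedKetFun β x m (y, p.2) = 0 := by
    by_contra h0; exact h (displacedKetFun_ne_zero h0).1
  rw [h0, ite_self]; rfl

/-- The Laplacian as a bounded operator. -/
def laplacianOp (Λ : Finset (Fin D → ℤ)) : Space Λ →L[ℂ] Space Λ :=
  ∑ x : Λ, ∑ y : Λ, if Adjacent x.1 y.1 then hop x x - hop x y else 0

/-- The sum of the hopping term and the potential. -/
def particleOp (γ : ℝ) (v : Λ → ℝ) : Space Λ →L[ℂ] Space Λ :=
  (γ : ℂ) • laplacianOp Λ + ∑ x : Λ, (v x : ℂ) • hop x x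

theorem coe_laplacianOp (ψ : Space Λ) : ⇑(laplacianOp Λ ψ) = laplacian ⇑ψ := by
  funext p
  have h1 : laplacianOp Λ ψ p = ∑ x : Λ, ∑ y : Λ, if Adjacent x.1 y.1 then
      ((if p.1 = x then ψ (x, p.2) else 0) - if p.1 = x then ψ (y, p.2) else 0) else 0 := by
    simp only [laplacianOp, sum_apply, lp.coeFn_sum, Finset.sum_apply]
    refine Finset.sum_congr rfl fun x _ => Finset.sum_congr rfl fun y _ => ?_
    by_cases h : Adjacent x.1 y.1
    · simp [h, hop_apply]
    · simp [h]
  rw [h1, Finset.sum_eq_single p.1]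
  · simp [laplacian]
  · intro x _ hx
    simp [hx.symm]
  · simp

theorem coe_particleOp (γ : ℝ) (v : Λ → ℝ) (ψ : Space Λ) :
    ⇑(particleOp γ v ψ) = (γ : ℂ) • laplacian ⇑ψ + potential v ⇑ψ := by
  funext p
  simp only [particleOp, add_apply, smul_apply, sum_apply, lp.coeFn_add, lp.coeFn_smul,
    lp.coeFn_sum, Pi.add_apply, Finset.sum_apply, Pi.smul_apply, coe_laplacianOp, hop_apply,
    smul_eq_mul]
  congr 1
  rw [Finset.sum_eq_single p.1]
  · simp [potential]
  · intro x _ hx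
    simp [hx.symm]
  · simp

theorem Adjacent.symm {x y : Fin D → ℤ} (h : Adjacent x y) : Adjacent y x := by
  unfold Adjacent at *
  rw [← h]
  exact Finset.sum_congr rfl fun i _ => abs_sub_comm _ _

theorem isSymmetric_particleOp (γ : ℝ) (v : Λ → ℝ) : (particleOp γ v).IsSymmetric := by
  intro ψ φ
  have hlap : inner ℂ (laplacianOp Λ ψ) φ = inner ℂ ψ (laplacianOp Λ φ) := by
    have hterm : ∀ x y : Λ, inner ℂ ((if Adjacent x.1 y.1 then hop x x - hop x y else 0 :
        Space Λ →L[ℂ] Space Λ) ψ) φ = (if Adjacent x.1 y.1 then inner ℂ ψ (hop x x φ) else 0) -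
          if Adjacent y.1 x.1 then inner ℂ ψ (hop y x φ) else 0 := by
      intro x y
      by_cases h : Adjacent x.1 y.1
      · rw [if_pos h, if_pos h, if_pos h.symm, sub_apply, inner_sub_left, inner_hop_left,
          inner_hop_left]
      · rw [if_neg h, if_neg h, if_neg fun h' => h h'.symm]; simp
    have hterm' : ∀ x y : Λ, inner ℂ ψ ((if Adjacent x.1 y.1 then hop x x - hop x y else 0 :
        Space Λ →L[ℂ] Space Λ) φ) = (if Adjacent x.1 y.1 then inner ℂ ψ (hop x x φ) else 0) -
          if Adjacent x.1 y.1 then inner ℂ ψ (hop x y φ) else 0 := by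
      intro x y
      split_ifs
      · rw [sub_apply, inner_sub_right]
      · simp
    simp only [laplacianOp, sum_apply, sum_inner, inner_sum, hterm, hterm',
      Finset.sum_sub_distrib]
    congr 1
    exact Finset.sum_comm
  simp only [ContinuousLinearMap.coe_coe, particleOp, add_apply, smul_apply, sum_apply,
    inner_add_left, inner_add_right, inner_smul_left, inner_smul_right, sum_inner, inner_sum,
    Complex.conj_ofReal, inner_hop_left, hlap]

theorem continuous_particleOp (γ : ℝ) : Continuous (particleOp (Λ := Λ) γ) := by
  unfold particleOp; fun_prop

theorem particleOp_update (γ : ℝ) (v : Λ → ℝ) (x : Λ) (t : ℝ) :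
    particleOp γ (Function.update v x t) =
      particleOp γ (Function.update v x 0) + (t : ℂ) • hop x x := by
  have h : ∀ s : ℝ, ∑ u : Λ, (Function.update v x s u : ℂ) • hop u u =
      (∑ u ∈ Finset.univ.erase x, (v u : ℂ) • hop u u) + (s : ℂ) • hop x x := by
    intro s
    rw [← Finset.sum_erase_add _ _ (Finset.mem_univ x), Function.update_self]
    congr 1
    refine Finset.sum_congr rfl fun u hu => ?_
    rw [Function.update_of_ne (Finset.ne_of_mem_erase hu)]
  simp only [particleOp, h]
  simp [add_assoc]

/-- A site has at most `2 D` neighbours. -/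
theorem card_adjacent_le (y : Λ) :
    (Finset.univ.filter fun x : Λ => Adjacent x.1 y.1).card ≤ 2 * D := by
  classical
  set f : Fin D × Bool → Fin D → ℤ := fun q =>
    y.1 + Pi.single q.1 (if q.2 then 1 else -1) with hf
  have hsub : (Finset.univ.filter fun x : Λ => Adjacent x.1 y.1).map
      (Function.Embedding.subtype _) ⊆ Finset.univ.image f := by
    intro z hz
    obtain ⟨x, hx, rfl⟩ := Finset.mem_map.1 hz
    have hadj : ∑ i, |x.1 i - y.1 i| = 1 := (Finset.mem_filter.1 hx).2
    obtain ⟨i, hi⟩ : ∃ i, |x.1 i - y.1 i| ≠ 0 := by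
      by_contra! hcon
      simp [hcon] at hadj
    have hrest : ∑ j ∈ Finset.univ.erase i, |x.1 j - y.1 j| + |x.1 i - y.1 i| = 1 := by
      rw [Finset.sum_erase_add _ _ (Finset.mem_univ i), hadj]
    have hnn : 0 ≤ ∑ j ∈ Finset.univ.erase i, |x.1 j - y.1 j| :=
      Finset.sum_nonneg fun _ _ => abs_nonneg _
    have hpos : 0 < |x.1 i - y.1 i| := lt_of_le_of_ne (abs_nonneg _) hi.symm
    have hi1 : |x.1 i - y.1 i| = 1 := by omega
    have h0 : ∑ j ∈ Finset.univ.erase i, |x.1 j - y.1 j| = 0 := by omega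
    have h0' := (Finset.sum_eq_zero_iff_of_nonneg fun _ _ => abs_nonneg _).1 h0
    have hj : ∀ j, j ≠ i → x.1 j = y.1 j := fun j hj => by
      have := h0' j (Finset.mem_erase.2 ⟨hj, Finset.mem_univ _⟩)
      rw [abs_eq_zero] at this; omega
    refine Finset.mem_image.2 ⟨(i, decide (x.1 i - y.1 i = 1)), Finset.mem_univ _, ?_⟩
    funext j
    by_cases hji : j = i
    · subst hji
      rcases (abs_eq zero_le_one).1 hi1 with h | h
      · simp [hf, h]; omega
      · simp [hf, h]; omega
    · simp [hf, hji, hj j hji]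
  calc (Finset.univ.filter fun x : Λ => Adjacent x.1 y.1).card
      = ((Finset.univ.filter fun x : Λ => Adjacent x.1 y.1).map
          (Function.Embedding.subtype _)).card := (Finset.card_map _).symm
    _ ≤ (Finset.univ.image f).card := Finset.card_le_card hsub
    _ ≤ (Finset.univ : Finset (Fin D × Bool)).card := Finset.card_image_le
    _ = 2 * D := by simp [mul_comm]

theorem norm_particleOp_displacedKet_le {γ : ℝ} (hγ : 0 ≤ γ) {V : ℝ} {v : Λ → ℝ} (β : ℂ) (y : Λ)
    (hv : v y ∈ Set.Icc 0 V) (m : Config Λ) :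
    ‖particleOp γ v (displacedKet β y m)‖ ≤ 4 * D * γ + V := by
  set q := displacedKet β y m with hq
  have hq1 : ‖q‖ = 1 := norm_displacedKet β y m
  set N := Finset.univ.filter fun x : Λ => Adjacent x.1 y.1 with hN
  have hlap : laplacianOp Λ q = ∑ x ∈ N, (q - hop x y q) := by
    have h1 : ∀ x z : Λ, (if Adjacent x.1 z.1 then hop x x - hop x z else 0 :
        Space Λ →L[ℂ] Space Λ) q = (if x = y then (if Adjacent z.1 y.1 then q else 0) else 0) -
          (if z = y then (if Adjacent x.1 y.1 then hop x y q else 0) else 0) := by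
      intro x z
      have hx : hop x x q = if x = y then q else 0 := by
        split_ifs with h
        · subst h; exact hop_displacedKet_self β x m
        · exact hop_displacedKet_of_ne β x h m
      have hz : hop x z q = if z = y then hop x y q else 0 := by
        split_ifs with h
        · rw [h]
        · exact hop_displacedKet_of_ne β x h m
      by_cases hadj : Adjacent x.1 z.1
      · rw [if_pos hadj, sub_apply, hx, hz]
        congr 1
        · by_cases h : x = y
          · subst h; simp [hadj.symm]
          · simp [h]
        · by_cases h : z = y
          · subst h; simp [hadj]
          · simp [h]
      · rw [if_neg hadj]
        have e1 : (if x = y then (if Adjacent z.1 y.1 then q else 0) else 0) = 0 := by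
          by_cases h : x = y
          · have hna : ¬ Adjacent z.1 y.1 := fun h' => hadj (by rw [h]; exact h'.symm)
            simp [hna]
          · simp [h]
        have e2 : (if z = y then (if Adjacent x.1 y.1 then hop x y q else 0) else 0) = 0 := by
          by_cases h : z = y
          · subst h; simp [hadj]
          · simp [h]
        rw [e1, e2]; simp
    simp only [laplacianOp, sum_apply, h1, Finset.sum_sub_distrib]
    congr 1
    · rw [Finset.sum_comm]
      simp only [Finset.sum_ite_eq', Finset.mem_univ, if_true, hN, Finset.sum_filter]
    · simp only [Finset.sum_ite_eq', Finset.mem_univ, if_true, hN, Finset.sum_filter]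
  have hlapn : ‖laplacianOp Λ q‖ ≤ 4 * D := by
    rw [hlap]
    calc ‖∑ x ∈ N, (q - hop x y q)‖ ≤ ∑ x ∈ N, (2 : ℝ) := by
          refine norm_sum_le_of_le _ fun x _ => (norm_sub_le _ _).trans ?_
          have := norm_hop_le x y q
          linarith
      _ = N.card * 2 := by simp
      _ ≤ (2 * D : ℕ) * 2 := by
          gcongr
          exact card_adjacent_le y
      _ = 4 * D := by push_cast; ring
  have hpot : ∑ x : Λ, (v x : ℂ) • hop x x q = (v y : ℂ) • q := by
    rw [Finset.sum_eq_single y]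
    · rw [hop_displacedKet_self]
    · intro x _ hx
      rw [hop_displacedKet_of_ne β x hx m, smul_zero]
    · simp
  have hsplit : particleOp γ v q = (γ : ℂ) • laplacianOp Λ q + (v y : ℂ) • q := by
    rw [← hpot]
    simp only [particleOp, add_apply, smul_apply, sum_apply]
  rw [hsplit]
  refine (norm_add_le _ _).trans ?_
  rw [norm_smul, norm_smul, Complex.norm_real, Complex.norm_real, Real.norm_eq_abs,
    Real.norm_eq_abs, abs_of_nonneg hγ, abs_of_nonneg hv.1, hq1, mul_one]
  have := mul_le_mul_of_nonneg_left hlapn hγ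
  linarith [hv.2]

end Holstein

namespace Holstein

open CompactResolvent

variable {D : ℕ} {Λ : Finset (Fin D → ℤ)}

/-! ### The Hamiltonian as a bounded perturbation of a diagonal operator -/

theorem hamiltonianExpr_apply (γ ω : ℝ) (α : ℂ) (v : Λ → ℝ) (ψ : State Λ → ℂ) (p : State Λ) :
    hamiltonianExpr γ ω α v ψ p = hamiltonianExpr 0 ω α 0 ψ p +
      ((γ : ℂ) • laplacian ψ + potential v ψ) p := by
  simp only [hamiltonianExpr, LinearMap.add_apply, LinearMap.sub_apply, LinearMap.smul_apply,
    Pi.add_apply, Pi.sub_apply, Pi.smul_apply, smul_eq_mul]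
  simp [potential]
  ring

theorem freeExpr_apply (ω : ℝ) (α : ℂ) (ψ : State Λ → ℂ) (p : State Λ) :
    hamiltonianExpr 0 ω α 0 ψ p =
      -(α * create p.1 ψ p + (starRingEnd ℂ) α * annihilate p.1 ψ p) +
        ω * ((excitation p.2 : ℂ) * ψ p) + ((‖α‖ ^ 2 / ω : ℝ) : ℂ) * ψ p := by
  have h : (∑ u : Λ, create u ∘ₗ annihilate u) ψ p = (excitation p.2 : ℂ) * ψ p := by
    rw [LinearMap.sum_apply, Finset.sum_apply, excitation, Nat.cast_sum, Finset.sum_mul]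
    exact Finset.sum_congr rfl fun u _ => create_annihilate_apply u ψ p
  simp only [hamiltonianExpr, LinearMap.add_apply, LinearMap.sub_apply, LinearMap.smul_apply,
    Pi.add_apply, Pi.sub_apply, Pi.smul_apply, smul_eq_mul, h]
  simp [potential, createAtParticle, annihilateAtParticle]

theorem annihilate_displacedKetFun_apply (β : ℂ) (x : Λ) (m : Config Λ) (p : State Λ) :
    annihilate p.1 (displacedKetFun β x m) p = β * displacedKetFun β x m p +
      (Real.sqrt (m x) : ℂ) * displacedKetFun β x (m - Pi.single x 1) p := by
  by_cases h : p.1 = x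
  · rw [h, annihilate_displacedKetFun]; rfl
  · have h0 : ∀ m' n, displacedKetFun β x m' (p.1, n) = 0 := fun m' n => by
      by_contra h0; exact h (displacedKetFun_ne_zero h0).1
    have h1 : ∀ m', displacedKetFun β x m' p = 0 := fun m' => h0 m' p.2
    rw [annihilate_apply, h0, h1, h1]; simp

theorem create_displacedKetFun_apply (β : ℂ) (x : Λ) (m : Config Λ) (p : State Λ) :
    create p.1 (displacedKetFun β x m) p = (starRingEnd ℂ) β * displacedKetFun β x m p +
      (Real.sqrt ((m x : ℝ) + 1) : ℂ) * displacedKetFun β x (m + Pi.single x 1) p := by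
  by_cases h : p.1 = x
  · rw [h, create_displacedKetFun]; rfl
  · have h0 : ∀ m' n, displacedKetFun β x m' (p.1, n) = 0 := fun m' n => by
      by_contra h0; exact h (displacedKetFun_ne_zero h0).1
    have h1 : ∀ m', displacedKetFun β x m' p = 0 := fun m' => h0 m' p.2
    rw [create_apply, h0, h1, h1]; simp

/-- The oscillators away from `x` retain their occupation numbers `m`. -/
theorem excitation_mul_displacedKetFun (β : ℂ) (x : Λ) (m : Config Λ) (p : State Λ) :
    (excitation p.2 : ℂ) * displacedKetFun β x m p =
      create p.1 (annihilate p.1 (displacedKetFun β x m)) p +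
        ((excitation m : ℂ) - m x) * displacedKetFun β x m p := by
  rw [create_annihilate_apply]
  by_cases h : displacedKetFun β x m p = 0
  · simp [h]
  · obtain ⟨h1, h2⟩ := displacedKetFun_ne_zero h
    have h3 : (excitation p.2 : ℂ) = p.2 x + ((excitation m : ℂ) - m x) := by
      simp only [excitation, Nat.cast_sum]
      rw [← Finset.sum_erase_add _ _ (Finset.mem_univ x),
        ← Finset.sum_erase_add Finset.univ (fun u => (m u : ℂ)) (Finset.mem_univ x),
        Finset.sum_congr rfl fun u hu => by rw [h2 u (Finset.ne_of_mem_erase hu)]]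
      ring
    rw [h3, h1]
    ring

/-- Completing the square: the displaced number states diagonalize the free Hamiltonian. -/
theorem freeExpr_displacedKetFun {ω : ℝ} (hω : 0 < ω) (α : ℂ) (x : Λ) (m : Config Λ) :
    hamiltonianExpr 0 ω α 0 (displacedKetFun (α / ω) x m) =
      ((ω * excitation m : ℝ) : ℂ) • displacedKetFun (α / ω) x m := by
  have hω' : (ω : ℂ) ≠ 0 := by exact_mod_cast hω.ne'
  set β : ℂ := α / ω with hβ
  have hα : α = β * ω := by rw [hβ, div_mul_cancel₀ _ hω']
  funext p
  rw [freeExpr_apply, excitation_mul_displacedKetFun, create_displacedKetFun_apply,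
    annihilate_displacedKetFun_apply, Pi.smul_apply, smul_eq_mul]
  have hnorm : ((‖α‖ ^ 2 / ω : ℝ) : ℂ) = ω * (β * (starRingEnd ℂ) β) := by
    rw [Complex.mul_conj', hα]
    simp only [norm_mul, Complex.norm_real, Real.norm_eq_abs, mul_pow, sq_abs]
    push_cast
    field_simp
  have hcre : create p.1 (annihilate p.1 (displacedKetFun β x m)) p =
      β * create p.1 (displacedKetFun β x m) p +
        (Real.sqrt (m x) : ℂ) * create p.1 (displacedKetFun β x (m - Pi.single x 1)) p := by
    by_cases h : p.1 = x
    · rw [h, annihilate_displacedKetFun, map_add, map_smul, map_smul]; rfl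
    · have h0 : ∀ m' n, displacedKetFun β x m' (p.1, n) = 0 := fun m' n => by
        by_contra h0; exact h (displacedKetFun_ne_zero h0).1
      have h1 : ∀ m', displacedKetFun β x m' p = 0 := fun m' => h0 m' p.2
      rw [create_annihilate_apply, create_apply, create_apply, h1, h0, h0]; simp
  have hlast : (Real.sqrt (m x) : ℂ) *
      (Real.sqrt (((m - Pi.single x 1 : Config Λ) x : ℝ) + 1) : ℂ) *
        displacedKetFun β x (m - Pi.single x 1 + Pi.single x 1) p =
      (m x : ℂ) * displacedKetFun β x m p := by
    by_cases hm : m x = 0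
    · simp [hm]
    · have h1 : (((m - Pi.single x 1 : Config Λ) x : ℕ) : ℝ) + 1 = (m x : ℝ) := by
        simp only [Pi.sub_apply, Pi.single_eq_same]
        rw [Nat.cast_sub (by omega)]; simp
      rw [sub_single_add_single x hm, h1, ofReal_sqrt_mul_self (by positivity)]
      simp
  rw [hcre, create_displacedKetFun_apply, create_displacedKetFun_apply, hnorm]
  rw [hα, map_mul, Complex.conj_ofReal]
  push_cast
  linear_combination (ω : ℂ) * hlast

/-- Summation by parts: the free Hamiltonian on its maximal domain is symmetric against displaced
number states. -/
theorem hasSum_conj_displacedKetFun_mul_freeExpr {ω : ℝ} (hω : 0 < ω) (α : ℂ) (x : Λ)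
    (m : Config Λ) (ψ : Space Λ) :
    HasSum (fun p => (starRingEnd ℂ) (displacedKetFun (α / ω) x m p) *
        hamiltonianExpr 0 ω α 0 ⇑ψ p)
      (((ω * excitation m : ℝ) : ℂ) * inner ℂ (displacedKet (α / ω) x m) ψ) := by
  set β : ℂ := α / ω with hβ
  set q := displacedKet β x m with hq
  set A : Space Λ := β • q + (Real.sqrt (m x) : ℂ) • displacedKet β x (m - Pi.single x 1) with hA
  set B : Space Λ := (starRingEnd ℂ) β • q +
    (Real.sqrt ((m x : ℝ) + 1) : ℂ) • displacedKet β x (m + Pi.single x 1) with hB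
  have hAp : ∀ p, annihilate p.1 (displacedKetFun β x m) p = A p := fun p =>
    annihilate_displacedKetFun_apply β x m p
  have hBp : ∀ p, create p.1 (displacedKetFun β x m) p = B p := fun p =>
    create_displacedKetFun_apply β x m p
  set N : Space Λ := ((ω * excitation m : ℝ) : ℂ) • q + (α • B + (starRingEnd ℂ) α • A) -
    ((‖α‖ ^ 2 / ω : ℝ) : ℂ) • q with hN
  have hNp : ∀ p, (ω : ℂ) * ((excitation p.2 : ℂ) * displacedKetFun β x m p) = N p := by
    intro p
    have h := congrFun (freeExpr_displacedKetFun hω α x m) p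
    rw [freeExpr_apply, ← hβ, hAp, hBp, Pi.smul_apply, smul_eq_mul] at h
    simp only [hN, lp.coeFn_sub, lp.coeFn_add, lp.coeFn_smul, Pi.sub_apply, Pi.add_apply,
      Pi.smul_apply, smul_eq_mul, hq, coe_displacedKet]
    linear_combination h
  have h1 : HasSum (fun p => (starRingEnd ℂ) (displacedKetFun β x m p) * create p.1 ⇑ψ p)
      (inner ℂ A ψ) := by
    refine (hasSum_conj_mul_create_iff id _ _ _).2 ?_
    simp only [id, hAp]
    exact hasSum_inner A ψ
  have h2 : HasSum (fun p => (starRingEnd ℂ) (displacedKetFun β x m p) * annihilate p.1 ⇑ψ p)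
      (inner ℂ B ψ) := by
    refine (hasSum_conj_mul_annihilate_iff id _ _ _).2 ?_
    simp only [id, hBp]
    exact hasSum_inner B ψ
  have h3 := hasSum_inner N ψ
  have h4 := hasSum_inner q ψ
  have h := (((h1.mul_left α).add (h2.mul_left ((starRingEnd ℂ) α))).neg.add h3).add
    (h4.mul_left ((‖α‖ ^ 2 / ω : ℝ) : ℂ))
  have hval : ((ω * excitation m : ℝ) : ℂ) * inner ℂ q ψ =
      -(α * inner ℂ A ψ + (starRingEnd ℂ) α * inner ℂ B ψ) + inner ℂ N ψ +
        ((‖α‖ ^ 2 / ω : ℝ) : ℂ) * inner ℂ q ψ := by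
    simp only [N, inner_sub_left, inner_add_left, inner_smul_left, Complex.conj_ofReal,
      Complex.conj_conj]
    ring
  rw [hval]
  refine h.congr_fun fun p => ?_
  rw [freeExpr_apply, ← hNp p, map_mul, map_mul, Complex.conj_ofReal, Complex.conj_natCast,
    hq, coe_displacedKet]
  ring

/-- The eigenvalues of `(H₀ + 1)⁻¹`. -/
def freeInverseEigenvalue (ω : ℝ) (q : State Λ) : ℝ := (ω * excitation q.2 + 1)⁻¹

theorem abs_freeInverseEigenvalue_le {ω : ℝ} (hω : 0 < ω) (q : State Λ) :
    |freeInverseEigenvalue ω q| ≤ 1 := by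
  have : 0 ≤ ω * excitation q.2 := by positivity
  rw [freeInverseEigenvalue, abs_of_nonneg (by positivity)]
  exact inv_le_one_of_one_le₀ (by linarith)

theorem finite_excitation_le (Λ : Finset (Fin D → ℤ)) (K : ℕ) :
    {q : State Λ | excitation q.2 ≤ K}.Finite := by
  have h : {m : Config Λ | excitation m ≤ K}.Finite := by
    refine (Set.Finite.pi' (t := fun _ : Λ => Set.Iic K) fun _ => Set.finite_Iic K).subset ?_
    intro m hm u
    exact (Finset.single_le_sum (f := fun u => m u) (fun _ _ => Nat.zero_le _)
      (Finset.mem_univ u)).trans hm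
  refine (Set.finite_univ.prod h).subset fun q hq => ⟨Set.mem_univ _, hq⟩

theorem tendsto_freeInverseEigenvalue {ω : ℝ} (hω : 0 < ω) :
    Filter.Tendsto (freeInverseEigenvalue (Λ := Λ) ω) Filter.cofinite (nhds 0) := by
  have h1 : Filter.Tendsto (fun q : State Λ => excitation q.2) Filter.cofinite Filter.atTop := by
    refine Filter.tendsto_atTop.2 fun K => ?_
    rw [Filter.eventually_cofinite]
    exact (finite_excitation_le Λ K).subset fun q hq => (not_le.1 hq).le
  have h2 : Filter.Tendsto (fun k : ℕ => (ω * k + 1)⁻¹) Filter.atTop (nhds 0) :=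
    tendsto_inv_atTop_zero.comp (Filter.tendsto_atTop_add_const_right _ _
      (tendsto_natCast_atTop_atTop.const_mul_atTop hω))
  exact h2.comp h1

/-- The operator `(H₀ + 1)⁻¹` for the free Hamiltonian `H₀`. -/
def freeInverse (Λ : Finset (Fin D → ℤ)) {ω : ℝ} (hω : 0 < ω) (α : ℂ) :
    Space Λ →L[ℂ] Space Λ :=
  diagonalIn (displacedBasis Λ (α / ω)) (freeInverseEigenvalue ω) 1
    (abs_freeInverseEigenvalue_le hω)

theorem freeInverse_displacedKet {ω : ℝ} (hω : 0 < ω) (α : ℂ) (x : Λ) (m : Config Λ) :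
    freeInverse Λ hω α (displacedKet (α / ω) x m) =
      ((ω * excitation m : ℝ) + 1 : ℂ)⁻¹ • displacedKet (α / ω) x m := by
  have := diagonalIn_basis (displacedBasis Λ (α / ω)) (freeInverseEigenvalue ω) 1
    (abs_freeInverseEigenvalue_le hω) (x, m)
  rw [displacedBasis_apply] at this
  rw [freeInverse, this, freeInverseEigenvalue]
  push_cast
  rfl

theorem isCompactOperator_freeInverse {ω : ℝ} (hω : 0 < ω) (α : ℂ) :
    IsCompactOperator (freeInverse Λ hω α) :=
  isCompactOperator_diagonalIn _ _ _ _ (tendsto_freeInverseEigenvalue hω)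

theorem isSymmetric_freeInverse {ω : ℝ} (hω : 0 < ω) (α : ℂ) :
    (freeInverse Λ hω α).IsSymmetric := isSymmetric_diagonalIn _ _ _ _

theorem ofReal_add_one_ne_zero {ω : ℝ} (hω : 0 < ω) (m : Config Λ) :
    ((ω * excitation m : ℝ) + 1 : ℂ) ≠ 0 := by
  have h : (0 : ℝ) < ω * excitation m + 1 := by positivity
  exact_mod_cast h.ne'

theorem freeExpr_freeInverse {ω : ℝ} (hω : 0 < ω) (α : ℂ) (χ : Space Λ) :
    hamiltonianExpr 0 ω α 0 ⇑(freeInverse Λ hω α χ) = ⇑(χ - freeInverse Λ hω α χ) := by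
  funext p
  set R := freeInverse Λ hω α with hR
  -- Both sides are continuous in `χ`, so that it suffices to compare them on the eigenbasis.
  set L : Space Λ →L[ℂ] ℂ :=
    -(α • (Real.sqrt (p.2 p.1) : ℂ) • lp.evalCLM ℂ (fun _ : State Λ => ℂ) 2
          (p.1, p.2 - Pi.single p.1 1) +
        (starRingEnd ℂ) α • (Real.sqrt ((p.2 p.1 : ℝ) + 1) : ℂ) •
          lp.evalCLM ℂ (fun _ : State Λ => ℂ) 2 (p.1, p.2 + Pi.single p.1 1)) +
      (ω : ℂ) • (excitation p.2 : ℂ) • lp.evalCLM ℂ (fun _ : State Λ => ℂ) 2 p +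
      ((‖α‖ ^ 2 / ω : ℝ) : ℂ) • lp.evalCLM ℂ (fun _ : State Λ => ℂ) 2 p with hL
  have hLp : ∀ ψ : Space Λ, L ψ = hamiltonianExpr 0 ω α 0 ⇑ψ p := fun ψ =>
    (freeExpr_apply ω α ⇑ψ p).symm
  set E : Space Λ →L[ℂ] ℂ := lp.evalCLM ℂ (fun _ : State Λ => ℂ) 2 p with hE
  have hcomp : L ∘L R = E ∘L (1 - R) := by
    refine ContinuousLinearMap.ext_on (s := Set.range (displacedBasis Λ (α / ω))) ?_ ?_
    · rw [dense_iff_closure_eq, ← Submodule.topologicalClosure_coe,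
        (displacedBasis Λ (α / ω)).dense_span, Submodule.top_coe]
    · rintro _ ⟨⟨x, m⟩, rfl⟩
      rw [displacedBasis_apply]
      have hne := ofReal_add_one_ne_zero hω m
      have hEp : ∀ ψ : Space Λ, E ψ = ψ p := fun ψ => rfl
      rw [ContinuousLinearMap.comp_apply, ContinuousLinearMap.comp_apply, sub_apply,
        one_apply_eq_self, hR, freeInverse_displacedKet, map_smul, hLp, coe_displacedKet,
        freeExpr_displacedKetFun hω, map_sub, map_smul, hEp, coe_displacedKet, Pi.smul_apply]
      simp only [smul_eq_mul]
      field_simp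
      ring
  have h := congrArg (fun F : Space Λ →L[ℂ] ℂ => F χ) hcomp
  simp only [ContinuousLinearMap.comp_apply, hLp] at h
  exact h

theorem isPerturbation_hamiltonian (γ : ℝ) {ω : ℝ} (hω : 0 < ω) (α : ℂ) (v : Λ → ℝ) :
    IsPerturbation (hamiltonian γ ω α v) (freeInverse Λ hω α) (particleOp γ v) := by
  set R := freeInverse Λ hω α with hR
  have hexpr : ∀ ψ : Space Λ, hamiltonianExpr γ ω α v ⇑ψ =
      hamiltonianExpr 0 ω α 0 ⇑ψ + ⇑(particleOp γ v ψ) := by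
    intro ψ; funext p
    rw [hamiltonianExpr_apply, coe_particleOp]; rfl
  have hexprR : ∀ χ, hamiltonianExpr γ ω α v ⇑(R χ) = ⇑(χ - R χ + particleOp γ v (R χ)) := by
    intro χ
    rw [hexpr, freeExpr_freeInverse hω, lp.coeFn_add]
  refine ⟨fun ψ => ⟨fun h => ?_, ?_⟩, fun χ h => ?_⟩
  · set η : Space Λ := hamiltonian γ ω α v ⟨ψ, h⟩ - particleOp γ v ψ with hη
    have hηp : ∀ p, η p = hamiltonianExpr 0 ω α 0 ⇑ψ p := by
      intro p
      have h1 : hamiltonian γ ω α v ⟨ψ, h⟩ p = hamiltonianExpr γ ω α v ⇑ψ p := rfl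
      rw [hη, lp.coeFn_sub, Pi.sub_apply, h1, hexpr, Pi.add_apply, add_sub_cancel_right]
    refine ⟨η + ψ, ?_⟩
    rw [← sub_eq_zero]
    refine displacedKet_complete (α / ω) _ fun q => ?_
    have h2 := hasSum_conj_displacedKetFun_mul_freeExpr hω α q.1 q.2 ψ
    simp only [← hηp] at h2
    have h3 := (hasSum_inner (displacedKet (α / ω) q.1 q.2) η).unique h2
    have h4 : inner ℂ (displacedKet (α / ω) q.1 q.2) (R (η + ψ)) =
        inner ℂ (R (displacedKet (α / ω) q.1 q.2)) (η + ψ) :=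
      (isSymmetric_freeInverse hω α _ _).symm
    have hne := ofReal_add_one_ne_zero hω q.2
    rw [inner_sub_right, h4, hR, freeInverse_displacedKet, inner_smul_left, inner_add_right, h3]
    have hconj : (starRingEnd ℂ) ((ω * excitation q.2 : ℝ) + 1 : ℂ)⁻¹ =
        ((ω * excitation q.2 : ℝ) + 1 : ℂ)⁻¹ := by
      simp
    rw [hconj]
    field_simp
    ring
  · rintro ⟨χ, rfl⟩
    change Memℓp (hamiltonianExpr γ ω α v ⇑(R χ)) 2
    rw [hexprR]
    exact lp.memℓp _
  · exact lp.ext (hexprR χ)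

end Holstein

/-! ### Averaging over one random variable -/

/-- A moment bound that is available after integrating out one of the independent variables `v x`
alone, and for any value of `v x` on its right-hand side, carries over to the expectation. No
measurability of `F` and `A` is needed. -/
theorem lintegral_pi_le_of_forall_update {ι : Type*} [Fintype ι] [DecidableEq ι] (ν : Measure ℝ)
    [IsProbabilityMeasure ν] {I : Set ℝ} (hI : MeasurableSet I) (hνI : ∀ᵐ t ∂ν, t ∈ I)
    {F A G : (ι → ℝ) → ℝ≥0∞} (hG : Measurable G) {p : ℝ} (hp : 1 ≤ p) (x : ι) (K : ℝ≥0∞)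
    (hFA : ∀ v, (∀ i, v i ∈ I) → F v ^ p ≤ A v)
    (hAG : ∀ v, ∀ t' ∈ I, ∫⁻ t in I, A (Function.update v x t) ∂ν ≤
      K * G (Function.update v x t')) :
    ∫⁻ v, F v ∂(Measure.pi fun _ => ν) ≤ (K * ∫⁻ v, G v ∂(Measure.pi fun _ => ν)) ^ (1 / p) := by
  have hp0 : 0 < p := by linarith
  have hνr : ν.restrict I = ν := Measure.restrict_eq_self_of_ae_mem hνI
  -- A measurable minorant `g` of `F` with the same integral, cut off to the set where all `v i ∈ I`.
  obtain ⟨g, hg, hgF, hgint⟩ := exists_measurable_le_lintegral_eq (Measure.pi fun _ : ι => ν) F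
  set Q : Set (ι → ℝ) := Set.univ.pi fun _ => I with hQ
  have hQm : MeasurableSet Q := MeasurableSet.univ_pi fun _ => hI
  have hQae : ∀ᵐ v ∂(Measure.pi fun _ : ι => ν), v ∈ Q := by
    have : ∀ i : ι, ∀ᵐ v ∂(Measure.pi fun _ : ι => ν), v i ∈ I := fun i =>
      (Measure.quasiMeasurePreserving_eval (fun _ : ι => ν) i).ae hνI
    filter_upwards [ae_all_iff.2 this] with v hv i _ using hv i
  set h : (ι → ℝ) → ℝ≥0∞ := Q.indicator fun v => g v ^ p with hh
  have hhm : Measurable h := (hg.pow_const p).indicator hQm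
  have hle : ∫⁻ v, h v ∂(Measure.pi fun _ => ν) ≤
      ∫⁻ v, K * G v ∂(Measure.pi fun _ => ν) := by
    refine lintegral_le_of_lmarginal_le {x} hhm (hG.const_mul K) ?_
    intro v
    rw [lmarginal_singleton, lmarginal_singleton]
    have h1 : ∀ t' ∈ I, ∫⁻ t, h (Function.update v x t) ∂ν ≤ K * G (Function.update v x t') := by
      intro t' ht'
      refine le_trans ?_ (hAG v t' ht')
      rw [hνr]
      refine lintegral_mono fun t => ?_
      by_cases hv : Function.update v x t ∈ Q
      · rw [hh, Set.indicator_of_mem hv]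
        exact (ENNReal.rpow_le_rpow (hgF _) hp0.le).trans (hFA _ fun i => hv i trivial)
      · rw [hh, Set.indicator_of_notMem hv]; exact zero_le
    calc ∫⁻ t, h (Function.update v x t) ∂ν
        = ∫⁻ _, (∫⁻ t, h (Function.update v x t) ∂ν) ∂ν := by simp
      _ ≤ ∫⁻ t', K * G (Function.update v x t') ∂ν := by
          refine lintegral_mono_ae ?_
          filter_upwards [hνI] with t' ht' using h1 t' ht'
  have hjensen : ∫⁻ v, g v ∂(Measure.pi fun _ => ν) ≤
      (∫⁻ v, g v ^ p ∂(Measure.pi fun _ => ν)) ^ (1 / p) := by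
    have hq : 0 ≤ 1 - 1 / p := by
      rw [sub_nonneg, div_le_one hp0]; exact hp
    have := ENNReal.lintegral_mul_norm_pow_le (μ := Measure.pi fun _ : ι => ν)
      (f := fun v => g v ^ p) (g := fun _ => 1) (hg.pow_const p).aemeasurable
      aemeasurable_const (p := 1 / p) (q := 1 - 1 / p) (by positivity) hq (by ring)
    simpa [← ENNReal.rpow_mul, mul_inv_cancel₀ hp0.ne'] using this
  have hgh : ∫⁻ v, g v ^ p ∂(Measure.pi fun _ => ν) = ∫⁻ v, h v ∂(Measure.pi fun _ => ν) := by
    refine lintegral_congr_ae ?_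
    filter_upwards [hQae] with v hv
    rw [hh, Set.indicator_of_mem hv]
  rw [hgint]
  refine hjensen.trans (ENNReal.rpow_le_rpow ?_ (by positivity))
  rw [hgh, ← lintegral_const_mul K hG]
  exact hle

namespace Holstein

open CompactResolvent

variable {D : ℕ} {Λ : Finset (Fin D → ℤ)}

/-! ### The eigenfunction correlator of the Holstein Hamiltonian -/

theorem greenFunction_eq (γ : ℝ) {ω : ℝ} (hω : 0 < ω) (α : ℂ) (v : Λ → ℝ) (x : Λ) (m : Config Λ)
    (y : Λ) (ξ : Config Λ) (z : ℂ) :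
    greenFunction γ ω α v x m y ξ z = inner ℂ (displacedKet (α / ω) x m)
      (invAdd (freeInverse Λ hω α) (particleOp γ v - (z + 1) • 1) (displacedKet (α / ω) y ξ)) := by
  rw [greenFunction, (isPerturbation_hamiltonian γ hω α v).resolvent_eq]

theorem measurable_greenFunction (γ : ℝ) {ω : ℝ} (hω : 0 < ω) (α : ℂ) (x : Λ) (m : Config Λ)
    (y : Λ) (ξ : Config Λ) :
    Measurable fun q : (Λ → ℝ) × ℝ => greenFunction γ ω α q.1 x m y ξ (q.2 : ℂ) := by
  simp only [greenFunction_eq γ hω]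
  refine measurable_inner_invAdd
    (S := fun q : (Λ → ℝ) × ℝ => particleOp γ q.1 - ((q.2 : ℂ) + 1) • 1) ?_ _ _
  have := (continuous_particleOp (Λ := Λ) γ).comp (continuous_fst (Y := ℝ))
  exact this.sub (by fun_prop)

/-- Restricting the sum to the spectrum is not needed, as the eigenprojections vanish elsewhere. -/
theorem correlator_le (γ : ℝ) {ω : ℝ} (hω : 0 < ω) (α : ℂ) (v : Λ → ℝ) (x : Λ) (m : Config Λ)
    (y : Λ) (ξ : Config Λ) (J : Set ℝ) :
    correlator γ ω α v x m y ξ J ≤ ∑' E : ℝ, J.indicator (fun E =>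
      ‖inner ℂ (displacedKet (α / ω) x m)
        (eigProj (freeInverse Λ hω α) (particleOp γ v) E (displacedKet (α / ω) y ξ))‖ₑ) E := by
  simp only [correlator, (isPerturbation_hamiltonian γ hω α v).eigenprojection_eq]
  rw [tsum_subtype _ fun E : ℝ => ‖inner ℂ (displacedKet (α / ω) x m)
        (eigProj (freeInverse Λ hω α) (particleOp γ v) E (displacedKet (α / ω) y ξ))‖ₑ]
  exact ENNReal.tsum_le_tsum fun E =>
    Set.indicator_le_indicator_of_subset Set.inter_subset_right (fun _ => zero_le) E

/-- The displaced number states at the site `x` are complete in the range of the projection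
`hop x x` onto the states with the particle at `x`. -/
theorem enorm_inner_hop_le (β : ℂ) (x : Λ) (ψ θ : Space Λ) :
    ‖inner ℂ (hop x x ψ) θ‖ₑ ≤
      ∑' l, ‖inner ℂ (displacedKet β x l) ψ‖ₑ * ‖inner ℂ (displacedKet β x l) θ‖ₑ := by
  have h := (displacedBasis Λ β).hasSum_inner_mul_inner (hop x x ψ) θ
  have hinj : Function.Injective fun n : Config Λ => ((x, n) : State Λ) :=
    Prod.mk_right_injective x
  rw [← hinj.hasSum_iff] at h
  · rw [← h.tsum_eq]
    refine enorm_tsum_le_tsum_enorm.trans (ENNReal.tsum_le_tsum fun l => ?_)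
    rw [Function.comp_apply, displacedBasis_apply, inner_hop_left, hop_displacedKet_self,
      enorm_mul, ← inner_conj_symm, RCLike.enorm_conj]
  · rintro ⟨z, n⟩ hz
    have hzx : x ≠ z := fun h => hz ⟨n, by rw [h]⟩
    rw [displacedBasis_apply, inner_hop_left, hop_displacedKet_of_ne β x hzx]
    simp

/-- Energies much below the free energy `ω N(ξ)` contribute little to the local density of states
at `|y, ξ⟩`. -/
theorem tsum_energyWindow_eigProj_sq_le {γ κ V ω : ℝ} (hγ : 0 ≤ γ) (hκ : 4 * D * γ ≤ κ)
    (hω : 0 < ω) (α : ℂ) {v : Λ → ℝ} (k : ℕ) (y : Λ) (hv : v y ∈ Set.Icc 0 V) (ξ : Config Λ) :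
    ∑' E : ℝ, (energyWindow D γ ω V k).indicator (fun E =>
        ‖eigProj (freeInverse Λ hω α) (particleOp γ v) E (displacedKet (α / ω) y ξ)‖ₑ ^ 2) E ≤
      ENNReal.ofReal (max 2 (4 * (κ + V) / ω) *
        (((max k 1 : ℕ) : ℝ) / ((max (excitation ξ) 1 : ℕ) : ℝ))) ^ 2 := by
  set W := particleOp γ v
  set R := freeInverse Λ hω α
  set q := displacedKet (α / ω) y ξ
  set N := excitation ξ
  set c₁ := max 2 (4 * (κ + V) / ω) with hc₁
  have hV : 0 ≤ V := hv.1.trans hv.2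
  have hκ0 : 0 ≤ κ := le_trans (by positivity) hκ
  have h2 : 2 ≤ c₁ := le_max_left _ _
  have h4 : 4 * (κ + V) / ω ≤ c₁ := le_max_right _ _
  have hk1 : (1 : ℝ) ≤ ((max k 1 : ℕ) : ℝ) := by exact_mod_cast le_max_right _ _
  have hkk : (k : ℝ) ≤ ((max k 1 : ℕ) : ℝ) := by exact_mod_cast le_max_left _ _
  have hN1 : (0 : ℝ) < ((max N 1 : ℕ) : ℝ) := by positivity
  have hnorm : ‖q‖ₑ = 1 := by
    rw [← ofReal_norm, norm_displacedKet]; simp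
  have hRs := isSymmetric_freeInverse (Λ := Λ) hω α
  have hW := isSymmetric_particleOp γ v
  -- The window is well separated from the free energy `ω N`.
  by_cases hfar : 2 * k < N ∧ 4 * (κ + V) ≤ ω * N
  · obtain ⟨hkN, hcN⟩ := hfar
    have hN0 : 1 ≤ N := by omega
    have hN0' : (0 : ℝ) < N := by exact_mod_cast hN0
    have hkN' : 2 * (k : ℝ) < N := by exact_mod_cast hkN
    have hd : 0 < ω * N / 4 := by positivity
    have hy : (((ω * N : ℝ) : ℂ) + 1) • R q = q := by
      have h := freeInverse_displacedKet hω α y ξ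
      rw [h, smul_smul, mul_inv_cancel₀ (ofReal_add_one_ne_zero hω ξ), one_smul]
    have hWq : ‖W q‖ ≤ κ + V :=
      (norm_particleOp_displacedKet_le hγ (α / ω) y hv ξ).trans (by linarith)
    refine (tsum_indicator_eigProj_sq_le hRs hW hd hy hWq fun E hE => ?_).trans ?_
    · have h1 := hE.2
      have h3 : ω * (2 * k) ≤ ω * N := mul_le_mul_of_nonneg_left hkN'.le hω.le
      linarith
    · gcongr
      rw [max_eq_left hN0]
      calc (κ + V) / (ω * N / 4) = 4 * (κ + V) / ω * (1 / N) := by field_simp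
        _ ≤ c₁ * (((max k 1 : ℕ) : ℝ) / N) := by gcongr
  -- Otherwise the bound is at least one, and Bessel's inequality suffices.
  · have h1 : 1 ≤ c₁ * (((max k 1 : ℕ) : ℝ) / ((max N 1 : ℕ) : ℝ)) := by
      rw [← mul_div_assoc, one_le_div hN1]
      have h5 : c₁ ≤ c₁ * ((max k 1 : ℕ) : ℝ) := le_mul_of_one_le_right (by linarith) hk1
      have h6 : 2 * ((max k 1 : ℕ) : ℝ) ≤ c₁ * ((max k 1 : ℕ) : ℝ) := by gcongr
      rw [Nat.cast_max, max_le_iff, Nat.cast_one]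
      refine ⟨?_, by linarith⟩
      rw [not_and_or, not_lt, not_le] at hfar
      rcases hfar with h | h
      · have : (N : ℝ) ≤ 2 * k := by exact_mod_cast h
        linarith
      · have : (N : ℝ) < 4 * (κ + V) / ω := by rwa [lt_div_iff₀' hω]
        linarith
    calc ∑' E : ℝ, (energyWindow D γ ω V k).indicator (fun E => ‖eigProj R W E q‖ₑ ^ 2) E
        ≤ ∑' E : ℝ, ‖eigProj R W E q‖ₑ ^ 2 :=
          ENNReal.tsum_le_tsum fun E => Set.indicator_le_self _ _ E
      _ ≤ ‖q‖ₑ ^ 2 := tsum_enorm_eigProj_sq_le hRs hW q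
      _ = ENNReal.ofReal 1 ^ 2 := by rw [hnorm, ENNReal.ofReal_one]
      _ ≤ _ := by gcongr

/-- The fractional moment of the Green function summed over the final oscillator configuration and
integrated over the energies in `J`. -/
def greenMoment (s γ ω : ℝ) (α : ℂ) (x y : Λ) (ξ : Config Λ) (J : Set ℝ) (v : Λ → ℝ) : ℝ≥0∞ :=
  ∑' l : Config Λ, ∫⁻ E in J, ‖greenFunction γ ω α v x l y ξ (E : ℂ)‖ₑ ^ s

theorem measurable_enorm_greenFunction_rpow (s γ : ℝ) {ω : ℝ} (hω : 0 < ω) (α : ℂ) (x : Λ)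
    (m : Config Λ) (y : Λ) (ξ : Config Λ) : Measurable (Function.uncurry
      fun (v : Λ → ℝ) (E : ℝ) => ‖greenFunction γ ω α v x m y ξ (E : ℂ)‖ₑ ^ s) :=
  (measurable_greenFunction γ hω α x m y ξ).enorm.pow_const s

theorem measurable_greenMoment (s γ : ℝ) {ω : ℝ} (hω : 0 < ω) (α : ℂ) (x y : Λ) (ξ : Config Λ)
    (J : Set ℝ) : Measurable (greenMoment s γ ω α x y ξ J) :=
  Measurable.tsum fun l =>
    (measurable_enorm_greenFunction_rpow s γ hω α x l y ξ).lintegral_prod_right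

theorem lintegral_greenMoment (s γ : ℝ) {ω : ℝ} (hω : 0 < ω) (α : ℂ) (x y : Λ) (ξ : Config Λ)
    (J : Set ℝ) (μ : Measure (Λ → ℝ)) [SFinite μ] :
    ∫⁻ v, greenMoment s γ ω α x y ξ J v ∂μ =
      ∑' l : Config Λ, ∫⁻ E in J, ∫⁻ v, ‖greenFunction γ ω α v x l y ξ (E : ℂ)‖ₑ ^ s ∂μ := by
  simp only [greenMoment]
  rw [lintegral_tsum fun l =>
    (measurable_enorm_greenFunction_rpow s γ hω α x l y ξ).lintegral_prod_right.aemeasurable]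
  refine tsum_congr fun l => ?_
  exact lintegral_lintegral_swap (measurable_enorm_greenFunction_rpow s γ hω α x l y ξ).aemeasurable

/-- The local moments of the eigenfunctions, averaged over the potential at `x`, are bounded by the
fractional moment of the Green function for any value `t'` of the potential at `x`. -/
theorem lintegral_tsum_eigProj_update_le {s : ℝ} (hs0 : 0 < s) (hs1 : s < 1) {V : ℝ} (hV : 0 < V)
    (γ : ℝ) {ω : ℝ} (hω : 0 < ω) (α : ℂ) (x y : Λ) (m ξ : Config Λ) {J : Set ℝ}
    (hJ : MeasurableSet J) (v : Λ → ℝ) {t' : ℝ} (ht' : t' ∈ Set.Icc 0 V) :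
    ∫⁻ t in Set.Icc 0 V, ∑' E : ℝ, J.indicator (fun E =>
        ‖eigProj (freeInverse Λ hω α) (particleOp γ (Function.update v x t)) E
          (displacedKet (α / ω) x m)‖ₑ ^ (2 - s) *
        ‖eigProj (freeInverse Λ hω α) (particleOp γ (Function.update v x t)) E
          (displacedKet (α / ω) y ξ)‖ₑ ^ s) E ≤
      ENNReal.ofReal V ^ s * (2 * ENNReal.ofReal (weightBound (V + 2))) *
        greenMoment s γ ω α x y ξ J (Function.update v x t') := by
  obtain ⟨W, hW, hWt⟩ : ∃ W : Space Λ →L[ℂ] Space Λ, W.IsSymmetric ∧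
      ∀ t : ℝ, particleOp γ (Function.update v x t) = W + (t : ℂ) • hop x x :=
    ⟨_, isSymmetric_particleOp γ _, particleOp_update γ v x⟩
  simp only [greenMoment, greenFunction_eq γ hω, hWt]
  exact lintegral_tsum_eigProj_rpow_le (isCompactOperator_freeInverse hω α)
    (isSymmetric_freeInverse hω α) hW (isSymmetric_hop x) (hop_hop x)
    (fun q : State Λ => displacedKet (α / ω) q.1 q.2) (displacedKet_complete (α / ω))
    (φ := displacedKet (α / ω) x) (norm_displacedKet (α / ω) x) (hop_displacedKet_self (α / ω) x)
    (enorm_inner_hop_le (α / ω) x) hs0 hs1 hV ht' hJ m _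

end Holstein

end

theorem theorem1p7 (s : ℝ) (hs0 : 0 < s) (hs1 : s < 1) (V : ℝ) (ρ : ℝ → ℝ)
    (hρ_meas : Measurable ρ) (hρ_nonneg : ∀ t, 0 ≤ ρ t) (hρ_bdd : ∃ B, ∀ t, ρ t ≤ B)
    (hρ_supp : Function.support ρ ⊆ Set.Icc 0 V)
    (hρ_mass : ∫⁻ t, ENNReal.ofReal (ρ t) = 1) (ω : ℝ) (hω : 0 < ω) (κ : ℝ) :
    ∃ C : ℝ, 0 < C ∧
      ∀ (D : ℕ) (γ : ℝ) (_ : 0 ≤ γ) (_ : 4 * D * γ ≤ κ) (α : ℂ) (Λ : Finset (Fin D → ℤ))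
        (k : ℕ) (x y : Λ) (m ξ : Holstein.Config Λ),
        ∫⁻ v, Holstein.correlator γ ω α v x m y ξ (Holstein.energyWindow D γ ω V k)
            ∂(Holstein.disorderLaw ρ Λ) ≤
          ENNReal.ofReal
              (C * (((max k 1 : ℕ) : ℝ) / ((max (Holstein.excitation ξ) 1 : ℕ) : ℝ)) ^
                (1 - s / (2 - s))) *
            (∑' l : Holstein.Config Λ, ∫⁻ E in Holstein.energyWindow D γ ω V k,
              ∫⁻ v, ‖Holstein.greenFunction γ ω α v x l y ξ (E : ℂ)‖ₑ ^ s
                ∂(Holstein.disorderLaw ρ Λ)) ^ (1 / (2 - s)) := by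
  obtain ⟨B, hB⟩ := hρ_bdd
  have h2s : 0 < 2 - s := by linarith
  set ν : Measure ℝ := volume.withDensity fun t => ENNReal.ofReal (ρ t) with hν
  have hνprob : IsProbabilityMeasure ν :=
    ⟨by rw [hν, withDensity_apply _ MeasurableSet.univ, Measure.restrict_univ, hρ_mass]⟩
  have hνI : ∀ᵐ t ∂ν, t ∈ Set.Icc 0 V := by
    rw [hν, ae_withDensity_iff hρ_meas.ennreal_ofReal]
    refine Filter.Eventually.of_forall fun t ht => hρ_supp ?_
    intro h0
    rw [h0, ENNReal.ofReal_zero] at ht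
    exact ht rfl
  -- A density cannot be supported in a set of at most one point.
  have hV : 0 < V := by
    by_contra hV
    have h0 : volume (Set.Icc 0 V) = 0 := by
      rw [Real.volume_Icc, ENNReal.ofReal_eq_zero]; linarith
    have h1 : ν (Set.Icc 0 V) = 0 := withDensity_absolutelyContinuous _ _ h0
    rw [prob_compl_eq_zero_iff measurableSet_Icc |>.1 hνI] at h1
    exact one_ne_zero h1
  have hνle : ν ≤ ENNReal.ofReal B • volume := by
    rw [hν, ← withDensity_const]
    exact withDensity_mono (Filter.Eventually.of_forall fun t => ENNReal.ofReal_le_ofReal (hB t))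
  set K₀ : ℝ≥0∞ := ENNReal.ofReal B *
    (ENNReal.ofReal V ^ s * (2 * ENNReal.ofReal (weightBound (V + 2)))) with hK₀
  have hK₀top : K₀ ≠ ∞ := by
    refine ENNReal.mul_ne_top ENNReal.ofReal_ne_top (ENNReal.mul_ne_top ?_ ?_)
    · exact ENNReal.rpow_ne_top_of_nonneg hs0.le ENNReal.ofReal_ne_top
    · exact ENNReal.mul_ne_top (by simp) ENNReal.ofReal_ne_top
  set c₁ : ℝ := max 2 (4 * (κ + V) / ω) with hc₁
  have hc₁pos : 0 < c₁ := lt_of_lt_of_le two_pos (le_max_left _ _)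
  set θ : ℝ := 1 - s / (2 - s) with hθ
  have hθ' : 2 * ((1 - s) / (2 - s)) = θ := by rw [hθ]; field_simp; ring
  -- Adding one keeps the constant positive even if `B ≤ 0` has not been excluded.
  refine ⟨c₁ ^ θ * (K₀.toReal + 1) ^ (1 / (2 - s)), by positivity, ?_⟩
  intro D γ hγ hκ α Λ k x y m ξ
  set J := Holstein.energyWindow D γ ω V k with hJ
  have hJm : MeasurableSet J := measurableSet_Icc
  set r : ℝ := ((max k 1 : ℕ) : ℝ) / ((max (Holstein.excitation ξ) 1 : ℕ) : ℝ) with hr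
  have hr0 : 0 ≤ r := by positivity
  set b : ℝ≥0∞ := ENNReal.ofReal (c₁ * r) ^ 2 with hb
  set A : (Λ → ℝ) → ℝ≥0∞ := fun v => b ^ (1 - s) * ∑' E : ℝ, J.indicator (fun E =>
    ‖CompactResolvent.eigProj (Holstein.freeInverse Λ hω α) (Holstein.particleOp γ v) E
      (Holstein.displacedKet (α / ω) x m)‖ₑ ^ (2 - s) *
    ‖CompactResolvent.eigProj (Holstein.freeInverse Λ hω α) (Holstein.particleOp γ v) E
      (Holstein.displacedKet (α / ω) y ξ)‖ₑ ^ s) E with hA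
  have hbtop : b ^ (1 - s) ≠ ∞ :=
    ENNReal.rpow_ne_top_of_nonneg (by linarith) (ENNReal.pow_ne_top ENNReal.ofReal_ne_top)
  have hmain := lintegral_pi_le_of_forall_update ν measurableSet_Icc hνI
    (F := fun v => Holstein.correlator γ ω α v x m y ξ J) (A := A)
    (Holstein.measurable_greenMoment s γ hω α x y ξ J) (p := 2 - s) (by linarith) x
    (b ^ (1 - s) * K₀) ?_ ?_
  · change ∫⁻ v, Holstein.correlator γ ω α v x m y ξ J ∂(Measure.pi fun _ => ν) ≤ _
    refine hmain.trans ?_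
    rw [Holstein.lintegral_greenMoment s γ hω,
      ENNReal.mul_rpow_of_nonneg _ _ (by positivity : 0 ≤ 1 / (2 - s)),
      ENNReal.mul_rpow_of_nonneg _ _ (by positivity : 0 ≤ 1 / (2 - s))]
    refine mul_le_mul_left ?_ _
    have hb' : (b ^ (1 - s)) ^ (1 / (2 - s)) = ENNReal.ofReal (c₁ ^ θ * r ^ θ) := by
      have h1 : 0 ≤ θ := by
        rw [← hθ']
        have : 0 ≤ 1 - s := by linarith
        positivity
      rw [← Real.mul_rpow hc₁pos.le hr0, ← ENNReal.ofReal_rpow_of_nonneg (by positivity) h1, hb,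
        ← ENNReal.rpow_mul, ← ENNReal.rpow_natCast, ← ENNReal.rpow_mul, ← hθ']
      congr 1
      push_cast
      ring
    have hK' : K₀ ^ (1 / (2 - s)) ≤ ENNReal.ofReal ((K₀.toReal + 1) ^ (1 / (2 - s))) := by
      rw [← ENNReal.ofReal_rpow_of_nonneg (by positivity) (by positivity)]
      refine ENNReal.rpow_le_rpow ?_ (by positivity)
      exact (ENNReal.ofReal_toReal hK₀top).symm.le.trans
        (ENNReal.ofReal_le_ofReal (by linarith))
    rw [hb']
    refine (mul_le_mul_right hK' _).trans ?_
    rw [← ENNReal.ofReal_mul (by positivity)]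
    refine ENNReal.ofReal_le_ofReal (le_of_eq ?_)
    ring
  · intro v hv
    have h1 := (Holstein.correlator_le γ hω α v x m y ξ J).trans
      (CompactResolvent.tsum_indicator_inner_eigProj_le hs0 hs1 J _ _)
    have h2 := Holstein.tsum_energyWindow_eigProj_sq_le hγ hκ hω α (v := v) k y (hv y) ξ
    have h3 : 0 ≤ (1 - s) / (2 - s) := div_nonneg (by linarith) h2s.le
    refine (ENNReal.rpow_le_rpow (h1.trans (mul_le_mul_right (ENNReal.rpow_le_rpow h2 h3) _))
      h2s.le).trans (le_of_eq ?_)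
    rw [ENNReal.mul_rpow_of_nonneg _ _ h2s.le, ← ENNReal.rpow_mul, ← ENNReal.rpow_mul,
      one_div_mul_cancel h2s.ne', div_mul_cancel₀ _ h2s.ne', ENNReal.rpow_one, mul_comm]
  · intro v t' ht'
    simp only [hA]
    rw [lintegral_const_mul' _ _ hbtop, mul_assoc]
    refine mul_le_mul_right ?_ _
    have h1 := Holstein.lintegral_tsum_eigProj_update_le hs0 hs1 hV γ hω α x y m ξ hJm v ht'
    refine (lintegral_mono' (Measure.restrict_mono le_rfl hνle) le_rfl).trans ?_
    rw [Measure.restrict_smul, lintegral_smul_measure, hK₀, mul_assoc, smul_eq_mul]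
    exact mul_le_mul_right h1 _
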